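/- **Setting.** A magma is a finite non-empty set $\Gamma$ with a binary operation $\circ$. A *binary structure* $(q,O_1,O_2)$ for it consists of an integer $q\ge|\Gamma|$ and, for some injective encoding $\pi:\Gamma\to\{0,1\}^{\lceil\log_2 q\rceil}$, an oracle $O_1$ that returns $\pi(x)$ for a uniformly random $x\in\Gamma$ and an oracle $O_2$ that maps $(\pi(x),\pi(y))$ to $\pi(x\circ y)$. The Hamming distance of two operations on $\Gamma$ is the number of pairs on which they differ. The edit distance of two magmas is the minimum, over their multiplication tables (with elements labelled by natural numbers), of the total cost of transforming one table into the other by exchanges of one entry (cost $1$), insertions of an element into a table of size $k$ (cost $2k+1$) and deletions of an element from a table of size $k$ (cost $2k-1$). $(\Gamma,\circ)$ is $\epsilon$-far from the cyclic groups if its distance (Hamming: to every cyclic group operation on $\Gamma$; edit: to every finite cyclic group) is at least $\epsilon|\Gamma|^2$. An $\epsilon$-tester for cyclic groups outputs PASS with probability at least $2/3$ if $(\Gamma,\circ)$ is a cyclic group, and FAIL with probability at least $2/3$ if $(\Gamma,\circ)$ is $\epsilon$-far from the cyclic groups. **Algorithm $\mathrm{CyclicTest}_\epsilon$.** The input is a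 binary structure for $(\Gamma,\circ)$, the size $m=|\Gamma|$ and its factorization $m=p_1^{e_1}\cdots p_r^{e_r}$ into powers of distinct primes. Let $C_m=\{0,\dots,m-1\}$ be the integers modulo $m$ and $C_{m,i}$ its subgroup of order $p_i$. For $\gamma\in\Gamma$ define $f_\gamma:C_m\to\Gamma$ by $f_\gamma(1)=\gamma$; $f_\gamma(a)=\gamma\circ f_\gamma(a-1)$ for odd $a\ge2$; $f_\gamma(a)=f_\gamma(a/2)\circ f_\gamma(a/2)$ for even $a\ge 2$; $f_\gamma(0)=\gamma\circ f_\gamma(m-1)$ (for $m=1$, $f_\gamma(0)=\gamma$). With $d_1=\Theta(\log\log m)$, $d_2=\Theta(\epsilon^{-1}\log\log\log m)$ and $d_3=\Theta(\log\log\log m)$, the following round is repeated until it ends with the decision PASS, at most $d_1+1$ times: set the decision to PASS; choose $\gamma\in\Gamma$ uniformly at random; $d_2$ times, choose $x,y\in C_m$ uniformly at random, and set the decision to FAIL if $f_\gamma(x+y)\ne f_\gamma(x)\circ f_\gamma(y)$; for each $i=1,\dots,r$ take two arbitrary distinct $x,y\in C_{m,i}$, choose $u_1,\dots,u_{d_3}\in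 C_m$ uniformly at random, and set the decision to FAIL if $f_\gamma(x+u_j)=f_\gamma(y+u_j)$ for some $j$. The output is the last decision. **Theorem.** The constants hidden in $d_1,d_2,d_3$ can be chosen such that, for every $\epsilon>0$ and for every choice of the arbitrary pairs, $\mathrm{CyclicTest}_\epsilon$ is an $\epsilon$-tester for cyclic groups, when $m=|\Gamma|$ and its factorization are known, with respect to both the edit distance and the Hamming distance. Both its number of oracle queries and its running time are, in the worst case, $$O\!\left(\Bigl(\log m+\frac{\log\log m}{\epsilon}\Bigr)\cdot\log q\cdot\log\log\log m\right),$$ with an absolute constant. Here $\log t$ is read as $\max(1,\log_2 t)$, and $1/\epsilon$ as $\lceil 1/\epsilon\rceil$ in the definition of $d_2$. Time is counted on a randomized machine with words of $\lceil\log_2 q\rceil+\lceil\log_2\lceil1/\epsilon\rceil\rceil+O(1)$ bits, where an oracle call and an operation on words cost one step, copying or comparing encoded elements costs their length $\lceil\log_2 q\rceil$ per string, and drawing a uniform random number below $n$ costs one step for each binary digit of $n$ in addition. -/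

import Mathlib

universe u

noncomputable section

namespace CyclicTesting

/-! ## Magmas, distances and distance to a class of groups

A magma on `Γ` is a binary operation `op : Γ → Γ → Γ`. -/

/-- A class of groups. -/
def GroupClass : Type (u + 1) := (G : Type u) → Group G → Prop

/-- The class of cyclic groups. -/
def cyclicGroups : GroupClass.{u} := fun G _ => IsCyclic G

/-- The magma `(Γ, op)` is a group, and this group belongs to the class `𝒞`. -/
def IsGroupIn (𝒞 : GroupClass.{u}) {Γ : Type u} (op : Γ → Γ → Γ) : Prop :=
  ∃ g : Group Γ, (∀ x y : Γ, x * y = op x y) ∧ 𝒞 Γ g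

/-- Hamming distance between two operations on the same finite ground set. -/
def hamming {Γ : Type u} (op op' : Γ → Γ → Γ) : ℕ :=
  Set.ncard {z : Γ × Γ | op z.1 z.2 ≠ op' z.1 z.2}

/-- A table: a function `Π × Π → ℕ` for a finite set `Π` of natural numbers. -/
structure Table where
  dom : Finset ℕ
  val : dom → dom → ℕ

/-- `T'` arises from `T` by adding the new element `a` to the domain; the old values are kept and
the new ones are arbitrary. -/
structure Table.IsExtension (T T' : Table) (a : ℕ) : Prop where
  notMem : a ∉ T.dom
  dom_eq : T'.dom = insert a T.dom
  val_eq : ∀ (x y : T.dom) (x' y' : T'.dom), (x' : ℕ) = x → (y' : ℕ) = y →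
    T'.val x' y' = T.val x y

/-- `EditStep T T' c`: a single exchange, insert or delete operation of cost `c` leads from
`T` to `T'`. -/
inductive EditStep : Table → Table → ℕ → Prop
  | exchange (T : Table) (a b : T.dom) (v : ℕ) :
      EditStep T ⟨T.dom, fun x y => if x = a ∧ y = b then v else T.val x y⟩ 1
  | insert (T T' : Table) (a : ℕ) (h : T.IsExtension T' a) :
      EditStep T T' (2 * T.dom.card + 1)
  | delete (T T' : Table) (a : ℕ) (h : T'.IsExtension T a) :
      EditStep T T' (2 * T.dom.card - 1)

/-- `EditPath T T' c`: a finite sequence of operations of total cost `c` transforms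
`T` into `T'`. -/
inductive EditPath : Table → Table → ℕ → Prop
  | refl (T : Table) : EditPath T T 0
  | step {T T' T'' : Table} {c d : ℕ} (h : EditPath T T' c) (s : EditStep T' T'' d) :
      EditPath T T'' (c + d)

/-- Edit distance between tables. -/
def Table.editDist (T T' : Table) : ℕ := sInf {c | EditPath T T' c}

/-- `T` is a multiplication table for the magma `(Γ, op)`. -/
def IsMulTable {Γ : Type u} (op : Γ → Γ → Γ) (T : Table) : Prop :=
  ∃ σ : T.dom ≃ Γ, ∀ a b : T.dom, T.val a b = (σ.symm (op (σ a) (σ b)) : ℕ)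

/-- Edit distance between two finite magmas. -/
def editDist {Γ Γ' : Type u} (op : Γ → Γ → Γ) (op' : Γ' → Γ' → Γ') : ℕ :=
  sInf {d | ∃ T T' : Table, IsMulTable op T ∧ IsMulTable op' T' ∧ d = T.editDist T'}

/-- `(Γ, op)` is `δ`-far from `𝒞` with respect to the Hamming distance. -/
def HammingFar (𝒞 : GroupClass.{u}) (δ : ℝ) (Γ : Type u) (op : Γ → Γ → Γ) : Prop :=
  ∀ op' : Γ → Γ → Γ, IsGroupIn 𝒞 op' → δ * (Nat.card Γ : ℝ) ^ 2 ≤ hamming op op'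

/-- `(Γ, op)` is `δ`-far from `𝒞` with respect to the edit distance. -/
def EditFar (𝒞 : GroupClass.{u}) (δ : ℝ) (Γ : Type u) (op : Γ → Γ → Γ) : Prop :=
  ∀ (Γ' : Type u) [Finite Γ'] (op' : Γ' → Γ' → Γ'), IsGroupIn 𝒞 op' →
    δ * (Nat.card Γ : ℝ) ^ 2 ≤ editDist op op'

/-! ## Inputs and testers -/

/-- Binary strings of length `ℓ`. -/
abbrev BitString (ℓ : ℕ) : Type := Fin ℓ → Bool

/-- What an algorithm receives when the size of the ground set and its factorization are known:
the integer `q`, the two oracles on strings of length `⌈log₂ q⌉`, the size `m`, and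
`m = ∏ i, p i ^ e i`. -/
structure Instance where
  q : ℕ
  O₁ : PMF (BitString (Nat.clog 2 q))
  O₂ : BitString (Nat.clog 2 q) → BitString (Nat.clog 2 q) → BitString (Nat.clog 2 q)
  m : ℕ
  r : ℕ
  p : Fin r → ℕ
  e : Fin r → ℕ

/-- `(q, O₁, O₂)` is a binary structure for the magma `(Γ, op)`. -/
def Instance.IsBinaryStructure (I : Instance) {Γ : Type u} [Fintype Γ] [Nonempty Γ]
    (op : Γ → Γ → Γ) : Prop :=
  Fintype.card Γ ≤ I.q ∧
    ∃ π : Γ → BitString (Nat.clog 2 I.q), Function.Injective π ∧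
      I.O₁ = (PMF.uniformOfFintype Γ).map π ∧
      ∀ x y : Γ, I.O₂ (π x) (π y) = π (op x y)

/-- The instance presents the magma `(Γ, op)`: its oracles form a binary structure for it, and
it gives the correct size of `Γ` with the factorization of this size into powers of distinct
primes. -/
structure Instance.Presents (I : Instance) {Γ : Type u} [Fintype Γ] [Nonempty Γ]
    (op : Γ → Γ → Γ) : Prop where
  binary : I.IsBinaryStructure op
  size : I.m = Fintype.card Γ
  prime : ∀ i, (I.p i).Prime
  distinct : Function.Injective I.p
  exponent_pos : ∀ i, 0 < I.e i
  factorization : I.m = ∏ i, I.p i ^ I.e i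

/-- `A` maps each instance to the distribution of its output (`true` is PASS, `false` is FAIL).
It is a tester for the class `𝒞`, when size and factorization are known, with respect to the
notion `far` of being far from `𝒞`. -/
def IsTester (𝒞 : GroupClass.{u}) (far : (Γ : Type u) → (Γ → Γ → Γ) → Prop)
    (A : Instance → PMF Bool) : Prop :=
  ∀ (Γ : Type u) [Fintype Γ] [Nonempty Γ] (op : Γ → Γ → Γ) (I : Instance), I.Presents op →
    (IsGroupIn 𝒞 op → 2 / 3 ≤ A I true) ∧ (far Γ op → 2 / 3 ≤ A I false)

/-! ## A randomized word machine with oracles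

Programs of a small imperative language, with integer registers (words of `w` bits, arithmetic
modulo `2 ^ w`), string registers (binary strings of length `ℓ`), read-only input arrays and two
oracles. Time is charged as follows: one step for each node of an arithmetic expression, each
assignment, each test, each pass through a loop and each oracle call; in addition, a string that
is copied or compared costs its length, and drawing a random number from `{0, …, n - 1}` costs
the number of binary digits of `n`. -/

/-- Integer registers. -/
inductive IVar
  | m | r | len | len₂ | len₃ | d₁ | d₂ | d₃ | decision
  | i | x | y | u | s | step | j | bit | started | tmp
  deriving DecidableEq

/-- String registers. -/
inductive SVar
  | gamma | f | g | h
  deriving DecidableEq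

/-- Read-only input arrays. -/
inductive Arr
  | prime | fst | snd

/-- Arithmetic expressions. -/
inductive Expr
  | lit (n : ℕ)
  | var (v : IVar)
  | read (A : Arr) (i : Expr)
  | add (a b : Expr)
  | sub (a b : Expr)
  | mul (a b : Expr)
  | div (a b : Expr)
  | mod (a b : Expr)
  | shiftRight (a b : Expr)

/-- Tests. -/
inductive Test
  | always
  | eq (a b : Expr)
  | lt (a b : Expr)
  | strEq (s t : SVar)

/-- Programs. `loop n t body` evaluates `n` once and then executes `body` at most `n` times;
before each pass it performs the test `t` and leaves the loop if `t` does not hold. -/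
inductive Cmd
  | skip
  | assign (v : IVar) (e : Expr)
  | rand (v : IVar) (n : Expr)
  | copy (s t : SVar)
  | sample (s : SVar)
  | query (s t₁ t₂ : SVar)
  | seq (c d : Cmd)
  | ite (t : Test) (c d : Cmd)
  | loop (n : Expr) (t : Test) (body : Cmd)

/-- What stays fixed during a computation: the word length, the oracles and the arrays. -/
structure Env (ℓ : ℕ) where
  w : ℕ
  O₁ : PMF (BitString ℓ)
  O₂ : BitString ℓ → BitString ℓ → BitString ℓ
  arr : Arr → ℕ → ℕ

/-- Contents of the registers, with the numbers of oracle queries and of steps made so far. -/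
structure Config (ℓ : ℕ) where
  int : IVar → ℕ
  str : SVar → BitString ℓ
  queries : ℕ
  time : ℕ

/-- Charge `t` steps. -/
def Config.tick {ℓ : ℕ} (c : Config ℓ) (t : ℕ) : Config ℓ := { c with time := c.time + t }

/-- Charge one oracle query. -/
def Config.tickQuery {ℓ : ℕ} (c : Config ℓ) : Config ℓ := { c with queries := c.queries + 1 }

/-- Write an integer register. -/
def Config.setInt {ℓ : ℕ} (c : Config ℓ) (v : IVar) (k : ℕ) : Config ℓ :=
  { c with int := Function.update c.int v k }

/-- Write a string register. -/
def Config.setStr {ℓ : ℕ} (c : Config ℓ) (s : SVar) (v : BitString ℓ) : Config ℓ :=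
  { c with str := Function.update c.str s v }

/-- Value of an expression. Subtraction is truncated at zero. -/
def Expr.eval {ℓ : ℕ} (E : Env ℓ) (c : Config ℓ) : Expr → ℕ
  | lit n => n % 2 ^ E.w
  | var v => c.int v
  | read A i => E.arr A (i.eval E c)
  | add a b => (a.eval E c + b.eval E c) % 2 ^ E.w
  | sub a b => a.eval E c - b.eval E c
  | mul a b => (a.eval E c * b.eval E c) % 2 ^ E.w
  | div a b => a.eval E c / b.eval E c
  | mod a b => a.eval E c % b.eval E c
  | shiftRight a b => a.eval E c >>> b.eval E c

/-- Cost of an expression: its number of nodes. -/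
def Expr.cost : Expr → ℕ
  | lit _ => 1
  | var _ => 1
  | read _ i => i.cost + 1
  | add a b => a.cost + b.cost + 1
  | sub a b => a.cost + b.cost + 1
  | mul a b => a.cost + b.cost + 1
  | div a b => a.cost + b.cost + 1
  | mod a b => a.cost + b.cost + 1
  | shiftRight a b => a.cost + b.cost + 1

/-- Result of a test. -/
def Test.eval {ℓ : ℕ} (E : Env ℓ) (c : Config ℓ) : Test → Bool
  | always => true
  | eq a b => decide (a.eval E c = b.eval E c)
  | lt a b => decide (a.eval E c < b.eval E c)
  | strEq s t => decide (c.str s = c.str t)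

/-- Cost of a test; comparing two strings means reading both of them. -/
def Test.cost (ℓ : ℕ) : Test → ℕ
  | always => 1
  | eq a b => a.cost + b.cost + 1
  | lt a b => a.cost + b.cost + 1
  | strEq _ _ => 2 * ℓ + 1

/-- The uniform distribution on `{0, …, n - 1}` (for `n = 0` the point mass at `0`). -/
def uniformBelow (n : ℕ) : PMF ℕ :=
  if h : n = 0 then PMF.pure 0
  else PMF.uniformOfFinset (Finset.range n) (Finset.nonempty_range_iff.mpr h)

/-- At most `n` passes through a loop with the test `t` and the given body. -/
def loopExec {ℓ : ℕ} (E : Env ℓ) (t : Test) (body : Config ℓ → PMF (Config ℓ)) :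
    ℕ → Config ℓ → PMF (Config ℓ)
  | 0, c => PMF.pure c
  | n + 1, c =>
      if t.eval E c then (body (c.tick (t.cost ℓ + 1))).bind (loopExec E t body n)
      else PMF.pure (c.tick (t.cost ℓ + 1))

/-- Semantics of programs: the distribution of the final configuration. -/
def Cmd.exec {ℓ : ℕ} (E : Env ℓ) : Cmd → Config ℓ → PMF (Config ℓ)
  | skip => fun c => PMF.pure c
  | assign v e => fun c => PMF.pure ((c.setInt v (e.eval E c)).tick (e.cost + 1))
  | rand v n => fun c =>
      (uniformBelow (n.eval E c)).map fun k =>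
        (c.setInt v k).tick (n.cost + 1 + Nat.size (n.eval E c))
  | copy s t => fun c => PMF.pure ((c.setStr s (c.str t)).tick (ℓ + 1))
  | sample s => fun c => E.O₁.map fun z => ((c.setStr s z).tick 1).tickQuery
  | query s t₁ t₂ => fun c =>
      PMF.pure (((c.setStr s (E.O₂ (c.str t₁) (c.str t₂))).tick 1).tickQuery)
  | seq p p' => fun c => (p.exec E c).bind (p'.exec E)
  | ite t p p' => fun c =>
      if t.eval E c then p.exec E (c.tick (t.cost ℓ)) else p'.exec E (c.tick (t.cost ℓ))
  | loop n t body => fun c => loopExec E t (body.exec E) (n.eval E c) (c.tick (n.cost + 1))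

/-- Sequential composition of a list of programs. -/
def Cmd.block : List Cmd → Cmd
  | [] => Cmd.skip
  | c :: cs => Cmd.seq c (Cmd.block cs)

/-! ## The algorithm -/

/-- The powers `f_γ(a)` of an element `γ` of a magma, for `a ≥ 1`: `f_γ(1) = γ`, and for `a ≥ 2`
`f_γ(a) = f_γ(a/2) ∘ f_γ(a/2)` if `a` is even and `f_γ(a) = γ ∘ f_γ(a-1)` if `a` is odd. The value
at `0` is a convention, needed only for a ground set with one element. -/
def power {Γ : Type u} (op : Γ → Γ → Γ) (γ : Γ) (a : ℕ) : Γ :=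
  if a ≤ 1 then γ
  else if a % 2 = 0 then op (power op γ (a / 2)) (power op γ (a / 2))
  else op γ (power op γ (a - 1))
termination_by a
decreasing_by all_goals omega

/-- The map `f_γ : {0, …, m - 1} → Γ`: as above for `a ≠ 0`, with `f_γ(0) = γ ∘ f_γ(m - 1)`. -/
def fMap {Γ : Type u} (op : Γ → Γ → Γ) (m : ℕ) (γ : Γ) (a : ℕ) : Γ :=
  if a = 0 then op γ (power op γ (m - 1)) else power op γ a

section Program

open CyclicTesting.Expr CyclicTesting.Test CyclicTesting.Cmd

/-- Sequential composition of a list of programs. -/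
def block : List Cmd → Cmd
  | [] => skip
  | c :: cs => seq c (block cs)

/-- `dst := number of binary digits of src`. -/
def bitLength (dst src : IVar) : Cmd := block [
  assign .tmp (var src),
  assign dst (lit 0),
  loop (var src) (lt (lit 0) (var .tmp)) (block [
    assign .tmp (div (var .tmp) (lit 2)),
    assign dst (add (var dst) (lit 1))])]

/-- One pass of `evalF`: process the binary digit number `j - 1` of the exponent. -/
def powerStep (dst : SVar) : Cmd := block [
  assign .j (sub (var .j) (lit 1)),
  assign .bit (mod (shiftRight (var .tmp) (var .j)) (lit 2)),
  ite (eq (var .started) (lit 1))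
    (block [
      query dst dst dst,
      ite (eq (var .bit) (lit 1)) (query dst .gamma dst) skip])
    (assign .started (var .bit))]

/-- `dst := f_γ(src)`, where `γ` is the content of the register `gamma`. The binary digits of the
exponent are processed from the most significant one downwards. -/
def evalF (dst : SVar) (src : IVar) : Cmd := block [
  copy dst .gamma,
  assign .started (lit 0),
  ite (eq (var src) (lit 0))
    (assign .tmp (sub (var .m) (lit 1)))
    (assign .tmp (var src)),
  assign .j (var .len),
  loop (var .len) always (powerStep dst),
  ite (eq (var src) (lit 0)) (query dst .gamma dst) skip]

/-- One homomorphism test: for random `x, y` in `C_m`, if `f_γ(x + y) ≠ f_γ(x) ∘ f_γ(y)` then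
`decision := FAIL`. -/
def homTest : Cmd := block [
  rand .x (var .m),
  rand .y (var .m),
  assign .s (mod (add (var .x) (var .y)) (var .m)),
  evalF .f .s,
  evalF .g .x,
  evalF .h .y,
  query .g .g .h,
  ite (strEq .f .g) skip (assign .decision (lit 0))]

/-- One injectivity test: for a random `u` in `C_m`, if `f_γ(x + u) = f_γ(y + u)` then
`decision := FAIL`. -/
def injTest : Cmd := block [
  rand .u (var .m),
  assign .s (mod (add (var .x) (var .u)) (var .m)),
  evalF .f .s,
  assign .s (mod (add (var .y) (var .u)) (var .m)),
  evalF .g .s,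
  ite (strEq .f .g) (assign .decision (lit 0)) skip]

/-- The tests for the subgroup `C_{m,i} = {k * (m / p_i) | k < p_i}` of order `p_i` (with `i`
counted from `0`), for two chosen elements `x, y` of it; then `i := i + 1`. -/
def subgroupTest : Cmd := block [
  assign .step (div (var .m) (read .prime (var .i))),
  assign .x (mul (read .fst (var .i)) (var .step)),
  assign .y (mul (read .snd (var .i)) (var .step)),
  loop (var .d₃) always injTest,
  assign .i (add (var .i) (lit 1))]

/-- One pass through the main loop: choose `γ` at random and perform all tests. -/
def mainBody : Cmd := block [
  assign .decision (lit 1),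
  sample .gamma,
  loop (var .d₂) always homTest,
  assign .i (lit 0),
  loop (var .r) always subgroupTest]

/-- The numbers of repetitions: with `L₂` and `L₃` the results of taking the number of binary
digits twice and three times, starting from `m`, set `d₁ = c₁ * L₂` (which is `Θ(log log m)`),
`d₂ = c₂ * N * L₃` (which is `Θ(ε⁻¹ log log log m)` for `N = ⌈1 / ε⌉`) and `d₃ = c₃ * L₃` (which
is `Θ(log log log m)`). -/
def setParameters (N c₁ c₂ c₃ : ℕ) : Cmd := block [
  bitLength .len .m,
  bitLength .len₂ .len,
  bitLength .len₃ .len₂,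
  assign .d₁ (mul (lit c₁) (var .len₂)),
  assign .d₂ (mul (mul (lit c₂) (lit N)) (var .len₃)),
  assign .d₃ (mul (lit c₃) (var .len₃))]

/-- The complete program. The register `decision` holds `0` for FAIL and `1` for PASS. The main
loop is left as soon as a pass ends with `decision = PASS`, and has at most `d₁ + 1` passes, those
with counter `0, …, d₁`. -/
def cyclicTestProgram (N c₁ c₂ c₃ : ℕ) : Cmd := block [
  setParameters N c₁ c₂ c₃,
  assign .decision (lit 0),
  loop (add (var .d₁) (lit 1)) (eq (var .decision) (lit 0)) mainBody]

end Program

section Correctness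
variable {ℓ : ℕ} {Γ : Type u}

/-- The recursion for `power`, two rules at a time. -/
theorem power_step (op : Γ → Γ → Γ) (γ : Γ) (P : ℕ) (h : P / 2 ≠ 0) :
    power op γ P = if P % 2 = 1 then op γ (op (power op γ (P / 2)) (power op γ (P / 2)))
      else op (power op γ (P / 2)) (power op γ (P / 2)) := by
  rw [power, if_neg (by omega)]
  split_ifs with h1 h2 h3
  · omega
  · rfl
  · rw [power, if_neg (by omega), if_pos (by omega), show (P - 1) / 2 = P / 2 by omega]
  · omega

/-- The invariant of the loop in `evalF`. -/
theorem powerLoop (E : Env ℓ) (hw : 1 < E.w) (op : Γ → Γ → Γ) (π : Γ → BitString ℓ)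
    (hO : ∀ x y, E.O₂ (π x) (π y) = π (op x y)) (γ : Γ) (dst : SVar) (hd : dst ≠ .gamma) (b n : ℕ)
    (c : Config ℓ) (hγ : c.str .gamma = π γ) (hb : c.int .tmp = b) (hj : c.int .j = n)
    (hs : c.int .started = if b >>> n = 0 then 0 else 1)
    (hz : c.str dst = π (power op γ (b >>> n))) :
    ∃ c', loopExec E .always ((powerStep dst).exec E) n c = PMF.pure c' ∧
      c'.str .gamma = π γ ∧ c'.str dst = π (power op γ b) ∧
      (∀ v, v ≠ .j → v ≠ .bit → v ≠ .started → c'.int v = c.int v) := by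
  have e1 : 1 % 2 ^ E.w = 1 := Nat.mod_eq_of_lt (Nat.one_lt_two_pow (by omega))
  have e2 : 2 % 2 ^ E.w = 2 := Nat.mod_eq_of_lt
    (lt_of_lt_of_le (by norm_num) (Nat.pow_le_pow_right (n := 2) (by norm_num) (show 2 ≤ E.w from hw)))
  induction n generalizing c with
  | zero => exact ⟨c, rfl, hγ, by simpa using hz, fun _ _ _ _ => rfl⟩
  | succ n ih =>
    rw [Nat.shiftRight_succ] at hs hz
    have hd' : SVar.gamma ≠ dst := hd.symm
    simp only [loopExec, Test.eval, if_true]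
    obtain ⟨c1, h1, h2, h3, h4, h5, h6, h7⟩ : ∃ c1, (powerStep dst).exec E (c.tick (Test.always.cost ℓ + 1))
        = PMF.pure c1 ∧ c1.str .gamma = π γ ∧ c1.int .tmp = b ∧ c1.int .j = n ∧
        (c1.int .started = if b >>> n = 0 then 0 else 1) ∧ c1.str dst = π (power op γ (b >>> n)) ∧
      (∀ v, v ≠ .j → v ≠ .bit → v ≠ .started → c1.int v = c.int v) := by
      by_cases hP : b >>> n / 2 = 0
      · rw [if_pos hP] at hs
        have h01 : b >>> n = 0 ∨ b >>> n = 1 := by omega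
        refine ⟨_, by simp [powerStep, block, Cmd.exec, Expr.eval, Test.eval, Config.tick, Config.setInt, Config.setStr, Config.tickQuery, PMF.pure_bind, e1, e2, hs, hj, hb]; rfl, ?_⟩
        simp +contextual [hγ, hb, hz, Function.update]
        have : power op γ 0 = γ ∧ power op γ 1 = γ := ⟨by rw [power]; simp, by rw [power]; simp⟩
        rw [hP]
        rcases h01 with h | h <;> simp [h, this]
      · rw [if_neg hP] at hs
        have hne : b >>> n ≠ 0 := by omega
        have := power_step op γ _ hP
        by_cases hbit : b >>> n % 2 = 1
        all_goals
          simp only [hbit, if_true, if_false] at this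
          refine ⟨_, by simp [powerStep, block, Cmd.exec, Expr.eval, Test.eval, Config.tick, Config.setInt, Config.setStr, Config.tickQuery, PMF.pure_bind, e1, e2, hs, hj, hb, hbit]; rfl, ?_⟩
          simp +contextual [hγ, hb, hz, Function.update, hne, this, hO, hs, hd']
    rw [h1, PMF.pure_bind]
    obtain ⟨c', g1, g2, g3, g4⟩ := ih c1 h2 h3 h4 h5 h6
    exact ⟨c', g1, g2, g3, fun v a b c => (g4 v a b c).trans (h7 v a b c)⟩

/-- The program `evalF` computes the map `f_γ`. -/
theorem evalF_spec (E : Env ℓ) (hw : 1 < E.w) (op : Γ → Γ → Γ) (π : Γ → BitString ℓ)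
    (hO : ∀ x y, E.O₂ (π x) (π y) = π (op x y)) (γ : Γ) (dst : SVar) (hd : dst ≠ .gamma)
    (src : IVar) (hsrc : src ∈ [IVar.x, .s, .y])
    (c : Config ℓ) (hγ : c.str .gamma = π γ) (hl : c.int .len = Nat.size (c.int .m))
    (hm : c.int src < c.int .m) :
    ∃ c', (evalF dst src).exec E c = PMF.pure c' ∧
      c'.str dst = π (fMap op (c.int .m) γ (c.int src)) := by
  have e1 : 1 % 2 ^ E.w = 1 := Nat.mod_eq_of_lt (Nat.one_lt_two_pow (by omega))
  have hd' : SVar.gamma ≠ dst := hd.symm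
  have ht : src ≠ .tmp ∧ src ≠ .j ∧ src ≠ .bit ∧ src ≠ .started := by
    simp at hsrc; rcases hsrc with h | h | h <;> simp [h]
  obtain ⟨ht1, ht2, ht3, ht4⟩ := ht
  have hsz := Nat.lt_size_self (c.int .m)
  have p0 : power op γ 0 = γ := by rw [power]; simp
  obtain ⟨b, hb⟩ : ∃ b, b = if c.int src = 0 then c.int .m - 1 else c.int src := ⟨_, rfl⟩
  have hbm : b < 2 ^ (c.int .m).size := by split_ifs at hb <;> omega
  have hz : b >>> (c.int .m).size = 0 := by
    rw [Nat.shiftRight_eq_div_pow]; exact Nat.div_eq_of_lt hbm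
  have key : ∃ c0 : Config ℓ, (evalF dst src).exec E c =
        (loopExec E .always ((powerStep dst).exec E) (c.int .m).size c0).bind
          ((block [Cmd.ite (Test.eq (Expr.var src) (Expr.lit 0))
            (Cmd.query dst .gamma dst) Cmd.skip]).exec E) ∧
      c0.str .gamma = π γ ∧ c0.int .tmp = b ∧ c0.int .j = (c.int .m).size ∧
      c0.int .started = 0 ∧ c0.str dst = π γ ∧ c0.int src = c.int src := by
    by_cases h0 : c.int src = 0
    all_goals
      simp only [h0, if_true, if_false] at hb
      refine ⟨_, by simp [evalF, block, Cmd.exec, Expr.eval, Test.eval, PMF.pure_bind, Config.tick, Config.setInt, Config.setStr, h0, ht4, e1, hl]; rfl, ?_⟩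
      simp [Function.update, hγ, hd', hb, ht1, ht2, ht4, h0]
  obtain ⟨c0, k1, k2, k3, k4, k5, k6, k7⟩ := key
  obtain ⟨c', g1, g2, g3, g4⟩ := powerLoop E hw op π hO γ dst hd b _ c0 k2 k3 k4
    (by simpa [hz] using k5) (by simpa [hz, p0] using k6)
  rw [k1, g1, PMF.pure_bind]
  have hs : c'.int src = c.int src := (g4 src ht2 ht3 ht4).trans k7
  by_cases h0 : c.int src = 0
  all_goals
    simp only [h0, if_true, if_false] at hb
    refine ⟨_, by simp [block, Cmd.exec, Expr.eval, Test.eval, Config.tick, hs, h0]; rfl, ?_⟩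
    simp [fMap, h0, g2, g3, hO, hb, Config.setStr, Config.tickQuery]
end Correctness

/-- A rule for the arbitrary choice of two distinct elements of the subgroup of order `p` of
`C_m`: for every prime divisor `p` of `m` two distinct numbers `k < p`, which stand for the
elements `k * (m / p)`. -/
structure PairRule where
  fst : ℕ → ℕ → ℕ
  snd : ℕ → ℕ → ℕ
  fst_lt : ∀ m p, p.Prime → p ∣ m → fst m p < p
  snd_lt : ∀ m p, p.Prime → p ∣ m → snd m p < p
  ne : ∀ m p, p.Prime → p ∣ m → fst m p ≠ snd m p

/-- Word length `⌈log₂ q⌉ + ⌈log₂ ⌈1 / ε⌉⌉ + K`. -/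
def wordLength (ε : ℝ) (K q : ℕ) : ℕ := Nat.clog 2 q + Nat.clog 2 ⌈1 / ε⌉₊ + K

/-- The array of length `n` with the given entries, followed by zeros. -/
def arrayOf {n : ℕ} (v : Fin n → ℕ) (i : ℕ) : ℕ := if h : i < n then v ⟨i, h⟩ else 0

/-- The environment in which the algorithm runs on the instance `I`. -/
def runEnv (ε : ℝ) (K : ℕ) (R : PairRule) (I : Instance) : Env (Nat.clog 2 I.q) where
  w := wordLength ε K I.q
  O₁ := I.O₁
  O₂ := I.O₂
  arr
    | .prime => arrayOf I.p
    | .fst => arrayOf fun i => R.fst I.m (I.p i)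
    | .snd => arrayOf fun i => R.snd I.m (I.p i)

/-- The initial configuration: `m` and `r` are given, all other registers are zero. -/
def startConfig (I : Instance) : Config (Nat.clog 2 I.q) where
  int
    | .m => I.m
    | .r => I.r
    | _ => 0
  str := fun _ _ => false
  queries := 0
  time := 0

/-- The distribution of the final configuration of `CyclicTest_ε` on the instance `I`. -/
def cyclicTestRun (ε : ℝ) (c₁ c₂ c₃ K : ℕ) (R : PairRule) (I : Instance) :
    PMF (Config (Nat.clog 2 I.q)) :=
  (cyclicTestProgram ⌈1 / ε⌉₊ c₁ c₂ c₃).exec (runEnv ε K R I) (startConfig I)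

/-- The distribution of the output of `CyclicTest_ε` (`true` is PASS, `false` is FAIL). -/
def cyclicTest (ε : ℝ) (c₁ c₂ c₃ K : ℕ) (R : PairRule) (I : Instance) : PMF Bool :=
  (cyclicTestRun ε c₁ c₂ c₃ K R I).map fun c => decide (c.int .decision = 1)

/-! ## The complexity bound -/

/-- The logarithm to base two, replaced by `1` where it is smaller than `1`. -/
def lg (x : ℝ) : ℝ := max 1 (Real.logb 2 x)

/-- `(log m + log log m / ε) * log q * log log log m`. -/
def complexityBound (ε : ℝ) (m q : ℕ) : ℝ :=
  (lg m + lg (lg m) / ε) * lg q * lg (lg (lg m))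

end CyclicTesting

end

/-! ### Prime numbers: Mertens' bound, Euler's totient and the number of prime divisors -/

namespace CyclicTesting
open Finset Real

/-! Completeness. In a cyclic group of order `m` a generator `γ` makes `f_γ` an isomorphism from
`ZMod m`, so no test of the round can reject (`roundTests_pass`). A random `γ` is a generator with
probability `φ(m) / m`, which by Mertens' upper bound for the reciprocals of the primes is at least
of order `1 / log log m` (`exists_le_totient_mul_size_size`). Hence a suitable multiple of `log log
m` rounds contains an accepting one with probability at least `2/3`.

Soundness. Let `f` be any map from the cyclic group `C_m` to a magma of size `m`, and let `f (x + y)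
= f x ∘ f y` fail for fewer than `m² / 32` pairs. For each `k`, either most points `u` satisfy `f (u
+ k) = f u`, or few do; the gap between the two cases makes the `k` of the first kind a subgroup
(`almostPeriods`). If it is trivial, then `f` is injective outside a small set, can be corrected to
a bijection, and the cyclic operation transported along this bijection is close to `∘`. If it is
nontrivial, it contains the whole subgroup of some prime order `p` dividing `m`, so any two elements
`x, y` of that subgroup satisfy `f (x + u) = f (y + u)` for most `u`. So in a magma far from the
cyclic groups, for every `γ`, either the homomorphism test rejects with probability at least `1 /
(32 * ⌈1 / ε⌉)`, or the injectivity test for one `p` rejects with probability at least `1/2`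
(`HammingFar.le_badPairs_or`). The repetitions push the acceptance probability of a round below one
third of the reciprocal of the number of rounds, and a union bound over the rounds finishes. The
edit distance needs nothing new, being at most the Hamming distance.

Complexity. One test costs `O(log q)` steps. A round makes `d₂ + r * d₃` tests, where `r` is the
number of prime divisors of `m`, and there are `O(log log m)` rounds. Since `r * log log m = O(log
m)` (`card_primeFactors_mul_size_size_le`), the product is the stated bound. Queries are bounded by
time.

The remaining work transfers this to the program: a calculus of expectations for its random
semantics, frame rules for unchanged registers, a syntactic cost bound, and the check that no
arithmetic exceeds the word length. Logarithms appear in the program as iterated `Nat.size`. -/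

theorem prod_prime_pow_dvd_factorial (n : ℕ) :
    ∏ p ∈ n.primesLE, p ^ (n / p) ∣ n.factorial := by
  refine Finset.prod_dvd_of_isRelPrime ?_ ?_
  · intro p hp q hq hpq
    have hp' := (Nat.mem_primesLE.1 hp).2
    have hq' := (Nat.mem_primesLE.1 hq).2
    exact Nat.coprime_iff_isRelPrime.1 (((Nat.coprime_primes hp' hq').2 hpq).pow _ _)
  · intro p hp
    -- A multinomial coefficient is an integer: `p! ^ (n / p)` divides `((n / p) * p)!`, and `p`
    -- divides `p!`.
    have h1 : p ^ (n / p) ∣ ((n / p) * p).factorial := by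
      have := Nat.prod_factorial_dvd_factorial_sum (Finset.range (n / p)) (fun _ => p)
      simp only [Finset.prod_const, Finset.card_range, Finset.sum_const, smul_eq_mul] at this
      exact (pow_dvd_pow_of_dvd (Nat.dvd_factorial (Nat.mem_primesLE.1 hp).2.pos le_rfl) _).trans
        this
    exact h1.trans (Nat.factorial_dvd_factorial (Nat.div_mul_le_self n p))

/-- Upper half of Mertens' first theorem: take logarithms in the preceding divisibility, with `n! ≤
n ^ n`. Replacing `n / p` by its floor costs at most `θ(n) ≤ n * log 4`. -/
theorem sum_log_div_prime_le (n : ℕ) (hn : 1 ≤ n) :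
    ∑ p ∈ n.primesLE, log p / p ≤ log n + log 4 := by
  have hn0 : (0 : ℝ) < n := by exact_mod_cast hn
  have h1 : ∑ p ∈ n.primesLE, ((n / p : ℕ) : ℝ) * log p ≤ n * log n := by
    have h2 : ∏ p ∈ n.primesLE, p ^ (n / p) ≤ n ^ n :=
      (Nat.le_of_dvd (Nat.factorial_pos n) (prod_prime_pow_dvd_factorial n)).trans
        (Nat.factorial_le_pow n)
    have h3 : ((∏ p ∈ n.primesLE, p ^ (n / p) : ℕ) : ℝ) ≤ ((n ^ n : ℕ) : ℝ) := by exact_mod_cast h2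
    have h4 := Real.log_le_log (by
      have : 0 < ∏ p ∈ n.primesLE, p ^ (n / p) := Finset.prod_pos fun p hp =>
        pow_pos (Nat.mem_primesLE.1 hp).2.pos _
      exact_mod_cast this) h3
    push_cast at h4
    rw [Real.log_pow, Real.log_prod] at h4
    · simpa [Real.log_pow] using h4
    · intro p hp
      have := (Nat.mem_primesLE.1 hp).2.pos
      positivity
  have h5 : (n : ℝ) * ∑ p ∈ n.primesLE, log p / p ≤
      ∑ p ∈ n.primesLE, ((n / p : ℕ) : ℝ) * log p + ∑ p ∈ n.primesLE, log p := by
    rw [Finset.mul_sum, ← Finset.sum_add_distrib]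
    refine Finset.sum_le_sum fun p hp => ?_
    have hp1 := (Nat.mem_primesLE.1 hp).2.one_lt
    have hlog : 0 ≤ log p := Real.log_nonneg (by exact_mod_cast hp1.le)
    have h6 : (n : ℝ) / p ≤ (n / p : ℕ) + 1 := by
      rw [← Nat.floor_div_eq_div (K := ℝ)]
      exact (Nat.lt_floor_add_one _).le
    calc (n : ℝ) * (log p / p) = (n / p) * log p := by ring
      _ ≤ ((n / p : ℕ) + 1) * log p := by gcongr
      _ = _ := by ring
  have h7 : ∑ p ∈ n.primesLE, log p ≤ log 4 * n := by
    rw [← Chebyshev.theta_eq_sum_primesLE_log]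
    exact Chebyshev.theta_le_log4_mul_x hn0.le
  have h8 : (n : ℝ) * ∑ p ∈ n.primesLE, log p / p ≤ n * (log n + log 4) := by linarith
  exact le_of_mul_le_mul_left h8 hn0

theorem sum_primesLE_succ {M : Type*} [AddCommMonoid M] (F : ℕ → M) (n : ℕ) :
    ∑ p ∈ (n + 1).primesLE, F p =
      ∑ p ∈ n.primesLE, F p + if (n + 1).Prime then F (n + 1) else 0 := by
  simp only [Nat.primesLE, Nat.primesBelow, Finset.sum_filter]
  rw [Finset.sum_range_succ]

/-- Mertens' upper bound for the sum of the reciprocals of the primes. -/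
theorem sum_inv_prime_le : ∃ C : ℝ, ∀ n : ℕ, 2 ≤ n →
    ∑ p ∈ n.primesLE, (1 / p : ℝ) ≤ log (log n) + C := by
  set A : ℕ → ℝ := fun n => ∑ p ∈ n.primesLE, log p / p with hA
  set S : ℕ → ℝ := fun n => ∑ p ∈ n.primesLE, (1 / p : ℝ) with hS
  have hlogpos : ∀ n : ℕ, 2 ≤ n → 0 < log n := fun n hn =>
    Real.log_pos (by exact_mod_cast hn)
  have hc : 0 < log 4 := Real.log_pos (by norm_num)
  -- Partial summation in the form of a quantity that never increases with `n`.
  have key : ∀ n : ℕ, 2 ≤ n → S n - A n / log n + log 4 / log n - log (log n) ≤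
      S 2 - A 2 / log (2 : ℕ) + log 4 / log (2 : ℕ) - log (log (2 : ℕ)) := by
    intro n hn
    induction n, hn using Nat.le_induction with
    | base => exact le_rfl
    | succ n hn ih =>
      refine le_trans ?_ ih
      have hl := hlogpos n hn
      have hl' := hlogpos (n + 1) (by omega)
      have hAn : A n ≤ log n + log 4 := sum_log_div_prime_le n (by omega)
      have hll : log n ≤ log (n + 1 : ℕ) :=
        Real.log_le_log (by positivity) (by exact_mod_cast Nat.le_succ n)
      -- If `n + 1` is prime, both terms on the left grow by `1 / (n + 1)`.
      have h1 : S (n + 1) - A (n + 1) / log (n + 1 : ℕ) = S n - A n / log (n + 1 : ℕ) := by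
        simp only [hS, hA, sum_primesLE_succ]
        split_ifs
        · have : log ((n + 1 : ℕ) : ℝ) ≠ 0 := hl'.ne'
          field_simp
          ring
        · simp
      -- This is `1 - u ≤ -log u` for the quotient `u` of the two logarithms.
      have h2 : 1 - log n / log (n + 1 : ℕ) ≤ log (log (n + 1 : ℕ)) - log (log n) := by
        have h3 := Real.add_one_le_exp (log (log n / log (n + 1 : ℕ)))
        rw [Real.exp_log (by positivity), Real.log_div hl.ne' hl'.ne'] at h3
        linarith
      have h4 : A n * (1 / log n - 1 / log (n + 1 : ℕ)) ≤
          (log n + log 4) * (1 / log n - 1 / log (n + 1 : ℕ)) := by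
        refine mul_le_mul_of_nonneg_right hAn (sub_nonneg.2 ?_)
        exact one_div_le_one_div_of_le hl hll
      have h5 : log n * (1 / log n) = 1 := by field_simp
      have e1 : A n / log (n + 1 : ℕ) = A n * (1 / log (n + 1 : ℕ)) := by ring
      have e2 : A n / log n = A n * (1 / log n) := by ring
      have e3 : log 4 / log (n + 1 : ℕ) = log 4 * (1 / log (n + 1 : ℕ)) := by ring
      have e4 : log 4 / log n = log 4 * (1 / log n) := by ring
      have e5 : log n / log (n + 1 : ℕ) = log n * (1 / log (n + 1 : ℕ)) := by ring
      rw [h1, e1, e2, e3, e4]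
      rw [e5] at h2
      linarith
  refine ⟨S 2 - A 2 / log (2 : ℕ) + log 4 / log (2 : ℕ) - log (log (2 : ℕ)) + 1 , fun n hn => ?_⟩
  have h1 := key n hn
  have hl := hlogpos n hn
  have hAn : A n ≤ log n + log 4 := sum_log_div_prime_le n (by omega)
  have h2 : A n / log n ≤ 1 + log 4 / log n := by
    rw [div_le_iff₀ hl]
    field_simp
    linarith
  change S n ≤ _
  linarith

theorem two_pow_card_primeFactors_le (m : ℕ) (hm : m ≠ 0) : 2 ^ m.primeFactors.card ≤ m :=
  (Finset.pow_card_le_prod _ _ _ fun _ hp => (Nat.prime_of_mem_primeFactors hp).two_le).trans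
    (Nat.le_of_dvd (Nat.pos_of_ne_zero hm) (Nat.prod_primeFactors_dvd m))

theorem card_primeFactors_lt_size (m : ℕ) (hm : m ≠ 0) : m.primeFactors.card < m.size :=
  Nat.lt_size.2 (two_pow_card_primeFactors_le m hm)

/-- Split the prime divisors at `2 ^ t`, roughly the square root of `log m`. There are at most `2 ^
t` small ones, and each large one accounts for at least `t` binary digits of `m`. This is what keeps
the injectivity tests for all primes, over all rounds, within the time bound. -/
theorem card_primeFactors_mul_size_size_le (m : ℕ) (hm : m ≠ 0) :
    m.primeFactors.card * m.size.size ≤ 9 * m.size := by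
  set y := m.size with hy
  set s := y.size with hs
  obtain ⟨t, ht⟩ : ∃ t, t = s / 2 := ⟨_, rfl⟩
  set Sm := m.primeFactors.filter (· < 2 ^ t)
  set L := m.primeFactors.filter (¬ · < 2 ^ t)
  have hcard : Sm.card + L.card = m.primeFactors.card := Finset.card_filter_add_card_filter_not _
  have h1 : Sm.card ≤ 2 ^ t := by
    have : Sm ⊆ Finset.range (2 ^ t) := fun p hp => Finset.mem_range.2 (Finset.mem_filter.1 hp).2
    simpa using Finset.card_le_card this
  have h2 : t * L.card < y := by
    rw [hy, Nat.lt_size, pow_mul]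
    refine (Finset.pow_card_le_prod L id _ fun p hp => not_lt.1 (Finset.mem_filter.1 hp).2).trans ?_
    refine Nat.le_of_dvd (Nat.pos_of_ne_zero hm) (dvd_trans ?_ (Nat.prod_primeFactors_dvd m))
    exact Finset.prod_dvd_prod_of_subset _ _ _ (Finset.filter_subset _ _)
  have h3 : L.card ≤ y := by
    have := card_primeFactors_lt_size m hm
    omega
  have hypos : 0 < y := Nat.size_pos.2 (Nat.pos_of_ne_zero hm)
  have h4 : 2 ^ (2 * t) ≤ 2 * y := by
    have hs0 : s - 1 < s := by
      have : 0 < s := Nat.size_pos.2 hypos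
      omega
    have := Nat.lt_size.1 hs0
    calc 2 ^ (2 * t) ≤ 2 ^ (s - 1 + 1) := Nat.pow_le_pow_right (by norm_num) (by omega)
      _ ≤ 2 * y := by rw [pow_succ]; omega
  have h5 : t < 2 ^ t := Nat.lt_two_pow_self
  have h6 : s ≤ 2 * t + 1 := by omega
  have h7 : Sm.card * s ≤ 3 * (2 * y) := by
    calc Sm.card * s ≤ 2 ^ t * (3 * 2 ^ t) := Nat.mul_le_mul h1 (by omega)
      _ = 3 * 2 ^ (2 * t) := by ring
      _ ≤ _ := by omega
  have h8 : L.card * s ≤ 3 * y := by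
    calc L.card * s ≤ L.card * (2 * t + 1) := Nat.mul_le_mul_left _ h6
      _ = 2 * (t * L.card) + L.card := by ring
      _ ≤ _ := by omega
  rw [← hcard, add_mul]
  omega

/-- The terms are `1 / (p - 1) - 1 / p`, so the sum over all integers telescopes. It bounds the cost
of replacing `1 / (p - 1)` by `1 / p`. -/
theorem sum_inv_mul_pred_le (n : ℕ) :
    ∑ p ∈ n.primesLE, (1 / ((p : ℝ) * (p - 1))) ≤ 1 := by
  have h : ∀ n : ℕ, 1 ≤ n → ∑ p ∈ n.primesLE, (1 / ((p : ℝ) * (p - 1))) ≤ 1 - 1 / n := by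
    intro n hn
    induction n, hn using Nat.le_induction with
    | base => simp [Nat.primesLE, Nat.primesBelow, Finset.sum_filter, Finset.sum_range_succ,
        Nat.not_prime_zero, Nat.not_prime_one]
    | succ n hn ih =>
      rw [sum_primesLE_succ]
      have hn0 : (0 : ℝ) < n := by exact_mod_cast hn
      have h1 : (if (n + 1).Prime then 1 / (((n + 1 : ℕ) : ℝ) * ((n + 1 : ℕ) - 1)) else 0) ≤
          1 / (n : ℝ) - 1 / (n + 1 : ℕ) := by
        have e : 1 / (((n + 1 : ℕ) : ℝ) * ((n + 1 : ℕ) - 1)) = 1 / (n : ℝ) - 1 / (n + 1 : ℕ) := by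
          push_cast
          have : (n : ℝ) + 1 ≠ 0 := by positivity
          have : (n : ℝ) ≠ 0 := hn0.ne'
          rw [add_sub_cancel_right]
          field_simp
          ring
        rw [← e]
        split_ifs
        · exact le_rfl
        · push_cast
          simp only [add_sub_cancel_right]
          positivity
      linarith
  rcases Nat.eq_zero_or_pos n with rfl | hn
  · simp [Nat.primesLE, Nat.primesBelow, Finset.sum_filter]
  · have := h n hn
    have : (0 : ℝ) ≤ 1 / n := by positivity
    linarith [h n hn]

/-- `m / φ(m)` is the product of the factors `1 + 1 / (p - 1)`, and `1 + x ≤ exp x`. -/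
theorem le_totient_mul_exp (m : ℕ) (hm : m ≠ 0) :
    (m : ℝ) ≤ m.totient * exp (∑ p ∈ m.primeFactors, 1 / ((p : ℝ) - 1)) := by
  have h1 : (m.totient : ℝ) = m * ∏ p ∈ m.primeFactors, (1 - (p : ℝ)⁻¹) := by
    have := Nat.totient_eq_mul_prod_factors m
    have h := congrArg (Rat.cast : ℚ → ℝ) this
    push_cast at h
    exact h
  have h2 : 1 ≤ (∏ p ∈ m.primeFactors, (1 - (p : ℝ)⁻¹)) *
      exp (∑ p ∈ m.primeFactors, 1 / ((p : ℝ) - 1)) := by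
    rw [Real.exp_sum, ← Finset.prod_mul_distrib]
    refine Finset.one_le_prod fun p hp => ?_
    have hp1 : (1 : ℝ) < p := by exact_mod_cast (Nat.prime_of_mem_primeFactors hp).one_lt
    have h3 := Real.add_one_le_exp (1 / ((p : ℝ) - 1))
    have h4 : (0 : ℝ) ≤ 1 - (p : ℝ)⁻¹ := sub_nonneg.2 (inv_le_one_of_one_le₀ hp1.le)
    have h5 : (1 - (p : ℝ)⁻¹) * (1 / ((p : ℝ) - 1) + 1) = 1 := by
      have : (p : ℝ) - 1 ≠ 0 := by linarith
      field_simp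
      ring
    calc (1 : ℝ) = _ := h5.symm
      _ ≤ _ := mul_le_mul_of_nonneg_left h3 h4
  rw [h1, mul_assoc]
  exact le_mul_of_one_le_right (by positivity) h2

/-- Only primes up to about `log m` matter: there are fewer than `m.size` prime divisors, so those
above `m.size` contribute at most `1` together. The other `1` pays for passing from `1 / (p - 1)` to
`1 / p`. -/
theorem sum_primeFactors_inv_pred_le (m : ℕ) (hm : m ≠ 0) :
    ∑ p ∈ m.primeFactors, 1 / ((p : ℝ) - 1) ≤
      ∑ p ∈ m.size.primesLE, (1 / p : ℝ) + 2 := by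
  set y := m.size with hy
  have hypos : 0 < y := Nat.size_pos.2 (Nat.pos_of_ne_zero hm)
  have hy0 : (0 : ℝ) < y := by exact_mod_cast hypos
  rw [← Finset.sum_filter_add_sum_filter_not m.primeFactors (· ≤ y)]
  have h1 : ∑ p ∈ m.primeFactors.filter (· ≤ y), 1 / ((p : ℝ) - 1) ≤
      ∑ p ∈ y.primesLE, (1 / p : ℝ) + 1 := by
    refine le_trans ?_ (add_le_add_right (sum_inv_mul_pred_le y) _)
    rw [← Finset.sum_add_distrib]
    have hone : ∀ p ∈ y.primesLE, (1 : ℝ) < p := fun p hp => by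
      exact_mod_cast (Nat.mem_primesLE.1 hp).2.one_lt
    refine le_trans (Finset.sum_le_sum_of_subset_of_nonneg (t := y.primesLE) ?_ ?_)
      (Finset.sum_le_sum fun p hp => ?_)
    · intro p hp
      rw [Finset.mem_filter] at hp
      exact Nat.mem_primesLE.2 ⟨hp.2, Nat.prime_of_mem_primeFactors hp.1⟩
    · intro p hp _
      have := hone p hp
      exact one_div_nonneg.2 (by linarith)
    · have := hone p hp
      have : (p : ℝ) - 1 ≠ 0 := by linarith
      apply le_of_eq
      field_simp
      ring
  have h2 : ∑ p ∈ m.primeFactors.filter (¬ · ≤ y), 1 / ((p : ℝ) - 1) ≤ 1 := by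
    have h3 : ∀ p ∈ m.primeFactors.filter (¬ · ≤ y), 1 / ((p : ℝ) - 1) ≤ 1 / y := by
      intro p hp
      have h4 : y + 1 ≤ p := not_le.1 (Finset.mem_filter.1 hp).2
      have h5 : (y : ℝ) + 1 ≤ p := by exact_mod_cast h4
      exact one_div_le_one_div_of_le hy0 (by linarith)
    refine (Finset.sum_le_card_nsmul _ _ _ h3).trans ?_
    have h6 : (m.primeFactors.filter (¬ · ≤ y)).card ≤ y :=
      (Finset.card_filter_le _ _).trans (card_primeFactors_lt_size m hm).le
    have h7 : ((m.primeFactors.filter (¬ · ≤ y)).card : ℝ) ≤ y := by exact_mod_cast h6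
    rw [nsmul_eq_mul, mul_one_div]
    exact (div_le_one hy0).2 h7
  linarith

/-- `φ(m) / m` is at least of order `1 / log log m`. -/
theorem exists_le_totient_mul_size_size : ∃ c : ℝ, 0 < c ∧ ∀ m : ℕ, m ≠ 0 →
    c * m ≤ m.totient * m.size.size := by
  obtain ⟨C, hC⟩ := sum_inv_prime_le
  -- The minimum with `1` serves `m = 1`, where Mertens' bound does not apply.
  refine ⟨min 1 (exp (-(C + 2))), lt_min one_pos (exp_pos _), fun m hm => ?_⟩
  have hmp : 0 < m := Nat.pos_of_ne_zero hm
  obtain rfl | h2 := (Nat.one_le_iff_ne_zero.2 hm).eq_or_lt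
  · simp
  have hs : 2 ≤ m.size := Nat.lt_size.2 (by norm_num; omega)
  have h1 := sum_primeFactors_inv_pred_le m hm
  have h3 := hC m.size hs
  have h4 : log m.size ≤ m.size.size := by
    have h5 : (m.size : ℝ) ≤ 2 ^ m.size.size := by exact_mod_cast (Nat.lt_size_self _).le
    have h6 := Real.log_le_log (by positivity) h5
    rw [Real.log_pow] at h6
    refine h6.trans (mul_le_of_le_one_right (by positivity) ?_)
    linarith [Real.log_two_lt_d9]
  have hl : 0 < log m.size := Real.log_pos (by exact_mod_cast hs)
  have h7 : (m : ℝ) ≤ m.totient * (m.size.size * exp (C + 2)) := by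
    refine (le_totient_mul_exp m hm).trans (mul_le_mul_of_nonneg_left ?_ (by positivity))
    calc exp (∑ p ∈ m.primeFactors, 1 / ((p : ℝ) - 1)) ≤ exp (log (log m.size) + (C + 2)) :=
          exp_le_exp.2 (by linarith)
      _ = log m.size * exp (C + 2) := by rw [exp_add, exp_log hl]
      _ ≤ _ := by gcongr
  calc min 1 (exp (-(C + 2))) * (m : ℝ) ≤ exp (-(C + 2)) * m := by gcongr; exact min_le_right _ _
    _ ≤ exp (-(C + 2)) * (m.totient * (m.size.size * exp (C + 2))) := by gcongr
    _ = m.totient * m.size.size * (exp (-(C + 2)) * exp (C + 2)) := by ring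
    _ = _ := by rw [← exp_add]; simp

end CyclicTesting

namespace CyclicTesting
open Finset

/-! ### The edit distance is at most the Hamming distance -/

section Distances

theorem exists_editPath_of_eqOn_compl {D : Finset ℕ} (v : D → D → ℕ) (s : Finset (D × D)) :
    ∀ v' : D → D → ℕ, (∀ a b, (a, b) ∉ s → v a b = v' a b) →
      ∃ c ≤ s.card, EditPath ⟨D, v⟩ ⟨D, v'⟩ c := by
  classical
  induction s using Finset.induction_on with
  | empty =>
    intro v' h
    have : v = v' := by
      ext a b
      exact h a b (by simp)
    subst this
    exact ⟨0, by simp, EditPath.refl _⟩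
  | insert z s hz ih =>
    intro v' h
    obtain ⟨a, b⟩ := z
    -- The intermediate table keeps the old entry at `(a, b)`, so it differs from `v` only on `s`;
    -- the last exchange writes `v' a b`.
    obtain ⟨c, hc, hp⟩ := ih (fun x y => if x = a ∧ y = b then v a b else v' x y) (by
      intro x y hxy
      split_ifs with hab
      · rw [hab.1, hab.2]
      · exact h x y (by
          rw [Finset.mem_insert, not_or]
          exact ⟨fun he => hab ⟨congrArg Prod.fst he, congrArg Prod.snd he⟩, hxy⟩))
    refine ⟨c + 1, by rw [Finset.card_insert_of_notMem hz]; omega, ?_⟩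
    have hstep := hp.step (EditStep.exchange _ a b (v' a b))
    convert hstep using 2
    funext x y
    split_ifs with hab
    · rw [hab.1, hab.2]
    · exact (if_neg hab).symm

/-- Label both tables in the same way; then one exchange for each differing entry suffices. -/
theorem editDist_le_hamming {Γ : Type u} [Finite Γ] (op op' : Γ → Γ → Γ) :
    editDist op op' ≤ hamming op op' := by
  classical
  obtain ⟨D, ⟨σ⟩⟩ : ∃ D : Finset ℕ, Nonempty (D ≃ Γ) := by
    obtain ⟨n, ⟨e⟩⟩ := Finite.exists_equiv_fin Γ
    exact ⟨Finset.range n, ⟨(Fintype.equivOfCardEq (by simp)).trans e.symm⟩⟩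
  let tbl : (Γ → Γ → Γ) → D → D → ℕ := fun o a b => (σ.symm (o (σ a) (σ b)) : ℕ)
  have h1 : editDist op op' ≤ Table.editDist ⟨D, tbl op⟩ ⟨D, tbl op'⟩ :=
    Nat.sInf_le ⟨_, _, ⟨σ, fun _ _ => rfl⟩, ⟨σ, fun _ _ => rfl⟩, rfl⟩
  obtain ⟨c, hc, hp⟩ := exists_editPath_of_eqOn_compl (tbl op)
    (Finset.univ.filter fun z : D × D => op (σ z.1) (σ z.2) ≠ op' (σ z.1) (σ z.2)) (tbl op') (by
      intro a b hab
      simp only [Finset.mem_filter, Finset.mem_univ, true_and, not_not] at hab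
      simp only [tbl, hab])
  refine h1.trans ((Nat.sInf_le hp).trans (hc.trans ?_))
  rw [hamming, ← Set.ncard_coe_finset]
  refine Set.ncard_le_ncard_of_injOn (fun z : D × D => (σ z.1, σ z.2)) ?_ ?_ (Set.toFinite _)
  · intro z hz
    simpa using hz
  · intro z _ z' _ h
    simpa [Prod.ext_iff] using h

/-- Reduces soundness for the edit distance to soundness for the Hamming distance. -/
theorem EditFar.hammingFar {δ : ℝ} {Γ : Type u} [Finite Γ] {op : Γ → Γ → Γ}
    {𝒞 : GroupClass.{u}} (h : EditFar 𝒞 δ Γ op) : HammingFar 𝒞 δ Γ op := fun op' hop =>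
  (h Γ op' hop).trans (by exact_mod_cast editDist_le_hamming op op')

end Distances

/-! ### Approximate homomorphisms from an abelian group to a magma -/

section ApproximateHomomorphism

set_option linter.unusedSectionVars false

variable {G : Type*} {Γ : Type u} [AddCommGroup G] [Fintype G] [DecidableEq G] [DecidableEq Γ]

/-- The pairs on which `f` fails to be a homomorphism. -/
def badPairs (op : Γ → Γ → Γ) (f : G → Γ) : Finset (G × G) :=
  univ.filter fun z => f (z.1 + z.2) ≠ op (f z.1) (f z.2)

/-- The points at which `f` is invariant under translation by `k`. -/
def invariantPoints (f : G → Γ) (k : G) : Finset G := univ.filter fun u => f (u + k) = f u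

/-- The points at which `f` is not invariant under translation by `k`. -/
def variantPoints (f : G → Γ) (k : G) : Finset G := univ.filter fun u => ¬ f (u + k) = f u

theorem card_invariantPoints_add (f : G → Γ) (k : G) :
    (invariantPoints f k).card + (variantPoints f k).card = Fintype.card G :=
  Finset.card_filter_add_card_filter_not _

/-- Let `x` be an invariant and `z` a variant point. If `(x, z - x)` and `(x + k, z - x)` were both
good pairs, then `f z = f x ∘ f (z - x) = f (x + k) ∘ f (z - x) = f (z + k)`, a contradiction. So
`(x, z)` is charged to a bad pair, and each bad pair is charged at most twice. -/
theorem card_invariant_mul_card_variant_le (op : Γ → Γ → Γ) (f : G → Γ) (k : G) :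
    (invariantPoints f k).card * (variantPoints f k).card ≤ 2 * (badPairs op f).card := by
  rw [← Finset.card_product]
  have hsub : invariantPoints f k ×ˢ variantPoints f k ⊆
      (badPairs op f).image (fun z => (z.1, z.1 + z.2)) ∪
      (badPairs op f).image (fun z => (z.1 - k, z.1 - k + z.2)) := by
    rintro ⟨x, z⟩ hxz
    simp only [mem_product, invariantPoints, variantPoints, mem_filter, mem_univ, true_and] at hxz
    by_cases h : f (x + (z - x)) = op (f x) (f (z - x))
    · refine mem_union_right _ (mem_image.2 ⟨(x + k, z - x), ?_, by ext <;> simp⟩)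
      simp only [badPairs, mem_filter, mem_univ, true_and]
      rw [hxz.1, ← h, show x + k + (z - x) = z + k by abel, show x + (z - x) = z by abel]
      exact hxz.2
    · refine mem_union_left _ (mem_image.2 ⟨(x, z - x), ?_, by ext <;> simp⟩)
      simpa only [badPairs, mem_filter, mem_univ, true_and] using h
  calc _ ≤ _ := Finset.card_le_card hsub
    _ ≤ _ := Finset.card_union_le _ _
    _ ≤ (badPairs op f).card + (badPairs op f).card :=
      add_le_add Finset.card_image_le Finset.card_image_le
    _ = _ := by ring

theorem card_variantPoints_add_le (f : G → Γ) (k l : G) :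
    (variantPoints f (k + l)).card ≤ (variantPoints f k).card + (variantPoints f l).card := by
  have hsub : variantPoints f (k + l) ⊆
      variantPoints f k ∪ (variantPoints f l).image (fun u => u - k) := by
    intro u hu
    simp only [variantPoints, mem_filter, mem_univ, true_and, mem_union, mem_image] at hu ⊢
    by_contra! h
    refine hu ?_
    have h2 := h.2 (u + k)
    by_contra h3
    refine h2 ?_ (by abel)
    rw [h.1, add_assoc]
    exact h3
  exact (Finset.card_le_card hsub).trans ((Finset.card_union_le _ _).trans
    (add_le_add_right Finset.card_image_le _))

theorem card_variantPoints_neg (f : G → Γ) (k : G) :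
    (variantPoints f (-k)).card ≤ (variantPoints f k).card := by
  have hsub : variantPoints f (-k) ⊆ (variantPoints f k).image (fun u => u + k) := by
    intro u hu
    simp only [variantPoints, mem_filter, mem_univ, true_and, mem_image] at hu ⊢
    exact ⟨u + -k, fun h => hu (by rw [← h]; congr 1; abel), by abel⟩
  exact (Finset.card_le_card hsub).trans Finset.card_image_le

/-- The translations under which an approximate homomorphism is invariant at most points. -/
def almostPeriods (op : Γ → Γ → Γ) (f : G → Γ)
    (hb : 32 * (badPairs op f).card < Fintype.card G ^ 2) : AddSubgroup G :=
  -- The product of the two numbers of points is below `|G|² / 16`; if more than half of the points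
  -- are invariant, at most `1/8` are variant. Two such translations compose to one with at most
  -- `1/4` variant points, which is again less than half.
  have aux : ∀ k, Fintype.card G < 2 * (invariantPoints f k).card →
      8 * (variantPoints f k).card ≤ Fintype.card G := by
    intro k hk
    have h1 := card_invariant_mul_card_variant_le op f k
    have h3 : Fintype.card G * (8 * (variantPoints f k).card) ≤
        Fintype.card G * Fintype.card G := by
      nlinarith [mul_le_mul_of_nonneg_right hk.le (Nat.zero_le (variantPoints f k).card)]
    exact le_of_mul_le_mul_left h3 Fintype.card_pos
  { carrier := {k | Fintype.card G < 2 * (invariantPoints f k).card}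
    zero_mem' := by
      have : 0 < Fintype.card G := Fintype.card_pos
      simp only [Set.mem_ofPred_eq, invariantPoints, add_zero, filter_true, card_univ]
      omega
    add_mem' := by
      intro k l hk hl
      have h1 := card_variantPoints_add_le f k l
      have h2 := card_invariantPoints_add f (k + l)
      have h3 := aux k hk
      have h4 := aux l hl
      have : 0 < Fintype.card G := Fintype.card_pos
      simp only [Set.mem_ofPred_eq]
      omega
    neg_mem' := by
      intro k hk
      have h1 := card_variantPoints_neg f k
      have h2 := card_invariantPoints_add f (-k)
      have h3 := aux k hk
      have : 0 < Fintype.card G := Fintype.card_pos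
      simp only [Set.mem_ofPred_eq]
      omega }

theorem mem_almostPeriods {op : Γ → Γ → Γ} {f : G → Γ}
    {hb : 32 * (badPairs op f).card < Fintype.card G ^ 2} {k : G} :
    k ∈ almostPeriods op f hb ↔ Fintype.card G < 2 * (invariantPoints f k).card := Iff.rfl

/-- The points whose translates often violate the homomorphism condition. -/
def badPoints (op : Γ → Γ → Γ) (f : G → Γ) : Finset G :=
  univ.filter fun x => Fintype.card G ≤ 4 * (univ.filter fun y => f (x + y) ≠ op (f x) (f y)).card

/-- Markov's inequality: each bad point is the first component of at least `|G| / 4` bad pairs. -/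
theorem card_mul_card_badPoints_le (op : Γ → Γ → Γ) (f : G → Γ) :
    Fintype.card G * (badPoints op f).card ≤ 4 * (badPairs op f).card := by
  have h : (badPairs op f).card =
      ∑ x, (univ.filter fun y => f (x + y) ≠ op (f x) (f y)).card := by
    simp only [badPairs, Finset.card_filter]
    rw [← Finset.univ_product_univ, Finset.sum_product]
  rw [h, Finset.mul_sum, mul_comm, ← smul_eq_mul]
  refine (Finset.card_nsmul_le_sum (badPoints op f) _ _ fun x hx => ?_).trans
    (Finset.sum_le_sum_of_subset (Finset.subset_univ _))
  exact (Finset.mem_filter.1 hx).2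

/-- If `f x = f x'` for two points that are not bad, then for more than half of all `y` we get `f (x
+ y) = f x ∘ f y = f x' ∘ f y = f (x' + y)`. So `x' - x` leaves a majority of points invariant and
must vanish. -/
theorem injOn_compl_badPoints (op : Γ → Γ → Γ) (f : G → Γ)
    (h : ∀ k, Fintype.card G < 2 * (invariantPoints f k).card → k = 0) :
    Set.InjOn f ((badPoints op f)ᶜ : Finset G) := by
  intro x hx x' hx' hf
  simp only [badPoints, coe_compl, coe_filter, mem_univ, true_and, Set.mem_compl_iff,
    Set.mem_ofPred_eq, not_le] at hx hx'
  have hsub : (univ : Finset G) ⊆ (univ.filter fun y => f (x + y) ≠ op (f x) (f y)) ∪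
      (univ.filter fun y => f (x' + y) ≠ op (f x') (f y)) ∪
      (invariantPoints f (x' - x)).image (fun u => u - x) := by
    intro y _
    simp only [invariantPoints, mem_union, mem_filter, mem_univ, true_and, mem_image]
    by_contra! hy
    refine hy.2 (x + y) ?_ (by abel)
    rw [show x + y + (x' - x) = x' + y by abel, hy.1.1, hy.1.2, hf]
  have h1 := Finset.card_le_card hsub
  have h2 := Finset.card_union_le ((univ.filter fun y => f (x + y) ≠ op (f x) (f y)) ∪
      (univ.filter fun y => f (x' + y) ≠ op (f x') (f y)))
      ((invariantPoints f (x' - x)).image (fun u => u - x))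
  have h3 := Finset.card_union_le (univ.filter fun y => f (x + y) ≠ op (f x) (f y))
      (univ.filter fun y => f (x' + y) ≠ op (f x') (f y))
  have h4 : ((invariantPoints f (x' - x)).image (fun u => u - x)).card ≤ _ :=
    Finset.card_image_le
  rw [card_univ] at h1
  exact (sub_eq_zero.1 (h (x' - x) (by omega))).symm

/-- Equal cardinalities allow the injection on the complement of the bad points to be extended to a
bijection. -/
theorem exists_equiv_card_ne_le [Fintype Γ] (hcard : Fintype.card G = Fintype.card Γ)
    (op : Γ → Γ → Γ) (f : G → Γ)
    (h : ∀ k, Fintype.card G < 2 * (invariantPoints f k).card → k = 0) :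
    ∃ e : G ≃ Γ, (univ.filter fun x => e x ≠ f x).card ≤ (badPoints op f).card := by
  obtain ⟨g, hg⟩ := Finset.exists_equiv_extend_of_card_eq (t := (univ : Finset Γ))
    (by rw [card_univ]; exact hcard) (Finset.subset_univ _) (injOn_compl_badPoints op f h)
  refine ⟨g.trans (Equiv.subtypeUnivEquiv fun x => Finset.mem_univ x), Finset.card_le_card ?_⟩
  intro x hx
  rw [mem_filter] at hx
  by_contra hx'
  exact hx.2 (hg x (Finset.mem_compl.2 hx'))

/-- If `e` and `f` agree at `x`, `y` and `x + y` and the pair `(x, y)` is good, then both operations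
agree at `(e x, e y)`. The four sets in the union collect the exceptions; the third is parametrized
by `x` and the sum `x + y`. -/
theorem hamming_transport_le [Fintype Γ] (op : Γ → Γ → Γ) (f : G → Γ) (e : G ≃ Γ) :
    hamming op (fun a b => e (e.symm a + e.symm b)) ≤
      3 * (Fintype.card G * (univ.filter fun x => e x ≠ f x).card) + (badPairs op f).card := by
  set X := univ.filter fun x => e x ≠ f x with hX
  have hsub : {z : Γ × Γ | op z.1 z.2 ≠ e (e.symm z.1 + e.symm z.2)} ⊆
      (((X ×ˢ (univ : Finset G)).image (fun z => (e z.1, e z.2)) ∪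
        ((univ : Finset G) ×ˢ X).image (fun z => (e z.1, e z.2)) ∪
        ((univ : Finset G) ×ˢ X).image (fun z => (e z.1, e (z.2 - z.1))) ∪
        (badPairs op f).image (fun z => (e z.1, e z.2)) : Finset (Γ × Γ)) : Set (Γ × Γ)) := by
    rintro ⟨a, b⟩ hab
    obtain ⟨x, rfl⟩ := e.surjective a
    obtain ⟨y, rfl⟩ := e.surjective b
    simp only [Set.mem_ofPred_eq, Equiv.symm_apply_apply] at hab
    rw [Finset.mem_coe]
    by_contra hcon
    simp only [mem_union, not_or] at hcon
    obtain ⟨⟨⟨h1, h2⟩, h3⟩, h4⟩ := hcon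
    have h1' : e x = f x := by
      by_contra hx
      exact h1 (mem_image.2 ⟨(x, y), by simp [hX, hx], rfl⟩)
    have h2' : e y = f y := by
      by_contra hx
      exact h2 (mem_image.2 ⟨(x, y), by simp [hX, hx], rfl⟩)
    have h3' : e (x + y) = f (x + y) := by
      by_contra hx
      exact h3 (mem_image.2 ⟨(x, x + y), by simp [hX, hx], by simp⟩)
    have h4' : f (x + y) = op (f x) (f y) := by
      by_contra hx
      exact h4 (mem_image.2 ⟨(x, y), by simp [badPairs, hx], rfl⟩)
    exact hab (by rw [h1', h2', h3', h4'])
  refine (Set.ncard_le_ncard hsub (Set.toFinite _)).trans ?_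
  rw [Set.ncard_coe_finset]
  refine (Finset.card_union_le _ _).trans (add_le_add ?_ Finset.card_image_le)
  have hc : ∀ (F : G × G → Γ × Γ), (((univ : Finset G) ×ˢ X).image F).card ≤
      Fintype.card G * X.card := fun F => Finset.card_image_le.trans (by
    rw [Finset.card_product, card_univ])
  have hc' : ((X ×ˢ (univ : Finset G)).image (fun z => (e z.1, e z.2))).card ≤
      Fintype.card G * X.card := Finset.card_image_le.trans (by
    rw [Finset.card_product, card_univ, mul_comm])
  refine (Finset.card_union_le _ _).trans ?_
  have h2 := Finset.card_union_le ((X ×ˢ (univ : Finset G)).image (fun z => (e z.1, e z.2)))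
    (((univ : Finset G) ×ˢ X).image (fun z => (e z.1, e z.2)))
  have h3 := hc (fun z => (e z.1, e z.2))
  have h4 := hc (fun z => (e z.1, e (z.2 - z.1)))
  omega

theorem isGroupIn_cyclicGroups_transport [IsAddCyclic G] (e : G ≃ Γ) :
    IsGroupIn cyclicGroups.{u} (fun a b : Γ => e (e.symm a + e.symm b)) := by
  let e' : Γ ≃ Multiplicative G := e.symm.trans Multiplicative.ofAdd
  let _ : Group Γ := e'.group
  refine ⟨e'.group, fun _ _ => rfl, ?_⟩
  exact isCyclic_of_surjective (e'.mulEquiv.symm : Multiplicative G →* Γ) e'.mulEquiv.symm.surjective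

/-- An approximate homomorphism from a cyclic group to a magma of the same size either has a
nontrivial group of almost periods or shows that the magma is close to a cyclic group. -/
theorem exists_hamming_le_or_almostPeriods [Fintype Γ] [IsAddCyclic G]
    (hcard : Fintype.card G = Fintype.card Γ) (op : Γ → Γ → Γ) (f : G → Γ)
    (hb : 32 * (badPairs op f).card < Fintype.card G ^ 2) :
    (∃ op' : Γ → Γ → Γ, IsGroupIn cyclicGroups.{u} op' ∧
      hamming op op' ≤ 13 * (badPairs op f).card) ∨ almostPeriods op f hb ≠ ⊥ := by
  by_cases h : almostPeriods op f hb = ⊥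
  · left
    obtain ⟨e, he⟩ := exists_equiv_card_ne_le hcard op f (fun k hk => by
      have : k ∈ almostPeriods op f hb := hk
      rwa [h, AddSubgroup.mem_bot] at this)
    refine ⟨_, isGroupIn_cyclicGroups_transport e, (hamming_transport_le op f e).trans ?_⟩
    -- The constant is `13 = 3 * 4 + 1`: three exceptional sets of size `|G|` times the bad points,
    -- and the bad pairs themselves.
    have h1 := card_mul_card_badPoints_le op f
    have h2 := Nat.mul_le_mul_left (Fintype.card G) he
    omega
  · exact Or.inr h

/-- By Cauchy's theorem `K` has an element of prime order `p`, and its `p` multiples exhaust the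
solutions of `p • x = 0` in a cyclic group. Hence one arbitrary pair from each subgroup of prime
order suffices for the injectivity tests. -/
theorem exists_prime_torsion_le [IsAddCyclic G] (K : AddSubgroup G) (hK : K ≠ ⊥) :
    ∃ p : ℕ, p.Prime ∧ p ∣ Fintype.card G ∧ ∀ x : G, p • x = 0 → x ∈ K := by
  classical
  have h1 : Nat.card K ≠ 1 := fun h => hK (AddSubgroup.eq_bot_of_card_eq K h)
  obtain ⟨p, hp, hpK⟩ := Nat.exists_prime_and_dvd h1
  have := Fact.mk hp
  obtain ⟨g, hg⟩ := exists_prime_addOrderOf_dvd_card' (G := K) p hpK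
  refine ⟨p, hp, ?_, fun x hx => ?_⟩
  · rw [← Nat.card_eq_fintype_card]
    exact hpK.trans (AddSubgroup.card_addSubgroup_dvd_card K)
  have hg' : addOrderOf (g : G) = p := by rw [← hg]; exact AddSubgroup.addOrderOf_coe g
  have hsub : univ.filter (fun a : G => a ∈ AddSubgroup.zmultiples (g : G)) ⊆
      univ.filter (fun a : G => p • a = 0) := by
    intro a ha
    simp only [mem_filter, mem_univ, true_and, AddSubgroup.mem_zmultiples_iff] at ha ⊢
    obtain ⟨z, rfl⟩ := ha
    rw [smul_comm, ← hg', addOrderOf_nsmul_eq_zero, smul_zero]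
  have hcard : (univ.filter (fun a : G => a ∈ AddSubgroup.zmultiples (g : G))).card = p := by
    rw [← hg', ← Nat.card_zmultiples, Nat.card_eq_fintype_card, Fintype.card_subtype]
  have heq := Finset.eq_of_subset_of_card_le hsub (by
    rw [hcard]
    exact IsAddCyclic.card_nsmul_eq_zero_le hp.pos)
  have hx' : x ∈ univ.filter (fun a : G => p • a = 0) := by simpa using hx
  rw [← heq, mem_filter] at hx'
  obtain ⟨z, hz⟩ := AddSubgroup.mem_zmultiples_iff.1 hx'.2
  rw [← hz]
  exact K.zsmul_mem g.2 z

/-- Either the homomorphism test or one of the injectivity tests detects that a magma is far from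
the cyclic groups. -/
theorem HammingFar.le_badPairs_or [Fintype Γ] [IsAddCyclic G]
    (hcard : Fintype.card G = Fintype.card Γ) {op : Γ → Γ → Γ} {ε : ℝ} (hε : 0 < ε)
    (hfar : HammingFar cyclicGroups.{u} ε Γ op) (f : G → Γ) :
    Fintype.card G ^ 2 ≤ 32 * ⌈1 / ε⌉₊ * (badPairs op f).card ∨
    ∃ p : ℕ, p.Prime ∧ p ∣ Fintype.card G ∧ ∀ x y : G, p • x = 0 → p • y = 0 →
      Fintype.card G ≤ 2 * (univ.filter fun u => f (x + u) = f (y + u)).card := by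
  have hN : 1 ≤ ⌈1 / ε⌉₊ := Nat.one_le_ceil_iff.2 (by positivity)
  -- With at least `|G|² / 32` bad pairs the first alternative holds at once. With fewer, being far
  -- excludes a close cyclic operation unless `|G|² ≤ 13 * ⌈1 / ε⌉` times the number of bad pairs.
  by_cases hb : 32 * (badPairs op f).card < Fintype.card G ^ 2
  · rcases exists_hamming_le_or_almostPeriods hcard op f hb with ⟨op', hop', hd⟩ | hK
    · left
      have h1 := hfar op' hop'
      rw [Nat.card_eq_fintype_card, ← hcard] at h1
      have h2 : ((hamming op op' : ℕ) : ℝ) ≤ 13 * (badPairs op f).card := by exact_mod_cast hd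
      have h3 : 1 ≤ (⌈1 / ε⌉₊ : ℝ) * ε := by
        have := Nat.le_ceil (1 / ε)
        rwa [div_le_iff₀ hε] at this
      have h4 : ((Fintype.card G : ℝ)) ^ 2 ≤ 32 * ⌈1 / ε⌉₊ * (badPairs op f).card := by
        calc ((Fintype.card G : ℝ)) ^ 2 ≤ (⌈1 / ε⌉₊ * ε) * (Fintype.card G : ℝ) ^ 2 :=
              le_mul_of_one_le_left (by positivity) h3
          _ = ⌈1 / ε⌉₊ * (ε * (Fintype.card G : ℝ) ^ 2) := by ring
          _ ≤ ⌈1 / ε⌉₊ * (13 * (badPairs op f).card) := by 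
              exact mul_le_mul_of_nonneg_left (h1.trans h2) (by positivity)
          _ ≤ ⌈1 / ε⌉₊ * (32 * (badPairs op f).card) := by gcongr; norm_num
          _ = _ := by ring
      exact_mod_cast h4
    · right
      obtain ⟨p, hp, hpd, hK'⟩ := exists_prime_torsion_le _ hK
      refine ⟨p, hp, hpd, fun x y hx hy => ?_⟩
      -- The difference `x - y` is an almost period; translating its invariant points by `-y` gives
      -- collisions `f (x + u) = f (y + u)`.
      have h1 := mem_almostPeriods.1 (hK' (x - y) (by rw [smul_sub, hx, hy, sub_zero]))
      have h2 : (invariantPoints f (x - y)).card ≤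
          (univ.filter fun u => f (x + u) = f (y + u)).card := by
        refine Finset.card_le_card_of_injOn (fun u => u - y) ?_
          (fun a _ b _ hab => sub_left_injective hab)
        intro u hu
        simp only [invariantPoints, coe_filter, mem_univ, true_and, Set.mem_ofPred_eq] at hu ⊢
        rw [show x + (u - y) = u + (x - y) by abel, show y + (u - y) = u by abel, hu]
      omega
  · left
    have : (badPairs op f).card ≤ ⌈1 / ε⌉₊ * (badPairs op f).card :=
      Nat.le_mul_of_pos_left _ hN
    rw [mul_assoc]
    omega

end ApproximateHomomorphism
end CyclicTesting

namespace CyclicTesting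
open Finset ENNReal

/-! ### Expectations under discrete distributions -/

section Expectation

variable {α β : Type*}

/-- The expectation of a nonnegative function. -/
noncomputable def expect (μ : PMF α) (φ : α → ℝ≥0∞) : ℝ≥0∞ := ∑' a, μ a * φ a

theorem expect_pure (a : α) (φ : α → ℝ≥0∞) : expect (PMF.pure a) φ = φ a := by
  rw [expect, tsum_eq_single a]
  · simp
  · intro b hb
    simp [hb]

theorem expect_bind (μ : PMF α) (f : α → PMF β) (φ : β → ℝ≥0∞) :
    expect (μ.bind f) φ = expect μ fun a => expect (f a) φ := by
  simp only [expect, PMF.bind_apply, ← ENNReal.tsum_mul_left, ← ENNReal.tsum_mul_right]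
  rw [ENNReal.tsum_comm]
  simp only [mul_assoc]

theorem expect_mono {μ : PMF α} {φ ψ : α → ℝ≥0∞} (h : ∀ a ∈ μ.support, φ a ≤ ψ a) :
    expect μ φ ≤ expect μ ψ := by
  refine ENNReal.tsum_le_tsum fun a => ?_
  by_cases ha : μ a = 0
  · simp [ha]
  · gcongr
    exact h a ((PMF.mem_support_iff μ a).2 ha)

theorem expect_mul_left (μ : PMF α) (a : ℝ≥0∞) (φ : α → ℝ≥0∞) :
    expect μ (fun x => a * φ x) = a * expect μ φ := by
  simp only [expect, ← ENNReal.tsum_mul_left]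
  exact tsum_congr fun x => by ring

theorem expect_add (μ : PMF α) (φ ψ : α → ℝ≥0∞) :
    expect μ (fun x => φ x + ψ x) = expect μ φ + expect μ ψ := by
  simp only [expect, mul_add, ENNReal.tsum_add]

theorem expect_const (μ : PMF α) (a : ℝ≥0∞) : expect μ (fun _ => a) = a := by
  rw [expect, ENNReal.tsum_mul_right, PMF.tsum_coe, one_mul]

theorem expect_le_of_forall {μ : PMF α} {φ : α → ℝ≥0∞} {a : ℝ≥0∞}
    (h : ∀ x ∈ μ.support, φ x ≤ a) : expect μ φ ≤ a :=
  (expect_mono h).trans (expect_const μ a).le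

theorem expect_uniform [Fintype α] [Nonempty α] (φ : α → ℝ≥0∞) :
    expect (PMF.uniformOfFintype α) φ = (Fintype.card α : ℝ≥0∞)⁻¹ * ∑ a, φ a := by
  rw [expect, tsum_fintype, Finset.mul_sum]
  exact Finset.sum_congr rfl fun a _ => by rw [PMF.uniformOfFintype_apply]

theorem expect_uniform_indicator [Fintype α] [Nonempty α] (S : Finset α) (φ : α → ℝ≥0∞)
    (b : ℝ≥0∞) (h1 : ∀ a ∈ S, φ a ≤ b) (h0 : ∀ a ∉ S, φ a = 0) :
    expect (PMF.uniformOfFintype α) φ ≤ (S.card : ℝ≥0∞) / Fintype.card α * b := by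
  rw [expect_uniform, div_eq_mul_inv, mul_comm (S.card : ℝ≥0∞), mul_assoc]
  gcongr
  rw [← Finset.sum_subset (Finset.subset_univ S) fun a _ ha => h0 a ha, ← nsmul_eq_mul]
  exact Finset.sum_le_card_nsmul _ _ _ h1

theorem map_apply_eq_expect (μ : PMF α) (f : α → Bool) (b : Bool) :
    μ.map f b = expect μ fun a => if f a = b then 1 else 0 := by
  rw [PMF.map_apply, expect]
  exact tsum_congr fun a => by simp [eq_comm]

/-- Turns the random numbers drawn by the program into random elements of the group `ZMod m`. -/
theorem uniformBelow_bind (m : ℕ) [NeZero m] (f : ℕ → PMF α) :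
    (uniformBelow m).bind f = (PMF.uniformOfFintype (ZMod m)).bind fun x => f x.val := by
  have h : uniformBelow m = (PMF.uniformOfFintype (ZMod m)).map ZMod.val := by
    ext k
    rw [uniformBelow, dif_neg (NeZero.ne m), PMF.uniformOfFinset_apply, PMF.map_apply]
    simp only [Finset.mem_range, Finset.card_range, PMF.uniformOfFintype_apply, ZMod.card]
    split_ifs with hk
    · rw [tsum_eq_single (k : ZMod m)]
      · simp [ZMod.val_natCast, Nat.mod_eq_of_lt hk]
      · intro b hb
        rw [if_neg]
        rintro rfl
        exact hb (by simp)
    · symm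
      rw [ENNReal.tsum_eq_zero]
      intro b
      rw [if_neg]
      rintro rfl
      exact hk b.val_lt
  rw [h, PMF.bind_map]
  rfl

end Expectation

/-! ### Invariants and expectations for loops -/

section Loops

variable {ℓ : ℕ} {E : Env ℓ} {body : Config ℓ → PMF (Config ℓ)}

theorem loopExec_support (t : Test) (P : Config ℓ → Prop)
    (htick : ∀ c k, P c → P (c.tick k))
    (hbody : ∀ c, P c → ∀ c' ∈ (body c).support, P c') (n : ℕ) (c : Config ℓ) (hc : P c) :
    ∀ c' ∈ (loopExec E t body n c).support, P c' := by
  induction n generalizing c with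
  | zero =>
    intro c' hc'
    rw [loopExec, PMF.mem_support_pure_iff] at hc'
    rwa [hc']
  | succ n ih =>
    intro c' hc'
    rw [loopExec] at hc'
    split_ifs at hc'
    · obtain ⟨c1, h1, h2⟩ := (PMF.mem_support_bind_iff _ _ _).1 hc'
      exact ih c1 (hbody _ (htick _ _ hc) c1 h1) c' h2
    · rw [PMF.mem_support_pure_iff] at hc'
      rw [hc']
      exact htick _ _ hc

theorem loopExec_always_support (P : ℕ → Config ℓ → Prop)
    (hbody : ∀ k c, P (k + 1) c → ∀ c' ∈ (body (c.tick (Test.always.cost ℓ + 1))).support, P k c')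
    (n : ℕ) (c : Config ℓ) (hc : P n c) :
    ∀ c' ∈ (loopExec E .always body n c).support, P 0 c' := by
  induction n generalizing c with
  | zero =>
    intro c' hc'
    rw [loopExec, PMF.mem_support_pure_iff] at hc'
    rwa [hc']
  | succ n ih =>
    intro c' hc'
    obtain ⟨c1, h1, h2⟩ := (PMF.mem_support_bind_iff _ _ _).1 hc'
    exact ih c1 (hbody n c hc c1 h1) c' h2

/-- A multiplicative supermartingale argument: each pass shrinks the expectation of `D` by its own
factor. The index counts the passes that remain, so the first pass contributes the factor with the
largest index. -/
theorem expect_loopExec_always_le (P : ℕ → Config ℓ → Prop) (D : Config ℓ → ℝ≥0∞) (a : ℕ → ℝ≥0∞)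
    (hbody : ∀ k c, P (k + 1) c → ∀ c' ∈ (body (c.tick (Test.always.cost ℓ + 1))).support, P k c')
    (hD : ∀ k c, P (k + 1) c → expect (body (c.tick (Test.always.cost ℓ + 1))) D ≤ a k * D c)
    (n : ℕ) (c : Config ℓ) (hc : P n c) :
    expect (loopExec E .always body n c) D ≤ (∏ k ∈ range n, a k) * D c := by
  induction n generalizing c with
  | zero => simp [loopExec, expect_pure]
  | succ n ih =>
    simp only [loopExec, Test.eval, if_true]
    rw [expect_bind, Finset.prod_range_succ, mul_assoc]
    calc expect (body (c.tick (Test.always.cost ℓ + 1)))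
          (fun c' => expect (loopExec E .always body n c') D)
        ≤ expect (body (c.tick (Test.always.cost ℓ + 1)))
          (fun c' => (∏ k ∈ range n, a k) * D c') :=
          expect_mono fun c' hc' => ih c' (hbody n c hc c' hc')
      _ ≤ _ := by
          rw [expect_mul_left]
          gcongr
          exact hD n c hc

end Loops

/-! ### Registers that a program leaves unchanged; queries against time -/

section Frames

variable {ℓ : ℕ} {E : Env ℓ}

/-- The program does not write the integer register `v`. -/
def Cmd.Avoids (v : IVar) : Cmd → Prop
  | .assign v' _ => v' ≠ v
  | .rand v' _ => v' ≠ v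
  | .seq p p' => p.Avoids v ∧ p'.Avoids v
  | .ite _ p p' => p.Avoids v ∧ p'.Avoids v
  | .loop _ _ p => p.Avoids v
  | _ => True

/-- The program does not write the string register `s`. -/
def Cmd.AvoidsStr (s : SVar) : Cmd → Prop
  | .copy s' _ => s' ≠ s
  | .sample s' => s' ≠ s
  | .query s' _ _ => s' ≠ s
  | .seq p p' => p.AvoidsStr s ∧ p'.AvoidsStr s
  | .ite _ p p' => p.AvoidsStr s ∧ p'.AvoidsStr s
  | .loop _ _ p => p.AvoidsStr s
  | _ => True

theorem Cmd.Avoids.int_eq {v : IVar} {p : Cmd} (h : p.Avoids v) (c : Config ℓ) :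
    ∀ c' ∈ (p.exec E c).support, c'.int v = c.int v := by
  induction p generalizing c with
  | skip => intro c' hc'; rw [Cmd.exec, PMF.mem_support_pure_iff] at hc'; rw [hc']
  | assign v' e =>
    intro c' hc'
    rw [Cmd.exec, PMF.mem_support_pure_iff] at hc'
    rw [hc']
    exact Function.update_of_ne (Ne.symm h) _ _
  | rand v' n =>
    intro c' hc'
    obtain ⟨k, -, rfl⟩ := (PMF.mem_support_map_iff _ _ _).1 hc'
    exact Function.update_of_ne (Ne.symm h) _ _
  | copy s t => intro c' hc'; rw [Cmd.exec, PMF.mem_support_pure_iff] at hc'; rw [hc']; rfl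
  | sample s =>
    intro c' hc'
    obtain ⟨k, -, rfl⟩ := (PMF.mem_support_map_iff _ _ _).1 hc'
    rfl
  | query s t t' => intro c' hc'; rw [Cmd.exec, PMF.mem_support_pure_iff] at hc'; rw [hc']; rfl
  | seq p p' ih ih' =>
    intro c' hc'
    obtain ⟨c1, h1, h2⟩ := (PMF.mem_support_bind_iff _ _ _).1 hc'
    exact (ih' h.2 c1 c' h2).trans (ih h.1 c c1 h1)
  | ite t p p' ih ih' =>
    intro c' hc'
    simp only [Cmd.exec] at hc'
    split_ifs at hc'
    · exact ih h.1 (c.tick (t.cost ℓ)) c' hc'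
    · exact ih' h.2 (c.tick (t.cost ℓ)) c' hc'
  | loop n t p ih =>
    exact loopExec_support t (fun c' => c'.int v = c.int v) (fun _ _ h => h)
      (fun c1 h1 c' hc' => (ih h c1 c' hc').trans h1) _ _ rfl

theorem Cmd.AvoidsStr.str_eq {s : SVar} {p : Cmd} (h : p.AvoidsStr s) (c : Config ℓ) :
    ∀ c' ∈ (p.exec E c).support, c'.str s = c.str s := by
  induction p generalizing c with
  | skip => intro c' hc'; rw [Cmd.exec, PMF.mem_support_pure_iff] at hc'; rw [hc']
  | assign v' e => intro c' hc'; rw [Cmd.exec, PMF.mem_support_pure_iff] at hc'; rw [hc']; rfl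
  | rand v' n =>
    intro c' hc'
    obtain ⟨k, -, rfl⟩ := (PMF.mem_support_map_iff _ _ _).1 hc'
    rfl
  | copy s' t =>
    intro c' hc'
    rw [Cmd.exec, PMF.mem_support_pure_iff] at hc'
    rw [hc']
    exact Function.update_of_ne (Ne.symm h) _ _
  | sample s' =>
    intro c' hc'
    obtain ⟨k, -, rfl⟩ := (PMF.mem_support_map_iff _ _ _).1 hc'
    exact Function.update_of_ne (Ne.symm h) _ _
  | query s' t t' =>
    intro c' hc'
    rw [Cmd.exec, PMF.mem_support_pure_iff] at hc'
    rw [hc']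
    exact Function.update_of_ne (Ne.symm h) _ _
  | seq p p' ih ih' =>
    intro c' hc'
    obtain ⟨c1, h1, h2⟩ := (PMF.mem_support_bind_iff _ _ _).1 hc'
    exact (ih' h.2 c1 c' h2).trans (ih h.1 c c1 h1)
  | ite t p p' ih ih' =>
    intro c' hc'
    simp only [Cmd.exec] at hc'
    split_ifs at hc'
    · exact ih h.1 (c.tick (t.cost ℓ)) c' hc'
    · exact ih' h.2 (c.tick (t.cost ℓ)) c' hc'
  | loop n t p ih =>
    exact loopExec_support t (fun c' => c'.str s = c.str s) (fun _ _ h => h)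
      (fun c1 h1 c' hc' => (ih h c1 c' hc').trans h1) _ _ rfl

/-- Every query takes one step. -/
theorem Cmd.queries_add_time_le (p : Cmd) (c : Config ℓ) :
    ∀ c' ∈ (p.exec E c).support, c'.queries + c.time ≤ c'.time + c.queries := by
  induction p generalizing c with
  | skip => intro c' hc'; rw [Cmd.exec, PMF.mem_support_pure_iff] at hc'; rw [hc']; omega
  | assign v' e =>
    intro c' hc'
    rw [Cmd.exec, PMF.mem_support_pure_iff] at hc'
    simp only [hc', Config.tick, Config.setInt]
    omega
  | rand v' n =>
    intro c' hc'
    obtain ⟨k, -, rfl⟩ := (PMF.mem_support_map_iff _ _ _).1 hc'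
    simp only [Config.tick, Config.setInt]
    omega
  | copy s' t =>
    intro c' hc'
    rw [Cmd.exec, PMF.mem_support_pure_iff] at hc'
    simp only [hc', Config.tick, Config.setStr]
    omega
  | sample s' =>
    intro c' hc'
    obtain ⟨k, -, rfl⟩ := (PMF.mem_support_map_iff _ _ _).1 hc'
    simp only [Config.tick, Config.setStr, Config.tickQuery]
    omega
  | query s' t t' =>
    intro c' hc'
    rw [Cmd.exec, PMF.mem_support_pure_iff] at hc'
    simp only [hc', Config.tick, Config.setStr, Config.tickQuery]
    omega
  | seq p p' ih ih' =>
    intro c' hc'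
    obtain ⟨c1, h1, h2⟩ := (PMF.mem_support_bind_iff _ _ _).1 hc'
    have := ih' c1 c' h2
    have := ih c c1 h1
    omega
  | ite t p p' ih ih' =>
    intro c' hc'
    simp only [Cmd.exec] at hc'
    split_ifs at hc'
    · have := ih _ c' hc'
      simp only [Config.tick] at this
      omega
    · have := ih' _ c' hc'
      simp only [Config.tick] at this
      omega
  | loop n t p ih =>
    refine loopExec_support t (fun c' => c'.queries + c.time ≤ c'.time + c.queries) ?_
      (fun c1 h1 c' hc' => ?_) _ _ ?_
    · intro c1 k h1
      simp only [Config.tick]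
      omega
    · have := ih c1 c' hc'
      omega
    · simp only [Config.tick]
      omega

end Frames

/-! ### Running time bounds read off from the syntax -/

section Costs

variable {ℓ : ℕ} (E : Env ℓ) (F : IVar → Prop)

/-- All registers in the expression satisfy `F`. -/
def Expr.Uses : Expr → Prop
  | .lit _ => True
  | .var v => F v
  | .read _ i => i.Uses
  | .add a b => a.Uses ∧ b.Uses
  | .sub a b => a.Uses ∧ b.Uses
  | .mul a b => a.Uses ∧ b.Uses
  | .div a b => a.Uses ∧ b.Uses
  | .mod a b => a.Uses ∧ b.Uses
  | .shiftRight a b => a.Uses ∧ b.Uses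

variable {E F} in
theorem Expr.Uses.eval_eq {e : Expr} (h : e.Uses F) {c c' : Config ℓ}
    (hc : ∀ v, F v → c.int v = c'.int v) : e.eval E c = e.eval E c' := by
  induction e with
  | lit n => rfl
  | var v => exact hc v h
  | read A i ih => simp only [Expr.eval, ih h]
  | add a b iha ihb => simp only [Expr.eval, iha h.1, ihb h.2]
  | sub a b iha ihb => simp only [Expr.eval, iha h.1, ihb h.2]
  | mul a b iha ihb => simp only [Expr.eval, iha h.1, ihb h.2]
  | div a b iha ihb => simp only [Expr.eval, iha h.1, ihb h.2]
  | mod a b iha ihb => simp only [Expr.eval, iha h.1, ihb h.2]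
  | shiftRight a b iha ihb => simp only [Expr.eval, iha h.1, ihb h.2]

/-- The numbers of passes through loops and the ranges of random numbers depend only on registers
in `F`. -/
def Cmd.Bounded : Cmd → Prop
  | .rand _ n => n.Uses F
  | .seq p p' => p.Bounded ∧ p'.Bounded
  | .ite _ p p' => p.Bounded ∧ p'.Bounded
  | .loop n _ p => n.Uses F ∧ p.Bounded
  | _ => True

/-- A bound for the running time of a program that does not change the registers which determine
the numbers of passes through its loops. -/
def Cmd.costBound (c₀ : Config ℓ) : Cmd → ℕ
  | .skip => 0
  | .assign _ e => e.cost + 1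
  | .rand _ n => n.cost + 1 + Nat.size (n.eval E c₀)
  | .copy _ _ => ℓ + 1
  | .sample _ => 1
  | .query _ _ _ => 1
  | .seq p p' => p.costBound c₀ + p'.costBound c₀
  | .ite t p p' => t.cost ℓ + (p.costBound c₀ + p'.costBound c₀)
  | .loop n t p => n.cost + 1 + (n.eval E c₀ * (t.cost ℓ + 1 + p.costBound c₀) + (t.cost ℓ + 1))

variable {E F}

/-- The last summand pays for the failing test that leaves the loop early. -/
theorem loopExec_time_le {body : Config ℓ → PMF (Config ℓ)} (t : Test) (P : Config ℓ → Prop)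
    (htick : ∀ c k, P c → P (c.tick k)) (T : ℕ)
    (hbody : ∀ c, P c → ∀ c' ∈ (body c).support, P c' ∧ c'.time ≤ c.time + T)
    (n : ℕ) (c : Config ℓ) (hc : P c) :
    ∀ c' ∈ (loopExec E t body n c).support,
      c'.time ≤ c.time + (n * (t.cost ℓ + 1 + T) + (t.cost ℓ + 1)) := by
  induction n generalizing c with
  | zero =>
    intro c' hc'
    rw [loopExec, PMF.mem_support_pure_iff] at hc'
    rw [hc']
    omega
  | succ n ih =>
    intro c' hc'
    rw [loopExec] at hc'
    rw [add_mul, one_mul]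
    split_ifs at hc'
    · obtain ⟨c1, h1, h2⟩ := (PMF.mem_support_bind_iff _ _ _).1 hc'
      obtain ⟨h3, h4⟩ := hbody _ (htick _ _ hc) c1 h1
      have := ih c1 h3 c' h2
      simp only [Config.tick] at h4
      omega
    · rw [PMF.mem_support_pure_iff] at hc'
      rw [hc']
      simp only [Config.tick]
      omega

/-- Registers in `F` are never written, so every loop bound and random range has the same value
whenever it is evaluated as in `c₀`. -/
theorem Cmd.Bounded.time_le {p : Cmd} (hp : p.Bounded F) (hF : ∀ v, F v → p.Avoids v)
    {c₀ c : Config ℓ} (hc : ∀ v, F v → c.int v = c₀.int v) :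
    ∀ c' ∈ (p.exec E c).support, c'.time ≤ c.time + p.costBound E c₀ := by
  induction p generalizing c with
  | skip => intro c' hc'; rw [Cmd.exec, PMF.mem_support_pure_iff] at hc'; rw [hc']; omega
  | assign v' e =>
    intro c' hc'
    rw [Cmd.exec, PMF.mem_support_pure_iff] at hc'
    rw [hc']
    exact le_rfl
  | rand v' n =>
    intro c' hc'
    obtain ⟨k, -, rfl⟩ := (PMF.mem_support_map_iff _ _ _).1 hc'
    rw [Cmd.costBound, ← Expr.Uses.eval_eq hp hc]
    exact le_rfl
  | copy s' t =>
    intro c' hc'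
    rw [Cmd.exec, PMF.mem_support_pure_iff] at hc'
    rw [hc']
    exact le_rfl
  | sample s' =>
    intro c' hc'
    obtain ⟨k, -, rfl⟩ := (PMF.mem_support_map_iff _ _ _).1 hc'
    exact le_rfl
  | query s' t t' =>
    intro c' hc'
    rw [Cmd.exec, PMF.mem_support_pure_iff] at hc'
    rw [hc']
    exact le_rfl
  | seq p p' ih ih' =>
    intro c' hc'
    obtain ⟨c1, h1, h2⟩ := (PMF.mem_support_bind_iff _ _ _).1 hc'
    have h3 := ih hp.1 (fun v hv => (hF v hv).1) hc c1 h1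
    have h4 := ih' hp.2 (fun v hv => (hF v hv).2)
      (fun v hv => ((hF v hv).1.int_eq c c1 h1).trans (hc v hv)) c' h2
    rw [Cmd.costBound]
    omega
  | ite t p p' ih ih' =>
    intro c' hc'
    simp only [Cmd.exec] at hc'
    rw [Cmd.costBound]
    split_ifs at hc'
    · have := ih hp.1 (fun v hv => (hF v hv).1) (c := c.tick (t.cost ℓ)) hc c' hc'
      simp only [Config.tick] at this
      omega
    · have := ih' hp.2 (fun v hv => (hF v hv).2) (c := c.tick (t.cost ℓ)) hc c' hc'
      simp only [Config.tick] at this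
      omega
  | loop n t p ih =>
    intro c' hc'
    have h := loopExec_time_le t (fun c => ∀ v, F v → c.int v = c₀.int v) (fun _ _ h => h)
      (p.costBound E c₀) (fun c1 h1 c' hc' => ⟨fun v hv =>
        (Cmd.Avoids.int_eq (p := p) (hF v hv) c1 c' hc').trans (h1 v hv), ih hp.2 hF h1 c' hc'⟩)
      _ (c.tick (n.cost + 1)) hc c' hc'
    rw [Cmd.costBound, ← Expr.Uses.eval_eq hp.1 hc]
    simp only [Config.tick] at h
    omega

end Costs
end CyclicTesting

namespace CyclicTesting
open Finset ENNReal

/-! ### A single homomorphism or injectivity test -/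

section Rounds

variable {ℓ : ℕ} {Γ : Type u}

/-- The map `f_γ` on the integers modulo `m`. -/
def fCyclic (op : Γ → Γ → Γ) (m : ℕ) (γ : Γ) (x : ZMod m) : Γ := fMap op m γ x.val

/-- The oracles of `E` present the magma `(Γ, op)`, and numbers below `2 * m` fit into a word. -/
structure Env.Models (E : Env ℓ) (op : Γ → Γ → Γ) (π : Γ → BitString ℓ) (m : ℕ) : Prop where
  one_lt : 1 < E.w
  two_mul_le : 2 * m ≤ 2 ^ E.w
  injective : Function.Injective π
  query : ∀ x y, E.O₂ (π x) (π y) = π (op x y)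

/-- The registers contain the data needed to compute `f_γ`. -/
structure Config.Ready (m : ℕ) (z : BitString ℓ) (c : Config ℓ) : Prop where
  int_m : c.int .m = m
  int_len : c.int .len = m.size
  str_gamma : c.str .gamma = z

theorem Config.Ready.of_mem_support {E : Env ℓ} {m : ℕ} {z : BitString ℓ} {c c' : Config ℓ}
    (h : c.Ready m z) {p : Cmd} (hc' : c' ∈ (p.exec E c).support) (h1 : p.Avoids .m)
    (h2 : p.Avoids .len) (h3 : p.AvoidsStr .gamma) : c'.Ready m z :=
  ⟨(h1.int_eq c c' hc').trans h.int_m, (h2.int_eq c c' hc').trans h.int_len,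
    (h3.str_eq c c' hc').trans h.str_gamma⟩

theorem evalF_avoids (dst : SVar) (src v : IVar) (h1 : v ≠ .tmp) (h2 : v ≠ .j) (h3 : v ≠ .bit)
    (h4 : v ≠ .started) : (evalF dst src).Avoids v := by
  simp [evalF, powerStep, block, Cmd.Avoids, h1.symm, h2.symm, h3.symm, h4.symm]

theorem evalF_avoidsStr (dst s : SVar) (src : IVar) (h : s ≠ dst) :
    (evalF dst src).AvoidsStr s := by
  simp [evalF, powerStep, block, Cmd.AvoidsStr, h.symm]

theorem homTest_avoids (v : IVar) (h : v ∈ [IVar.m, .r, .len, .d₁, .d₂, .d₃, .i]) :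
    homTest.Avoids v := by
  simp only [List.mem_cons, List.not_mem_nil, or_false] at h
  rcases h with rfl | rfl | rfl | rfl | rfl | rfl | rfl <;>
    simp [homTest, evalF, powerStep, block, Cmd.Avoids]

theorem injTest_avoids (v : IVar) (h : v ∈ [IVar.m, .r, .len, .d₁, .d₂, .d₃, .i, .x, .y]) :
    injTest.Avoids v := by
  simp only [List.mem_cons, List.not_mem_nil, or_false] at h
  rcases h with rfl | rfl | rfl | rfl | rfl | rfl | rfl | rfl | rfl <;>
    simp [injTest, evalF, powerStep, block, Cmd.Avoids]

theorem mainBody_avoids (v : IVar) (h : v ∈ [IVar.m, .r, .len, .d₁, .d₂, .d₃]) :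
    mainBody.Avoids v := by
  simp only [List.mem_cons, List.not_mem_nil, or_false] at h
  rcases h with rfl | rfl | rfl | rfl | rfl | rfl <;>
    simp [mainBody, subgroupTest, injTest, homTest, evalF, powerStep, block, Cmd.Avoids]

theorem subgroupTest_avoids (v : IVar) (h : v ∈ [IVar.m, .r, .len, .d₁, .d₂, .d₃]) :
    subgroupTest.Avoids v := by
  simp only [List.mem_cons, List.not_mem_nil, or_false] at h
  rcases h with rfl | rfl | rfl | rfl | rfl | rfl <;>
    simp [subgroupTest, injTest, evalF, powerStep, block, Cmd.Avoids]

theorem homTest_avoidsStr : homTest.AvoidsStr .gamma := by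
  simp [homTest, evalF, powerStep, block, Cmd.AvoidsStr]

theorem injTest_avoidsStr : injTest.AvoidsStr .gamma := by
  simp [injTest, evalF, powerStep, block, Cmd.AvoidsStr]

theorem subgroupTest_avoidsStr : subgroupTest.AvoidsStr .gamma := by
  simp [subgroupTest, injTest, evalF, powerStep, block, Cmd.AvoidsStr]

variable {E : Env ℓ} {op : Γ → Γ → Γ} {π : Γ → BitString ℓ} {m : ℕ} {γ : Γ} {c : Config ℓ}

/-- Joins the correctness of `evalF` with its frame properties, so that several evaluations can be
chained. -/
theorem evalF_exec [NeZero m] (hE : E.Models op π m) (hc : c.Ready m (π γ)) (dst : SVar)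
    (hd : dst ≠ .gamma) (src : IVar) (hsrc : src ∈ [IVar.x, .s, .y]) (x : ZMod m)
    (hx : c.int src = x.val) :
    ∃ c', (evalF dst src).exec E c = PMF.pure c' ∧ c'.Ready m (π γ) ∧
      c'.str dst = π (fCyclic op m γ x) ∧ (∀ s, s ≠ dst → c'.str s = c.str s) ∧
      ∀ v, v ≠ .tmp → v ≠ .j → v ≠ .bit → v ≠ .started → c'.int v = c.int v := by
  obtain ⟨c', h1, h2⟩ := evalF_spec E hE.one_lt op π hE.query γ dst hd src hsrc c hc.str_gamma
    (by rw [hc.int_len, hc.int_m]) (by rw [hx, hc.int_m]; exact x.val_lt)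
  have h3 : c' ∈ ((evalF dst src).exec E c).support := by rw [h1]; simp
  refine ⟨c', h1, ?_, ?_, fun s hs => (evalF_avoidsStr dst s src hs).str_eq c c' h3,
    fun v a b d e => (evalF_avoids dst src v a b d e).int_eq c c' h3⟩
  · exact hc.of_mem_support h3 (evalF_avoids _ _ _ (by simp) (by simp) (by simp) (by simp))
      (evalF_avoids _ _ _ (by simp) (by simp) (by simp) (by simp)) (evalF_avoidsStr _ _ _ hd.symm)
  · rw [h2, hc.int_m, hx, fCyclic]

theorem eval_add_mod [NeZero m] (hE : E.Models op π m) (hc : c.int .m = m) {v v' : IVar}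
    {x y : ZMod m} (hx : c.int v = x.val) (hy : c.int v' = y.val) :
    (Expr.mod (.add (.var v) (.var v')) (.var .m)).eval E c = (x + y).val := by
  have h1 := x.val_lt
  have h2 := y.val_lt
  have h3 := hE.two_mul_le
  simp only [Expr.eval, hc, hx, hy, ZMod.val_add]
  rw [Nat.mod_eq_of_lt (show x.val + y.val < 2 ^ E.w by omega)]

/-- After `x` and `y` have been drawn the test is deterministic, so its distribution is the image of
the uniform one. Comparing strings decides equality in `Γ` because `π` is injective. -/
theorem homTest_exec [NeZero m] [DecidableEq Γ] (hE : E.Models op π m) (hc : c.Ready m (π γ)) :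
    ∃ g : ZMod m → ZMod m → Config ℓ,
      (homTest.exec E c = (PMF.uniformOfFintype (ZMod m)).bind fun x =>
        (PMF.uniformOfFintype (ZMod m)).bind fun y => PMF.pure (g x y)) ∧
      ∀ x y, (g x y).int .decision =
        if fCyclic op m γ (x + y) = op (fCyclic op m γ x) (fCyclic op m γ y) then c.int .decision
        else 0 := by
  set after : ZMod m → ZMod m → Config ℓ := fun x y =>
    ((((c.setInt .x x.val).tick ((Expr.var IVar.m).cost + 1 + Nat.size m)).setInt .y y.val).tick
      ((Expr.var IVar.m).cost + 1 + Nat.size m)) with hafter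
  set rest : Cmd := block [
    .assign .s (.mod (.add (.var .x) (.var .y)) (.var .m)),
    evalF .f .s, evalF .g .x, evalF .h .y, .query .g .g .h,
    .ite (.strEq .f .g) .skip (.assign .decision (.lit 0))] with hrest
  have hexec : homTest.exec E c = (PMF.uniformOfFintype (ZMod m)).bind fun x =>
      (PMF.uniformOfFintype (ZMod m)).bind fun y => rest.exec E (after x y) := by
    have : homTest = .seq (.rand .x (.var .m)) (.seq (.rand .y (.var .m)) rest) := rfl
    rw [this]
    simp only [Cmd.exec, Expr.eval, hc.int_m]
    rw [PMF.bind_map, uniformBelow_bind]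
    congr 1
    funext x
    simp only [Function.comp]
    have hm : ((c.setInt .x x.val).tick ((Expr.var IVar.m).cost + 1 + Nat.size m)).int .m = m := by
      simpa [Config.tick, Config.setInt] using hc.int_m
    rw [hm, PMF.bind_map, uniformBelow_bind]
    rfl
  have hspec : ∀ x y, ∃ c', rest.exec E (after x y) = PMF.pure c' ∧ c'.int .decision =
        if fCyclic op m γ (x + y) = op (fCyclic op m γ x) (fCyclic op m γ y) then c.int .decision
        else 0 := by
    intro x y
    set c0 := after x y with hc0
    have hx0 : c0.int .x = x.val := by simp [hc0, hafter, Config.tick, Config.setInt]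
    have hy0 : c0.int .y = y.val := by simp [hc0, hafter, Config.tick, Config.setInt]
    have hm0 : c0.int .m = m := by simp [hc0, hafter, Config.tick, Config.setInt, hc.int_m]
    have hl0 : c0.int .len = m.size := by
      simp [hc0, hafter, Config.tick, Config.setInt, hc.int_len]
    have hd0 : c0.int .decision = c.int .decision := by
      simp [hc0, hafter, Config.tick, Config.setInt]
    have hg0 : c0.str .gamma = π γ := by
      simp [hc0, hafter, Config.tick, Config.setInt, hc.str_gamma]
    have hs0 := eval_add_mod (E := E) hE hm0 hx0 hy0
    set e : Expr := Expr.mod (.add (.var .x) (.var .y)) (.var .m) with he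
    set c1 := (c0.setInt .s (e.eval E c0)).tick (e.cost + 1) with hc1
    have hs1 : c1.int .s = (x + y).val := by simp [hc1, Config.tick, Config.setInt, hs0]
    have hi1 : ∀ v, v ≠ .s → c1.int v = c0.int v := by
      intro v hv
      simp [hc1, Config.tick, Config.setInt, hv]
    have hr1 : c1.Ready m (π γ) :=
      ⟨by rw [hi1 _ (by simp), hm0], by rw [hi1 _ (by simp), hl0], hg0⟩
    obtain ⟨c2, a2, b2, d2, e2, f2⟩ :=
      evalF_exec hE hr1 .f (by simp) .s (by simp) (x + y) hs1
    obtain ⟨c3, a3, b3, d3, e3, f3⟩ :=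
      evalF_exec hE b2 .g (by simp) .x (by simp) x (by
        rw [f2 _ (by simp) (by simp) (by simp) (by simp), hi1 _ (by simp), hx0])
    obtain ⟨c4, a4, b4, d4, e4, f4⟩ :=
      evalF_exec hE b3 .h (by simp) .y (by simp) y (by
        rw [f3 _ (by simp) (by simp) (by simp) (by simp),
          f2 _ (by simp) (by simp) (by simp) (by simp), hi1 _ (by simp), hy0])
    have hdec : c4.int .decision = c.int .decision := by
      rw [f4 _ (by simp) (by simp) (by simp) (by simp),
        f3 _ (by simp) (by simp) (by simp) (by simp),
        f2 _ (by simp) (by simp) (by simp) (by simp), hi1 _ (by simp), hd0]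
    have hf4 : c4.str .f = π (fCyclic op m γ (x + y)) := by
      rw [e4 _ (by simp), e3 _ (by simp), d2]
    have hg4 : c4.str .g = π (fCyclic op m γ x) := by rw [e4 _ (by simp), d3]
    have hex : rest.exec E c0 = (block [.query .g .g .h,
        .ite (.strEq .f .g) .skip (.assign .decision (.lit 0))]).exec E c4 := by
      simp only [hrest, block, Cmd.exec, PMF.pure_bind]
      rw [← hc1, a2, PMF.pure_bind, a3, PMF.pure_bind, a4, PMF.pure_bind]
    rw [hex]
    by_cases h : fCyclic op m γ (x + y) = op (fCyclic op m γ x) (fCyclic op m γ y)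
    · refine ⟨_, by
        simp [block, Cmd.exec, Test.eval, Config.tick, Config.setStr, Config.tickQuery,
          PMF.pure_bind, hf4, hg4, d4, hE.query, h]
        rfl, ?_⟩
      simp [h, hdec]
    · refine ⟨_, by
        simp [block, Cmd.exec, Test.eval, Config.tick, Config.setStr, Config.tickQuery,
          PMF.pure_bind, hf4, hg4, d4, hE.query, h, hE.injective.eq_iff]
        rfl, ?_⟩
      simp [h, Config.setInt, Expr.eval]
  choose g hg1 hg2 using hspec
  exact ⟨g, by rw [hexec]; simp only [hg1], hg2⟩

theorem injTest_exec [NeZero m] [DecidableEq Γ] (hE : E.Models op π m) (hc : c.Ready m (π γ))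
    {x y : ZMod m} (hx : c.int .x = x.val) (hy : c.int .y = y.val) :
    ∃ g : ZMod m → Config ℓ,
      (injTest.exec E c = (PMF.uniformOfFintype (ZMod m)).bind fun u => PMF.pure (g u)) ∧
      ∀ u, (g u).int .decision =
        if fCyclic op m γ (x + u) = fCyclic op m γ (y + u) then 0 else c.int .decision := by
  set after : ZMod m → Config ℓ := fun u =>
    (c.setInt .u u.val).tick ((Expr.var IVar.m).cost + 1 + Nat.size m) with hafter
  set rest : Cmd := block [
    .assign .s (.mod (.add (.var .x) (.var .u)) (.var .m)),
    evalF .f .s,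
    .assign .s (.mod (.add (.var .y) (.var .u)) (.var .m)),
    evalF .g .s,
    .ite (.strEq .f .g) (.assign .decision (.lit 0)) .skip] with hrest
  have hexec : injTest.exec E c = (PMF.uniformOfFintype (ZMod m)).bind fun u =>
      rest.exec E (after u) := by
    have : injTest = .seq (.rand .u (.var .m)) rest := rfl
    rw [this]
    simp only [Cmd.exec, Expr.eval, hc.int_m]
    rw [PMF.bind_map, uniformBelow_bind]
    rfl
  have hspec : ∀ u, ∃ c', rest.exec E (after u) = PMF.pure c' ∧ c'.int .decision =
        if fCyclic op m γ (x + u) = fCyclic op m γ (y + u) then 0 else c.int .decision := by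
    intro u
    set c0 := after u with hc0
    have hi0 : ∀ v, v ≠ .u → c0.int v = c.int v := by
      intro v hv
      simp [hc0, hafter, Config.tick, Config.setInt, hv]
    have hu0 : c0.int .u = u.val := by simp [hc0, hafter, Config.tick, Config.setInt]
    have hr0 : c0.Ready m (π γ) :=
      ⟨by rw [hi0 _ (by simp), hc.int_m], by rw [hi0 _ (by simp), hc.int_len], hc.str_gamma⟩
    have hs0 := eval_add_mod (E := E) hE hr0.int_m ((hi0 _ (by simp)).trans hx) hu0
    set e : Expr := Expr.mod (.add (.var .x) (.var .u)) (.var .m) with he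
    set c1 := (c0.setInt .s (e.eval E c0)).tick (e.cost + 1) with hc1
    have hs1 : c1.int .s = (x + u).val := by simp [hc1, Config.tick, Config.setInt, hs0]
    have hi1 : ∀ v, v ≠ .s → c1.int v = c0.int v := by
      intro v hv
      simp [hc1, Config.tick, Config.setInt, hv]
    have hr1 : c1.Ready m (π γ) :=
      ⟨by rw [hi1 _ (by simp), hr0.int_m], by rw [hi1 _ (by simp), hr0.int_len], hr0.str_gamma⟩
    obtain ⟨c2, a2, b2, d2, e2, f2⟩ :=
      evalF_exec hE hr1 .f (by simp) .s (by simp) (x + u) hs1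
    have hi2 : ∀ v, v ≠ .s → v ≠ .u → v ≠ .tmp → v ≠ .j → v ≠ .bit → v ≠ .started →
        c2.int v = c.int v := fun v h1 h2 h3 h4 h5 h6 =>
      (f2 v h3 h4 h5 h6).trans ((hi1 v h1).trans (hi0 v h2))
    have hu2 : c2.int .u = u.val := by
      rw [f2 _ (by simp) (by simp) (by simp) (by simp), hi1 _ (by simp), hu0]
    have hs2 := eval_add_mod (E := E) hE b2.int_m ((hi2 _ (by simp) (by simp) (by simp) (by simp)
      (by simp) (by simp)).trans hy) hu2
    set e' : Expr := Expr.mod (.add (.var .y) (.var .u)) (.var .m) with he'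
    set c3 := (c2.setInt .s (e'.eval E c2)).tick (e'.cost + 1) with hc3
    have hs3 : c3.int .s = (y + u).val := by simp [hc3, Config.tick, Config.setInt, hs2]
    have hi3 : ∀ v, v ≠ .s → c3.int v = c2.int v := by
      intro v hv
      simp [hc3, Config.tick, Config.setInt, hv]
    have hr3 : c3.Ready m (π γ) :=
      ⟨by rw [hi3 _ (by simp), b2.int_m], by rw [hi3 _ (by simp), b2.int_len], b2.str_gamma⟩
    obtain ⟨c4, a4, b4, d4, e4, f4⟩ :=
      evalF_exec hE hr3 .g (by simp) .s (by simp) (y + u) hs3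
    have hdec : c4.int .decision = c.int .decision := by
      rw [f4 _ (by simp) (by simp) (by simp) (by simp), hi3 _ (by simp),
        hi2 _ (by simp) (by simp) (by simp) (by simp) (by simp) (by simp)]
    have hf4 : c4.str .f = π (fCyclic op m γ (x + u)) := by
      rw [e4 _ (by simp), ← d2]
      rfl
    have hex : rest.exec E c0 = (block [
        .ite (.strEq .f .g) (.assign .decision (.lit 0)) .skip]).exec E c4 := by
      simp only [hrest, block, Cmd.exec, PMF.pure_bind]
      rw [← hc1, a2, PMF.pure_bind, ← hc3, a4, PMF.pure_bind]
    rw [hex]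
    by_cases h : fCyclic op m γ (x + u) = fCyclic op m γ (y + u)
    · refine ⟨_, by
        simp [block, Cmd.exec, Test.eval, Config.tick, hf4, d4, h]
        rfl, ?_⟩
      simp [h, Config.setInt, Expr.eval]
    · refine ⟨_, by
        simp [block, Cmd.exec, Test.eval, Config.tick, hf4, d4, h,
          hE.injective.eq_iff]
        rfl, ?_⟩
      simp [h, hdec]
  choose g hg1 hg2 using hspec
  exact ⟨g, by rw [hexec]; simp only [hg1], hg2⟩

end Rounds
end CyclicTesting

/-! ### How a round decides -/

namespace CyclicTesting
open Finset ENNReal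

theorem uniform_bind_uniform_bind {α β δ : Type*} [Fintype α] [Nonempty α] [Fintype β] [Nonempty β]
    (f : α → β → PMF δ) :
    ((PMF.uniformOfFintype α).bind fun x => (PMF.uniformOfFintype β).bind fun y => f x y) =
      (PMF.uniformOfFintype (α × β)).bind fun z => f z.1 z.2 := by
  ext d
  simp only [PMF.bind_apply, PMF.uniformOfFintype_apply, tsum_fintype, Fintype.sum_prod_type,
    Finset.mul_sum, Fintype.card_prod, Nat.cast_mul, ← mul_assoc]
  refine Finset.sum_congr rfl fun x _ => Finset.sum_congr rfl fun y _ => ?_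
  rw [ENNReal.mul_inv (Or.inr (natCast_ne_top _)) (Or.inl (natCast_ne_top _))]

section Decision

variable {ℓ : ℕ} {E : Env ℓ}

/-- The program changes the decision only to FAIL. -/
def Cmd.OnlyRejects : Cmd → Prop
  | .assign v e => v = .decision → e = .lit 0
  | .rand v _ => v ≠ .decision
  | .seq p p' => p.OnlyRejects ∧ p'.OnlyRejects
  | .ite _ p p' => p.OnlyRejects ∧ p'.OnlyRejects
  | .loop _ _ p => p.OnlyRejects
  | _ => True

/-- Since a round starts with the decision `1`, this confines its final decision to `0` or `1`. -/
theorem Cmd.OnlyRejects.decision_eq_or {p : Cmd} (h : p.OnlyRejects) (c : Config ℓ) :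
    ∀ c' ∈ (p.exec E c).support, c'.int .decision = c.int .decision ∨ c'.int .decision = 0 := by
  induction p generalizing c with
  | skip => intro c' hc'; rw [Cmd.exec, PMF.mem_support_pure_iff] at hc'; exact Or.inl (by rw [hc'])
  | assign v e =>
    intro c' hc'
    rw [Cmd.exec, PMF.mem_support_pure_iff] at hc'
    by_cases hv : v = .decision
    · right
      rw [hc', h hv, hv]
      simp [Config.tick, Config.setInt, Expr.eval]
    · left
      rw [hc']
      exact Function.update_of_ne (Ne.symm hv) _ _
  | rand v n =>
    intro c' hc'
    obtain ⟨k, -, rfl⟩ := (PMF.mem_support_map_iff _ _ _).1 hc'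
    exact Or.inl (Function.update_of_ne (Ne.symm h) _ _)
  | copy s t =>
    intro c' hc'
    rw [Cmd.exec, PMF.mem_support_pure_iff] at hc'
    rw [hc']
    exact Or.inl rfl
  | sample s =>
    intro c' hc'
    obtain ⟨k, -, rfl⟩ := (PMF.mem_support_map_iff _ _ _).1 hc'
    exact Or.inl rfl
  | query s t t' =>
    intro c' hc'
    rw [Cmd.exec, PMF.mem_support_pure_iff] at hc'
    rw [hc']
    exact Or.inl rfl
  | seq p p' ih ih' =>
    intro c' hc'
    obtain ⟨c1, h1, h2⟩ := (PMF.mem_support_bind_iff _ _ _).1 hc'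
    rcases ih' h.2 c1 c' h2 with h3 | h3
    · rw [h3]
      exact ih h.1 c c1 h1
    · exact Or.inr h3
  | ite t p p' ih ih' =>
    intro c' hc'
    simp only [Cmd.exec] at hc'
    split_ifs at hc'
    · exact ih h.1 (c.tick (t.cost ℓ)) c' hc'
    · exact ih' h.2 (c.tick (t.cost ℓ)) c' hc'
  | loop n t p ih =>
    refine loopExec_support t
      (fun c' => c'.int .decision = c.int .decision ∨ c'.int .decision = 0) (fun _ _ h => h)
      (fun c1 h1 c' hc' => ?_) _ _ (Or.inl rfl)
    rcases ih h c1 c' hc' with h3 | h3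
    · rwa [h3]
    · exact Or.inr h3

/-- The indicator function of the decision PASS. -/
noncomputable def passIndicator (c : Config ℓ) : ℝ≥0∞ := if c.int .decision = 1 then 1 else 0

/-- The indicator function of the decision FAIL. -/
noncomputable def failIndicator (c : Config ℓ) : ℝ≥0∞ := if c.int .decision = 0 then 1 else 0

theorem passIndicator_le_one (c : Config ℓ) : passIndicator c ≤ 1 := by
  rw [passIndicator]
  split_ifs <;> simp

theorem failIndicator_le_one (c : Config ℓ) : failIndicator c ≤ 1 := by
  rw [failIndicator]
  split_ifs <;> simp

end Decision

/-! ### Acceptance probabilities within a round -/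

section Rounds

variable {ℓ : ℕ} {Γ : Type u} {E : Env ℓ} {op : Γ → Γ → Γ} {π : Γ → BitString ℓ} {m r : ℕ} {γ : Γ}
  {c : Config ℓ}

/-- The arrays list `r` prime divisors of `m` and, for each of them, two distinct elements of the
subgroup of this order. -/
structure Env.Lists (E : Env ℓ) (m r : ℕ) : Prop where
  lt : r < 2 ^ E.w
  prime : ∀ i < r, (E.arr .prime i).Prime
  dvd : ∀ i < r, E.arr .prime i ∣ m
  fst_lt : ∀ i < r, E.arr .fst i < E.arr .prime i
  snd_lt : ∀ i < r, E.arr .snd i < E.arr .prime i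
  ne : ∀ i < r, E.arr .fst i ≠ E.arr .snd i

/-- The element of a subgroup of prime order which is given by an array entry. -/
def Env.element (E : Env ℓ) (A : Arr) (m i : ℕ) : ZMod m :=
  ((E.arr A i * (m / E.arr .prime i) : ℕ) : ZMod m)

theorem mul_div_lt_of_prime_dvd [NeZero m] {p k : ℕ} (hp : p.Prime) (hpm : p ∣ m) (hk : k < p) :
    k * (m / p) < m := by
  obtain ⟨n, rfl⟩ := hpm
  rw [Nat.mul_div_cancel_left _ hp.pos]
  have hn : 0 < n := Nat.pos_of_ne_zero fun h => NeZero.ne (p * n) (by simp [h])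
  exact Nat.mul_lt_mul_of_pos_right hk hn

theorem Env.val_element [NeZero m] {A : Arr} {i : ℕ} (hp : (E.arr .prime i).Prime)
    (hpm : E.arr .prime i ∣ m) (hA : E.arr A i < E.arr .prime i) :
    (E.element A m i).val = E.arr A i * (m / E.arr .prime i) := by
  rw [Env.element, ZMod.val_natCast, Nat.mod_eq_of_lt (mul_div_lt_of_prime_dvd hp hpm hA)]

theorem Env.nsmul_element (A : Arr) {i : ℕ} (hpm : E.arr .prime i ∣ m) :
    E.arr .prime i • E.element A m i = 0 := by
  rw [Env.element, nsmul_eq_mul, ← Nat.cast_mul, mul_left_comm, Nat.mul_div_cancel' hpm]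
  simp

theorem Env.Lists.element_ne [NeZero m] (hL : E.Lists m r) {i : ℕ} (hi : i < r) :
    E.element .fst m i ≠ E.element .snd m i := by
  intro h
  have h1 := congrArg ZMod.val h
  rw [Env.val_element (hL.prime i hi) (hL.dvd i hi) (hL.fst_lt i hi),
    Env.val_element (hL.prime i hi) (hL.dvd i hi) (hL.snd_lt i hi)] at h1
  refine hL.ne i hi (Nat.eq_of_mul_eq_mul_right ?_ h1)
  exact Nat.div_pos (Nat.le_of_dvd (NeZero.pos m) (hL.dvd i hi)) (hL.prime i hi).pos

section Probabilities
variable [NeZero m] [DecidableEq Γ]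

/-- The probability that the homomorphism test does not reject. -/
noncomputable def homProb (op : Γ → Γ → Γ) (m : ℕ) [NeZero m] (γ : Γ) : ℝ≥0∞ :=
  ((badPairs op (fCyclic op m γ))ᶜ.card : ℝ≥0∞) / Fintype.card (ZMod m × ZMod m)

/-- The probability that the injectivity test for `x` and `y` does not reject. -/
noncomputable def injProb (op : Γ → Γ → Γ) (m : ℕ) [NeZero m] (γ : Γ) (x y : ZMod m) : ℝ≥0∞ :=
  ((univ.filter fun u => ¬ fCyclic op m γ (x + u) = fCyclic op m γ (y + u)).card : ℝ≥0∞) /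
    Fintype.card (ZMod m)

theorem card_div_card_le_one {α : Type*} [Fintype α] (S : Finset α) :
    (S.card : ℝ≥0∞) / Fintype.card α ≤ 1 :=
  ENNReal.div_le_of_le_mul (by rw [one_mul]; exact_mod_cast Finset.card_le_univ S)

/-- The factor `passIndicator c` records that an earlier rejection is never revoked; it makes the
bounds multiply along loops. -/
theorem expect_homTest_le (hE : E.Models op π m) (hc : c.Ready m (π γ)) :
    expect (homTest.exec E c) passIndicator ≤ homProb op m γ * passIndicator c := by
  obtain ⟨g, hg, hdec⟩ := homTest_exec hE hc
  rw [hg, uniform_bind_uniform_bind, expect_bind]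
  simp only [expect_pure]
  refine expect_uniform_indicator _ _ _ (fun z hz => ?_) (fun z hz => ?_)
  · rw [passIndicator, passIndicator, hdec]
    simp only [badPairs, mem_compl, mem_filter, mem_univ, true_and, not_not] at hz
    rw [if_pos hz]
  · rw [passIndicator, hdec]
    simp only [badPairs, mem_compl, mem_filter, mem_univ, true_and, not_not] at hz
    rw [if_neg hz]
    simp

theorem expect_injTest_le (hE : E.Models op π m) (hc : c.Ready m (π γ)) {x y : ZMod m}
    (hx : c.int .x = x.val) (hy : c.int .y = y.val) :
    expect (injTest.exec E c) passIndicator ≤ injProb op m γ x y * passIndicator c := by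
  obtain ⟨g, hg, hdec⟩ := injTest_exec hE hc hx hy
  rw [hg, expect_bind]
  simp only [expect_pure]
  refine expect_uniform_indicator _ _ _ (fun z hz => ?_) (fun z hz => ?_)
  · rw [passIndicator, passIndicator, hdec]
    simp only [mem_filter, mem_univ, true_and] at hz
    rw [if_neg hz]
  · rw [passIndicator, hdec]
    simp only [mem_filter, mem_univ, true_and, not_not] at hz
    rw [if_pos hz]
    simp

theorem expect_homLoop_le (hE : E.Models op π m) (hc : c.Ready m (π γ)) :
    expect ((Cmd.loop (.var .d₂) .always homTest).exec E c) passIndicator ≤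
      homProb op m γ ^ c.int .d₂ * passIndicator c := by
  have h := expect_loopExec_always_le (E := E) (body := homTest.exec E)
    (fun _ c => c.Ready m (π γ)) passIndicator (fun _ => homProb op m γ)
    (fun k c hc c' hc' => Config.Ready.of_mem_support (c := c.tick _) ⟨hc.1, hc.2, hc.3⟩ hc'
      (homTest_avoids _ (by simp)) (homTest_avoids _ (by simp)) homTest_avoidsStr)
    (fun k c hc => expect_homTest_le (c := c.tick _) hE ⟨hc.1, hc.2, hc.3⟩) (c.int .d₂)
    (c.tick ((Expr.var IVar.d₂).cost + 1)) ⟨hc.1, hc.2, hc.3⟩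
  rw [prod_const, card_range] at h
  exact h

theorem expect_injLoop_le (hE : E.Models op π m) (hc : c.Ready m (π γ)) {x y : ZMod m}
    (hx : c.int .x = x.val) (hy : c.int .y = y.val) :
    expect ((Cmd.loop (.var .d₃) .always injTest).exec E c) passIndicator ≤
      injProb op m γ x y ^ c.int .d₃ * passIndicator c := by
  have h := expect_loopExec_always_le (E := E) (body := injTest.exec E)
    (fun _ c => c.Ready m (π γ) ∧ c.int .x = x.val ∧ c.int .y = y.val) passIndicator
    (fun _ => injProb op m γ x y)
    (fun k c hc c' hc' => ⟨Config.Ready.of_mem_support (c := c.tick _) ⟨hc.1.1, hc.1.2, hc.1.3⟩ hc'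
      (injTest_avoids _ (by simp)) (injTest_avoids _ (by simp)) injTest_avoidsStr,
      ((injTest_avoids .x (by simp)).int_eq _ _ hc').trans hc.2.1,
      ((injTest_avoids .y (by simp)).int_eq _ _ hc').trans hc.2.2⟩)
    (fun k c hc => expect_injTest_le (c := c.tick _) hE ⟨hc.1.1, hc.1.2, hc.1.3⟩ hc.2.1 hc.2.2)
    (c.int .d₃) (c.tick ((Expr.var IVar.d₃).cost + 1)) ⟨⟨hc.1, hc.2, hc.3⟩, hx, hy⟩
  rw [prod_const, card_range] at h
  exact h

end Probabilities

/-- The products `k * (m / p)` with `k < p` stay below `m` and so fit into a word. The element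
registers therefore hold true representatives before the injectivity tests begin. -/
theorem subgroupTest_exec [NeZero m] (hE : E.Models op π m) (hL : E.Lists m r)
    (hc : c.Ready m (π γ)) {i : ℕ} (hi : i < r) (hci : c.int .i = i) :
    ∃ c' : Config ℓ, c'.Ready m (π γ) ∧ c'.int .x = (E.element .fst m i).val ∧
      c'.int .y = (E.element .snd m i).val ∧
      (∀ v, v ≠ .step → v ≠ .x → v ≠ .y → c'.int v = c.int v) ∧
      subgroupTest.exec E c = ((Cmd.loop (.var .d₃) .always injTest).exec E c').bind
        ((Cmd.assign .i (.add (.var .i) (.lit 1))).exec E) := by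
  have hlt : ∀ A, E.arr A i < E.arr .prime i →
      E.arr A i * (m / E.arr .prime i) % 2 ^ E.w = (E.element A m i).val := by
    intro A hA
    rw [Env.val_element (hL.prime i hi) (hL.dvd i hi) hA]
    have h1 := mul_div_lt_of_prime_dvd (hL.prime i hi) (hL.dvd i hi) hA
    have h2 := hE.two_mul_le
    exact Nat.mod_eq_of_lt (by omega)
  refine ⟨_, ?_, ?_, ?_, ?_, by
    simp only [subgroupTest, block, Cmd.exec, PMF.pure_bind, PMF.bind_pure]
    rfl⟩
  · exact ⟨by simpa [Config.tick, Config.setInt] using hc.1,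
      by simpa [Config.tick, Config.setInt] using hc.2, hc.3⟩
  · simpa [Config.tick, Config.setInt, Expr.eval, hc.int_m, hci] using
      hlt .fst (hL.fst_lt i hi)
  · simpa [Config.tick, Config.setInt, Expr.eval, hc.int_m, hci] using
      hlt .snd (hL.snd_lt i hi)
  · intro v h1 h2 h3
    simp [Config.tick, Config.setInt, h1, h2, h3]

theorem subgroupTest_int_i [NeZero m] (hE : E.Models op π m) (hL : E.Lists m r)
    (hc : c.Ready m (π γ)) {i : ℕ} (hi : i < r) (hci : c.int .i = i) :
    ∀ c' ∈ (subgroupTest.exec E c).support, c'.int .i = i + 1 := by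
  obtain ⟨c1, -, -, -, h1, h2⟩ := subgroupTest_exec hE hL hc hi hci
  intro c' hc'
  rw [h2] at hc'
  obtain ⟨c2, h3, h4⟩ := (PMF.mem_support_bind_iff _ _ _).1 hc'
  have h5 : c2.int .i = i := by
    rw [Cmd.Avoids.int_eq (v := .i) (by exact injTest_avoids _ (by simp)) c1 c2 h3,
      h1 _ (by simp) (by simp) (by simp), hci]
  rw [Cmd.exec, PMF.mem_support_pure_iff] at h4
  have h6 := hL.lt
  have h7 : 1 % 2 ^ E.w = 1 := Nat.mod_eq_of_lt (by omega)
  simp only [h4, Config.tick, Config.setInt, Function.update_self, Expr.eval, h5, h7]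
  exact Nat.mod_eq_of_lt (by omega)

/-- The state before the remaining `k` passes through the loop over the prime divisors. -/
def Config.ReadyFor (m : ℕ) (z : BitString ℓ) (r d : ℕ) (k : ℕ) (c : Config ℓ) : Prop :=
  c.Ready m z ∧ c.int .i + k = r ∧ c.int .d₃ = d

theorem Config.ReadyFor.of_mem_support [NeZero m] (hE : E.Models op π m) (hL : E.Lists m r)
    {d k : ℕ} (hc : c.ReadyFor m (π γ) r d (k + 1)) :
    ∀ c' ∈ (subgroupTest.exec E (c.tick (Test.always.cost ℓ + 1))).support,
      c'.ReadyFor m (π γ) r d k := by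
  intro c' hc'
  have hr : (c.tick (Test.always.cost ℓ + 1)).Ready m (π γ) := ⟨hc.1.1, hc.1.2, hc.1.3⟩
  have h0 := hc.2.1
  refine ⟨hr.of_mem_support hc' (subgroupTest_avoids _ (by simp)) (subgroupTest_avoids _ (by simp))
    subgroupTest_avoidsStr, ?_,
    ((subgroupTest_avoids .d₃ (by simp)).int_eq _ _ hc').trans hc.2.2⟩
  rw [subgroupTest_int_i hE hL hr (i := c.int .i) (by omega) rfl c' hc']
  omega

/-- The tests of one round. -/
def roundTests : Cmd := block [
  .loop (.var .d₂) .always homTest,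
  .assign .i (.lit 0),
  .loop (.var .r) .always subgroupTest]

theorem expect_subgroupLoop_le [NeZero m] [DecidableEq Γ] (hE : E.Models op π m)
    (hL : E.Lists m r) {d : ℕ} (hr : c.int .r = r) (hc : c.ReadyFor m (π γ) r d r) :
    expect ((Cmd.loop (.var .r) .always subgroupTest).exec E c) passIndicator ≤
      (∏ k ∈ range r, injProb op m γ (E.element .fst m (r - (k + 1)))
        (E.element .snd m (r - (k + 1))) ^ d) * passIndicator c := by
  have h := expect_loopExec_always_le (E := E) (body := subgroupTest.exec E)
    (fun k c => c.ReadyFor m (π γ) r d k) passIndicator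
    (fun k => injProb op m γ (E.element .fst m (r - (k + 1))) (E.element .snd m (r - (k + 1))) ^ d)
    (fun k c hc => hc.of_mem_support hE hL)
    (fun k c hc => by
      have hr : (c.tick (Test.always.cost ℓ + 1)).Ready m (π γ) := ⟨hc.1.1, hc.1.2, hc.1.3⟩
      have h0 := hc.2.1
      -- With `k + 1` passes remaining the current prime has index `r - (k + 1)`; hence the reversed
      -- indices in the product.
      have hi : c.int .i = r - (k + 1) := by omega
      obtain ⟨c1, h1, h2, h3, h4, h5⟩ :=
        subgroupTest_exec hE hL hr (i := r - (k + 1)) (by omega) hi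
      rw [h5, expect_bind]
      have h6 := expect_injLoop_le hE h1 h2 h3
      rw [h4 .d₃ (by simp) (by simp) (by simp)] at h6
      have h7 : passIndicator c1 = passIndicator c := by
        rw [passIndicator, passIndicator, h4 .decision (by simp) (by simp) (by simp)]
        rfl
      rw [h7, show (c.tick (Test.always.cost ℓ + 1)).int .d₃ = d from hc.2.2] at h6
      refine le_trans (le_of_eq ?_) h6
      congr 1
      funext c2
      rw [Cmd.exec, expect_pure, passIndicator, passIndicator]
      simp [Config.tick, Config.setInt])
    r (c.tick ((Expr.var IVar.r).cost + 1)) ⟨⟨hc.1.1, hc.1.2, hc.1.3⟩, hc.2⟩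
  simp only [Cmd.exec, Expr.eval, hr]
  exact h

theorem expect_roundTests_le [NeZero m] [DecidableEq Γ] (hE : E.Models op π m) (hL : E.Lists m r)
    (hr : c.int .r = r) (hc : c.Ready m (π γ)) :
    expect (roundTests.exec E c) passIndicator ≤ homProb op m γ ^ c.int .d₂ *
      ∏ k ∈ range r, injProb op m γ (E.element .fst m (r - (k + 1)))
        (E.element .snd m (r - (k + 1))) ^ c.int .d₃ := by
  set a := ∏ k ∈ range r, injProb op m γ (E.element .fst m (r - (k + 1)))
        (E.element .snd m (r - (k + 1))) ^ c.int .d₃ with ha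
  have h1 : roundTests.exec E c = ((Cmd.loop (.var .d₂) .always homTest).exec E c).bind fun c1 =>
      (Cmd.loop (.var .r) .always subgroupTest).exec E
        ((c1.setInt .i 0).tick ((Expr.lit 0).cost + 1)) := by
    simp only [roundTests, block, Cmd.exec, PMF.pure_bind, PMF.bind_pure]
    simp [Expr.eval]
  rw [h1, expect_bind]
  calc _ ≤ expect ((Cmd.loop (.var .d₂) .always homTest).exec E c)
        (fun c1 => a * passIndicator c1) := by
        refine expect_mono fun c1 hc1 => ?_
        have h2 : ∀ v ∈ [IVar.m, .r, .len, .d₁, .d₂, .d₃, .i], c1.int v = c.int v :=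
          fun v hv => Cmd.Avoids.int_eq (p := .loop (.var .d₂) .always homTest)
            (homTest_avoids v hv) c c1 hc1
        have h3 := hc.of_mem_support hc1 (homTest_avoids _ (by simp))
          (homTest_avoids _ (by simp)) homTest_avoidsStr
        refine (expect_subgroupLoop_le (c := (c1.setInt .i 0).tick ((Expr.lit 0).cost + 1))
          hE hL (d := c.int .d₃) ?_ ⟨⟨?_, ?_, h3.3⟩, ?_, ?_⟩).trans
          (le_of_eq ?_)
        · simp [Config.tick, Config.setInt, h2, hr]
        · simpa [Config.tick, Config.setInt] using h3.1
        · simpa [Config.tick, Config.setInt] using h3.2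
        · simp [Config.tick, Config.setInt]
        · simp [Config.tick, Config.setInt, h2]
        · simp [passIndicator, Config.tick, Config.setInt, ha]
    _ ≤ a * (homProb op m γ ^ c.int .d₂ * passIndicator c) := by
        rw [expect_mul_left]
        gcongr
        exact expect_homLoop_le hE hc
    _ ≤ a * (homProb op m γ ^ c.int .d₂ * 1) := by
        gcongr
        exact passIndicator_le_one c
    _ = _ := by ring

/-- An injective homomorphism passes every test whatever the random choices; injectivity is used for
the two distinct subgroup elements shifted by `u`. -/
theorem roundTests_pass [NeZero m] (hE : E.Models op π m) (hL : E.Lists m r)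
    (hr : c.int .r = r) (hc : c.Ready m (π γ)) (hdec : c.int .decision = 1)
    (hhom : ∀ x y, fCyclic op m γ (x + y) = op (fCyclic op m γ x) (fCyclic op m γ y))
    (hinj : Function.Injective (fCyclic op m γ)) :
    ∀ c' ∈ (roundTests.exec E c).support, c'.int .decision = 1 := by
  classical
  intro c' hc'
  obtain ⟨c1, h1, hc1⟩ := (PMF.mem_support_bind_iff _ _ _).1 hc'
  obtain ⟨c2, h2, hc2⟩ := (PMF.mem_support_bind_iff _ _ _).1 hc1
  simp only [block, Cmd.exec, PMF.bind_pure] at hc2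
  have h3 := loopExec_always_support (E := E) (body := homTest.exec E)
    (fun _ c => c.Ready m (π γ) ∧ c.int .decision = 1)
    (fun k c hc c' hc' => ⟨Config.Ready.of_mem_support (c := c.tick _) ⟨hc.1.1, hc.1.2, hc.1.3⟩ hc'
      (homTest_avoids _ (by simp)) (homTest_avoids _ (by simp)) homTest_avoidsStr, by
      obtain ⟨g, hg, hd⟩ := homTest_exec (c := c.tick (Test.always.cost ℓ + 1)) hE
        ⟨hc.1.1, hc.1.2, hc.1.3⟩
      rw [hg] at hc'
      simp only [PMF.mem_support_bind_iff, PMF.mem_support_pure_iff] at hc'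
      obtain ⟨x, -, y, -, rfl⟩ := hc'
      rw [hd, if_pos (hhom x y)]
      exact hc.2⟩) (c.int .d₂) (c.tick ((Expr.var IVar.d₂).cost + 1)) ⟨⟨hc.1, hc.2, hc.3⟩, hdec⟩
    c1 h1
  have h4 : c1.int .r = r := (Cmd.Avoids.int_eq (p := .loop (.var .d₂) .always homTest)
            (homTest_avoids .r (by simp)) c c1 h1).trans hr
  rw [Cmd.exec, PMF.mem_support_pure_iff] at h2
  have h5 : c2.int .r = r := by simp [h2, Config.tick, Config.setInt, h4]
  have h6 : c2.int .i = 0 := by simp [h2, Config.tick, Config.setInt, Expr.eval]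
  have h7 : c2.int .decision = 1 := by simp [h2, Config.tick, Config.setInt, h3.2]
  have h8 : c2.Ready m (π γ) := ⟨by simp [h2, Config.tick, Config.setInt, h3.1.1],
    by simp [h2, Config.tick, Config.setInt, h3.1.2], by rw [h2]; exact h3.1.3⟩
  simp only [Expr.eval, h5] at hc2
  refine (loopExec_always_support (E := E) (body := subgroupTest.exec E)
    (fun k c => c.ReadyFor m (π γ) r (c2.int .d₃) k ∧ c.int .decision = 1) ?_ r
    (c2.tick ((Expr.var IVar.r).cost + 1)) ⟨⟨⟨h8.1, h8.2, h8.3⟩, by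
      change c2.int .i + r = r
      omega, rfl⟩, h7⟩ c' hc2).2
  intro k c hc c' hc'
  refine ⟨hc.1.of_mem_support hE hL c' hc', ?_⟩
  have hr : (c.tick (Test.always.cost ℓ + 1)).Ready m (π γ) := ⟨hc.1.1.1, hc.1.1.2, hc.1.1.3⟩
  have h0 := hc.1.2.1
  have hi : c.int .i < r := by omega
  obtain ⟨c3, g1, g2, g3, g4, g5⟩ := subgroupTest_exec hE hL hr hi rfl
  rw [g5] at hc'
  obtain ⟨c4, g6, g7⟩ := (PMF.mem_support_bind_iff _ _ _).1 hc'
  rw [Cmd.exec, PMF.mem_support_pure_iff] at g7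
  have g8 : c'.int .decision = c4.int .decision := by
    simp [g7, Config.tick, Config.setInt]
  rw [g8]
  refine (loopExec_always_support (E := E) (body := injTest.exec E)
    (fun _ c' => c'.Ready m (π γ) ∧ c'.int .x = (E.element .fst m (c.int .i)).val ∧
      c'.int .y = (E.element .snd m (c.int .i)).val ∧ c'.int .decision = 1) ?_ (c3.int .d₃)
    (c3.tick ((Expr.var IVar.d₃).cost + 1)) ⟨⟨g1.1, g1.2, g1.3⟩, g2, g3, by
      exact (g4 .decision (by simp) (by simp) (by simp)).trans hc.2⟩ c4 g6).2.2.2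
  intro _ c5 hc5 c6 hc6
  have hr5 : (c5.tick (Test.always.cost ℓ + 1)).Ready m (π γ) :=
    ⟨hc5.1.1, hc5.1.2, hc5.1.3⟩
  refine ⟨hr5.of_mem_support hc6 (injTest_avoids _ (by simp)) (injTest_avoids _ (by simp))
      injTest_avoidsStr,
      ((injTest_avoids .x (by simp)).int_eq _ _ hc6).trans hc5.2.1,
      ((injTest_avoids .y (by simp)).int_eq _ _ hc6).trans hc5.2.2.1, ?_⟩
  obtain ⟨g, hg, hd⟩ := injTest_exec hE hr5 hc5.2.1 hc5.2.2.1
  rw [hg] at hc6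
  simp only [PMF.mem_support_bind_iff, PMF.mem_support_pure_iff] at hc6
  obtain ⟨u, -, rfl⟩ := hc6
  rw [hd, if_neg (fun h => hL.element_ne hi (add_right_cancel (hinj h)))]
  exact hc5.2.2.2

theorem roundTests_onlyRejects : roundTests.OnlyRejects := by
  simp [roundTests, subgroupTest, injTest, homTest, evalF, powerStep, block, Cmd.OnlyRejects]

/-- The state after the choice of `γ`. -/
def Config.chosen (c : Config ℓ) (z : BitString ℓ) : Config ℓ :=
  ((((c.setInt .decision 1).tick ((Expr.lit 1).cost + 1)).setStr .gamma z).tick 1).tickQuery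

theorem mainBody_exec [Fintype Γ] [Nonempty Γ] (hw : 1 < E.w)
    (hO : E.O₁ = (PMF.uniformOfFintype Γ).map π) (c : Config ℓ) :
    mainBody.exec E c =
      (PMF.uniformOfFintype Γ).bind fun γ => roundTests.exec E (c.chosen (π γ)) := by
  have h1 : 1 % 2 ^ E.w = 1 := Nat.mod_eq_of_lt (Nat.one_lt_two_pow (by omega))
  have : mainBody = .seq (.assign .decision (.lit 1)) (.seq (.sample .gamma) roundTests) := rfl
  rw [this]
  simp only [Cmd.exec, PMF.pure_bind, hO, PMF.map_comp, PMF.bind_map, Expr.eval, h1]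
  rfl

theorem Config.Ready.chosen {z : BitString ℓ} (h : c.Ready m z) (z' : BitString ℓ) :
    (c.chosen z').Ready m z' :=
  ⟨by simpa [Config.chosen, Config.tick, Config.setInt, Config.setStr, Config.tickQuery] using h.1,
   by simpa [Config.chosen, Config.tick, Config.setInt, Config.setStr, Config.tickQuery] using h.2,
   by simp [Config.chosen, Config.tick, Config.setInt, Config.setStr, Config.tickQuery]⟩

theorem Config.int_chosen {z : BitString ℓ} {v : IVar} (hv : v ≠ .decision) :
    (c.chosen z).int v = c.int v := by
  simp [Config.chosen, Config.tick, Config.setInt, Config.setStr, Config.tickQuery, hv]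

theorem Config.int_decision_chosen {z : BitString ℓ} : (c.chosen z).int .decision = 1 := by
  simp [Config.chosen, Config.tick, Config.setInt, Config.setStr, Config.tickQuery]

theorem mainBody_decision [Fintype Γ] [Nonempty Γ] (hw : 1 < E.w)
    (hO : E.O₁ = (PMF.uniformOfFintype Γ).map π) (c : Config ℓ) :
    ∀ c' ∈ (mainBody.exec E c).support, c'.int .decision = 1 ∨ c'.int .decision = 0 := by
  intro c' hc'
  rw [mainBody_exec hw hO] at hc'
  obtain ⟨γ, -, h⟩ := (PMF.mem_support_bind_iff _ _ _).1 hc'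
  have := roundTests_onlyRejects.decision_eq_or _ c' h
  rwa [Config.int_decision_chosen] at this

/-- The indicator of acceptance after repeating rounds until one of them accepts. -/
theorem expect_repeat_pass_le {body : Config ℓ → PMF (Config ℓ)} (I : Config ℓ → Prop)
    (htick : ∀ c k, I c → I (c.tick k))
    (hI : ∀ c, I c → ∀ c' ∈ (body c).support, I c') {δ : ℝ≥0∞}
    (hδ : ∀ c, I c → expect (body c) passIndicator ≤ δ)
    (hbin : ∀ c, ∀ c' ∈ (body c).support, c'.int .decision = 1 ∨ c'.int .decision = 0)
    (n : ℕ) (c : Config ℓ) (hc : I c) (hdec : c.int .decision = 0) :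
    expect (loopExec E (.eq (.var .decision) (.lit 0)) body n c) passIndicator ≤ n * δ := by
  induction n generalizing c with
  | zero => simp [loopExec, expect_pure, passIndicator, hdec]
  | succ n ih =>
    set t : Test := .eq (.var .decision) (.lit 0) with ht
    have h1 : t.eval E c = true := by simp [ht, Test.eval, Expr.eval, hdec]
    rw [loopExec, if_pos h1, expect_bind]
    -- Union bound: either this round accepts, or its decision is FAIL and the induction hypothesis
    -- covers the other `n` rounds.
    calc _ ≤ expect (body (c.tick (t.cost ℓ + 1))) (fun c' => passIndicator c' + n * δ) := by
          refine expect_mono fun c' hc' => ?_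
          rcases hbin _ c' hc' with h | h
          · refine (expect_le_of_forall fun x _ => passIndicator_le_one x).trans ?_
            rw [passIndicator, if_pos h]
            exact le_self_add
          · exact (ih c' (hI _ (htick _ _ hc) c' hc') h).trans le_add_self
      _ ≤ δ + n * δ := by
          rw [expect_add, expect_const]
          gcongr
          exact hδ _ (htick _ _ hc)
      _ = _ := by push_cast; ring

/-- The indicator of rejection after repeating rounds until one of them accepts. -/
theorem expect_repeat_fail_le {body : Config ℓ → PMF (Config ℓ)} (I : Config ℓ → Prop)
    (htick : ∀ c k, I c → I (c.tick k))
    (hI : ∀ c, I c → ∀ c' ∈ (body c).support, I c') {b : ℝ≥0∞}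
    (hb : ∀ c, I c → expect (body c) failIndicator ≤ b)
    (n : ℕ) (c : Config ℓ) (hc : I c) :
    expect (loopExec E (.eq (.var .decision) (.lit 0)) body n c) failIndicator ≤
      b ^ n * failIndicator c := by
  induction n generalizing c with
  | zero => simp [loopExec, expect_pure]
  | succ n ih =>
    set t : Test := .eq (.var .decision) (.lit 0) with ht
    by_cases hdec : c.int .decision = 0
    · have h1 : t.eval E c = true := by simp [ht, Test.eval, Expr.eval, hdec]
      rw [loopExec, if_pos h1, expect_bind]
      calc _ ≤ expect (body (c.tick (t.cost ℓ + 1))) (fun c' => b ^ n * failIndicator c') :=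
            expect_mono fun c' hc' => ih c' (hI _ (htick _ _ hc) c' hc')
        _ ≤ b ^ n * b := by
            rw [expect_mul_left]
            gcongr
            exact hb _ (htick _ _ hc)
        _ = _ := by rw [failIndicator, if_pos hdec, mul_one, pow_succ]
    · have h1 : ¬ t.eval E c = true := by simp [ht, Test.eval, Expr.eval, hdec]
      rw [loopExec, if_neg h1, expect_pure]
      simp [failIndicator, Config.tick, hdec]

end Rounds
end CyclicTesting

/-! ### Computing the parameters, and the cost of a round -/

namespace CyclicTesting
open Finset

theorem size_div_two {t : ℕ} (ht : 0 < t) : t.size = (t / 2).size + 1 := by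
  apply le_antisymm
  · rw [Nat.size_le, pow_succ]
    have := Nat.lt_size_self (t / 2)
    omega
  · rw [Nat.succ_le_iff, Nat.lt_size]
    obtain h | h := Nat.eq_zero_or_pos (t / 2).size
    · rw [h, pow_zero]
      exact ht
    · have h1 := Nat.lt_size.1 (show (t / 2).size - 1 < (t / 2).size by omega)
      have h2 : 2 ^ (t / 2).size = 2 ^ ((t / 2).size - 1) * 2 := by
        rw [← pow_succ]
        congr 1
        omega
      omega

theorem size_le_self (n : ℕ) : n.size ≤ n := Nat.size_le.2 Nat.lt_two_pow_self

section Parameters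

variable {ℓ : ℕ} {E : Env ℓ}

/-- Each pass halves `tmp`, so the test ends the loop after logarithmically many passes although up
to `n` are allowed. A pass costs `12` steps and the final failing test `4`. -/
theorem bitLength_loop (hw : 1 < E.w) (dst : IVar) (hd : dst ≠ .tmp) (n : ℕ) (c : Config ℓ)
    (hn : c.int .tmp ≤ n) (hlt : c.int dst + (c.int .tmp).size < 2 ^ E.w) :
    ∃ c', loopExec E (.lt (.lit 0) (.var .tmp)) ((block [
        .assign .tmp (.div (.var .tmp) (.lit 2)),
        .assign dst (.add (.var dst) (.lit 1))]).exec E) n c = PMF.pure c' ∧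
      c'.int dst = c.int dst + (c.int .tmp).size ∧
      (∀ v, v ≠ .tmp → v ≠ dst → c'.int v = c.int v) ∧
      c'.time ≤ c.time + 12 * (c.int .tmp).size + 4 := by
  have e1 : 1 % 2 ^ E.w = 1 := Nat.mod_eq_of_lt (Nat.one_lt_two_pow (by omega))
  have e2 : 2 % 2 ^ E.w = 2 := Nat.mod_eq_of_lt
    (lt_of_lt_of_le (by norm_num) (Nat.pow_le_pow_right (n := 2) (by norm_num) hw))
  induction n generalizing c with
  | zero =>
    have h0 : c.int .tmp = 0 := by omega
    exact ⟨c, rfl, by simp [h0], fun _ _ _ => rfl, by omega⟩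
  | succ n ih =>
    by_cases h0 : c.int .tmp = 0
    · refine ⟨c.tick ((Test.lt (.lit 0) (.var .tmp)).cost ℓ + 1), by
        simp [loopExec, Test.eval, Expr.eval, h0], ?_, fun v _ _ => rfl, ?_⟩
      · simp [Config.tick, h0]
      · simp [Config.tick, h0, Test.cost, Expr.cost]
    · have hpos : 0 < c.int .tmp := Nat.pos_of_ne_zero h0
      have hsize := size_div_two hpos
      set b := (block [
        .assign .tmp (.div (.var .tmp) (.lit 2)),
        .assign dst (.add (.var dst) (.lit 1))]) with hb
      set t : Test := .lt (.lit 0) (.var .tmp) with ht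
      obtain ⟨c1, h1, h2, h3, h4, h5⟩ : ∃ c1, b.exec E (c.tick (t.cost ℓ + 1)) = PMF.pure c1 ∧
          c1.int .tmp = c.int .tmp / 2 ∧ c1.int dst = c.int dst + 1 ∧
          (∀ v, v ≠ .tmp → v ≠ dst → c1.int v = c.int v) ∧ c1.time = c.time + 12 := by
        refine ⟨_, by simp only [hb, block, Cmd.exec, PMF.pure_bind]; rfl, ?_, ?_, ?_, ?_⟩
        · simp [Config.tick, Config.setInt, hd.symm, Expr.eval, e2]
        · simp only [Config.tick, Config.setInt, Expr.eval, Function.update_self, e1,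
            Function.update_of_ne hd]
          exact Nat.mod_eq_of_lt (by omega)
        · intro v hv hv'
          simp [Config.tick, Config.setInt, hv, hv']
        · simp [Config.tick, Config.setInt, ht, Test.cost, Expr.cost]
      have htrue : t.eval E c = true := by simp [ht, Test.eval, Expr.eval, hpos]
      obtain ⟨c', g1, g2, g3, g4⟩ := ih c1 (by omega) (by rw [h2, h3]; omega)
      refine ⟨c', ?_, ?_, fun v hv hv' => (g3 v hv hv').trans (h4 v hv hv'), ?_⟩
      · rw [loopExec, if_pos htrue, h1, PMF.pure_bind, g1]
      · rw [g2, h2, h3, hsize]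
        ring
      · rw [h2, h5] at g4
        rw [hsize]
        omega

theorem bitLength_exec (hw : 1 < E.w) (dst src : IVar) (hd : dst ≠ .tmp) (hs : src ≠ .tmp)
    (hsd : src ≠ dst) (c : Config ℓ) (hlt : c.int src < 2 ^ E.w) :
    ∃ c', (bitLength dst src).exec E c = PMF.pure c' ∧ c'.int dst = (c.int src).size ∧
      (∀ v, v ≠ .tmp → v ≠ dst → c'.int v = c.int v) ∧
      c'.time ≤ c.time + 12 * (c.int src).size + 10 := by
  set c0 : Config ℓ := (((c.setInt .tmp (c.int src)).tick 2).setInt dst 0).tick 4 with hc0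
  have h1 : c0.int .tmp = c.int src := by
    simp [hc0, Config.tick, Config.setInt, hd.symm]
  have h2 : c0.int dst = 0 := by simp [hc0, Config.tick, Config.setInt]
  have h3 : ∀ v, v ≠ .tmp → v ≠ dst → c0.int v = c.int v := by
    intro v hv hv'
    simp [hc0, Config.tick, Config.setInt, hv, hv']
  have h4 : c0.time = c.time + 6 := rfl
  obtain ⟨c', g1, g2, g3, g4⟩ := bitLength_loop hw dst hd (c.int src) c0 (by rw [h1])
    (by rw [h1, h2, zero_add]; exact (size_le_self _).trans_lt hlt)
  refine ⟨c', ?_, by rw [g2, h1, h2, zero_add], fun v hv hv' => (g3 v hv hv').trans (h3 v hv hv'),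
    by rw [h1, h4] at g4; omega⟩
  rw [← g1]
  simp only [bitLength, block, Cmd.exec, PMF.pure_bind, PMF.bind_pure]
  congr 1
  simp [Expr.eval, Config.tick, Config.setInt, hs, hsd]

variable {m N c₁ c₂ c₃ : ℕ} {c : Config ℓ}

/-- All size hypotheses serve to exclude wrap-around. Positivity of `N` and `c₂` bounds each of
these literals by their product. -/
theorem setParameters_exec (hw : 1 < E.w) (hm : 0 < m) (hmw : 2 * m ≤ 2 ^ E.w)
    (h₁ : c₁ * m.size.size < 2 ^ E.w) (h₂ : c₂ * N * m.size.size.size < 2 ^ E.w)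
    (hN : 0 < N) (hc₂ : 0 < c₂) (h₃ : c₃ * m.size.size.size < 2 ^ E.w) (hc : c.int .m = m) :
    ∃ c', (setParameters N c₁ c₂ c₃).exec E c = PMF.pure c' ∧
      c'.int .len = m.size ∧ c'.int .d₁ = c₁ * m.size.size ∧
      c'.int .d₂ = c₂ * N * m.size.size.size ∧ c'.int .d₃ = c₃ * m.size.size.size ∧
      c'.int .m = m ∧ c'.int .r = c.int .r ∧ c'.time ≤ c.time + 36 * m.size + 44 := by
  have s1 := size_le_self m
  have s2 := size_le_self m.size
  have s3 := size_le_self m.size.size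
  have p1 : 0 < m.size := Nat.size_pos.2 hm
  have p2 : 0 < m.size.size := Nat.size_pos.2 p1
  have p3 : 0 < m.size.size.size := Nat.size_pos.2 p2
  obtain ⟨a1, b1, d1, e1, f1⟩ := bitLength_exec hw .len .m (by simp) (by simp) (by simp) c
    (by rw [hc]; omega)
  rw [hc] at d1 f1
  obtain ⟨a2, b2, d2, e2, f2⟩ := bitLength_exec hw .len₂ .len (by simp) (by simp) (by simp) a1
    (by rw [d1]; omega)
  rw [d1] at d2 f2
  obtain ⟨a3, b3, d3, e3, f3⟩ := bitLength_exec hw .len₃ .len₂ (by simp) (by simp) (by simp) a2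
    (by rw [d2]; omega)
  rw [d2] at d3 f3
  have i2 : a3.int .len₂ = m.size.size := by rw [e3 _ (by simp) (by simp), d2]
  have i1 : a3.int .len = m.size := by
    rw [e3 _ (by simp) (by simp), e2 _ (by simp) (by simp), d1]
  have i0 : a3.int .m = m := by
    rw [e3 _ (by simp) (by simp), e2 _ (by simp) (by simp), e1 _ (by simp) (by simp), hc]
  have ir : a3.int .r = c.int .r := by
    rw [e3 _ (by simp) (by simp), e2 _ (by simp) (by simp), e1 _ (by simp) (by simp)]
  have q1 : c₁ % 2 ^ E.w = c₁ :=
    Nat.mod_eq_of_lt ((Nat.le_mul_of_pos_right c₁ p2).trans_lt h₁)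
  have q2 : c₂ * N < 2 ^ E.w := (Nat.le_mul_of_pos_right (c₂ * N) p3).trans_lt h₂
  have q3 : c₂ % 2 ^ E.w = c₂ := Nat.mod_eq_of_lt ((Nat.le_mul_of_pos_right c₂ hN).trans_lt q2)
  have q4 : N % 2 ^ E.w = N := Nat.mod_eq_of_lt ((Nat.le_mul_of_pos_left N hc₂).trans_lt q2)
  have q5 : c₃ % 2 ^ E.w = c₃ :=
    Nat.mod_eq_of_lt ((Nat.le_mul_of_pos_right c₃ p3).trans_lt h₃)
  have r1 := Nat.mod_eq_of_lt h₁
  have r2 := Nat.mod_eq_of_lt h₂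
  have r3 := Nat.mod_eq_of_lt h₃
  have r4 := Nat.mod_eq_of_lt q2
  refine ⟨_, by
    simp only [setParameters, block, Cmd.exec]
    rw [b1, PMF.pure_bind, b2, PMF.pure_bind, b3, PMF.pure_bind, PMF.pure_bind, PMF.pure_bind,
      PMF.pure_bind], ?_, ?_, ?_, ?_, ?_, ?_, ?_⟩
  · simp [Config.tick, Config.setInt, i1]
  · simp [Config.tick, Config.setInt, Expr.eval, i2, q1, r1]
  · simp [Config.tick, Config.setInt, Expr.eval, d3, q3, q4, r4, r2]
  · simp [Config.tick, Config.setInt, Expr.eval, d3, q5, r3]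
  · simp [Config.tick, Config.setInt, i0]
  · simp [Config.tick, Config.setInt, ir]
  · simp only [Config.tick, Config.setInt, Expr.cost]
    omega

theorem cyclicTestProgram_exec (hw : 1 < E.w) (hm : 0 < m) (hmw : 2 * m ≤ 2 ^ E.w)
    (h₁ : c₁ * m.size.size + 1 < 2 ^ E.w) (h₂ : c₂ * N * m.size.size.size < 2 ^ E.w)
    (hN : 0 < N) (hc₂ : 0 < c₂) (h₃ : c₃ * m.size.size.size < 2 ^ E.w) (hc : c.int .m = m) :
    ∃ c', (cyclicTestProgram N c₁ c₂ c₃).exec E c =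
        loopExec E (.eq (.var .decision) (.lit 0)) (mainBody.exec E) (c₁ * m.size.size + 1) c' ∧
      c'.int .len = m.size ∧ c'.int .decision = 0 ∧
      c'.int .d₂ = c₂ * N * m.size.size.size ∧ c'.int .d₃ = c₃ * m.size.size.size ∧
      c'.int .m = m ∧ c'.int .r = c.int .r ∧ c'.time ≤ c.time + 36 * m.size + 50 := by
  obtain ⟨a, b1, b2, b3, b4, b5, b6, b7, b8⟩ :=
    setParameters_exec (c₁ := c₁) hw hm hmw (by omega) h₂ hN hc₂ h₃ hc
  have e1 : 1 % 2 ^ E.w = 1 := Nat.mod_eq_of_lt (Nat.one_lt_two_pow (by omega))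
  refine ⟨((a.setInt .decision 0).tick 2).tick 4, ?_, ?_, ?_, ?_, ?_, ?_, ?_, ?_⟩
  · rw [cyclicTestProgram]
    simp only [block, Cmd.exec, PMF.bind_pure]
    rw [b1, PMF.pure_bind, PMF.pure_bind]
    have hn : (Expr.add (.var .d₁) (.lit 1)).eval E
        ((a.setInt .decision ((Expr.lit 0).eval E a)).tick ((Expr.lit 0).cost + 1)) =
        c₁ * m.size.size + 1 := by
      simp only [Expr.eval, Config.tick, Config.setInt, ne_eq, reduceCtorEq, not_false_eq_true,
        Function.update_of_ne, b3, e1]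
      exact Nat.mod_eq_of_lt h₁
    rw [hn]
    simp [Expr.eval, Expr.cost]
  · simp [Config.tick, Config.setInt, b2]
  · simp [Config.tick, Config.setInt]
  · simp [Config.tick, Config.setInt, b4]
  · simp [Config.tick, Config.setInt, b5]
  · simp [Config.tick, Config.setInt, b6]
  · simp [Config.tick, Config.setInt, b7]
  · simp only [Config.tick, Config.setInt]
    omega

/-- The registers which determine the running time of a round. -/
def IsParameter (v : IVar) : Prop := v ∈ [IVar.m, .r, .len, .d₂, .d₃]

theorem mainBody_bounded : mainBody.Bounded IsParameter := by
  simp [mainBody, subgroupTest, injTest, homTest, evalF, powerStep, block, Cmd.Bounded, Expr.Uses,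
    IsParameter]

/-- Evaluating `f_γ` takes a constant number of steps for each binary digit of `m`, besides one copy
of a string of length `ℓ`. A test has at most three evaluations and one comparison; `300` is a
generous constant. -/
theorem mainBody_costBound_le (c₀ : Config ℓ) (hm : c₀.int .m = m) (hl : c₀.int .len = m.size) :
    mainBody.costBound E c₀ ≤
      300 * (m.size + ℓ + 1) * (1 + c₀.int .d₂ + c₀.int .r * (1 + c₀.int .d₃)) := by
  have h1 : homTest.costBound E c₀ + 2 ≤ 300 * (m.size + ℓ + 1) := by
    simp only [homTest, evalF, powerStep, block, Cmd.costBound, Expr.cost, Test.cost, Expr.eval, hm,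
      hl]
    omega
  have h2 : injTest.costBound E c₀ + 2 ≤ 300 * (m.size + ℓ + 1) := by
    simp only [injTest, evalF, powerStep, block, Cmd.costBound, Expr.cost, Test.cost, Expr.eval, hm,
      hl]
    omega
  have h3 : subgroupTest.costBound E c₀ + 2 ≤
      300 * (m.size + ℓ + 1) * (1 + c₀.int .d₃) := by
    have h4 : subgroupTest.costBound E c₀ = 23 + c₀.int .d₃ * (injTest.costBound E c₀ + 2) := by
      simp only [subgroupTest, block, Cmd.costBound, Expr.cost, Test.cost, Expr.eval]
      ring
    have h5 := Nat.mul_le_mul_left (c₀.int .d₃) h2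
    calc _ ≤ 300 * (m.size + ℓ + 1) + c₀.int .d₃ * (300 * (m.size + ℓ + 1)) := by omega
      _ = _ := by ring
  have h4 : mainBody.costBound E c₀ = 13 + c₀.int .d₂ * (homTest.costBound E c₀ + 2) +
      c₀.int .r * (subgroupTest.costBound E c₀ + 2) := by
    simp only [mainBody, block, Cmd.costBound, Expr.cost, Test.cost, Expr.eval]
    ring
  have h5 := Nat.mul_le_mul_left (c₀.int .d₂) h1
  have h6 := Nat.mul_le_mul_left (c₀.int .r) h3
  rw [h4]
  calc _ ≤ 300 * (m.size + ℓ + 1) + c₀.int .d₂ * (300 * (m.size + ℓ + 1)) +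
        c₀.int .r * (300 * (m.size + ℓ + 1) * (1 + c₀.int .d₃)) := by omega
    _ = _ := by ring

theorem repeat_time_le (n : ℕ) (c₀ : Config ℓ) (hm : c₀.int .m = m) (hl : c₀.int .len = m.size) :
    ∀ c' ∈ (loopExec E (.eq (.var .decision) (.lit 0)) (mainBody.exec E) n c₀).support,
      c'.time ≤ c₀.time + 310 * (m.size + ℓ + 1) * ((n + 1) *
        (1 + c₀.int .d₂ + c₀.int .r * (1 + c₀.int .d₃))) := by
  intro c' hc'
  have hav : ∀ v, IsParameter v → mainBody.Avoids v := by
    intro v hv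
    refine mainBody_avoids v ?_
    simp only [IsParameter, List.mem_cons, List.not_mem_nil, or_false] at hv ⊢
    tauto
  have h := loopExec_time_le (E := E) (body := mainBody.exec E) (.eq (.var .decision) (.lit 0))
    (fun c => ∀ v, IsParameter v → c.int v = c₀.int v) (fun _ _ h => h)
    (mainBody.costBound E c₀) (fun c1 h1 c2 h2 => ⟨fun v hv =>
      ((hav v hv).int_eq c1 c2 h2).trans (h1 v hv), mainBody_bounded.time_le hav h1 c2 h2⟩)
    n c₀ (fun _ _ => rfl) c' hc'
  have h2 := mainBody_costBound_le (E := E) c₀ hm hl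
  set X := 1 + c₀.int .d₂ + c₀.int .r * (1 + c₀.int .d₃) with hX
  set B := m.size + ℓ + 1 with hB
  have hBX : 1 ≤ B * X := Nat.one_le_iff_ne_zero.2 (by positivity)
  have h3 : mainBody.costBound E c₀ + 4 ≤ 310 * (B * X) := by
    rw [mul_assoc] at h2
    omega
  refine h.trans (Nat.add_le_add_left ?_ _)
  simp only [Test.cost, Expr.cost]
  calc _ ≤ n * (310 * (B * X)) + 310 * (B * X) := by
        refine add_le_add (Nat.mul_le_mul_left n (by omega)) (by omega)
    _ = _ := by ring

end Parameters
end CyclicTesting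

namespace CyclicTesting
open Finset ENNReal

/-! ### Powers of a generator -/

section Powers

variable {Γ : Type u} {op : Γ → Γ → Γ}

theorem power_eq_pow [Group Γ] (h : ∀ x y : Γ, x * y = op x y) (γ : Γ) (a : ℕ) (ha : 0 < a) :
    power op γ a = γ ^ a := by
  induction a using Nat.strong_induction_on with
  | _ a ih =>
    rw [power]
    split_ifs with h1 h2
    · rw [show a = 1 by omega, pow_one]
    · rw [ih (a / 2) (by omega) (by omega), ← h, ← pow_add]
      congr 1
      omega
    · rw [ih (a - 1) (by omega) (by omega), ← h, ← pow_succ']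
      congr 1
      omega

/-- At `0` the value is `γ * γ ^ (m - 1) = γ ^ m = 1`. For `m = 1` the convention for `power` at `0`
gives `γ * γ`, and there `γ = 1`. -/
theorem fCyclic_eq_pow [Group Γ] (h : ∀ x y : Γ, x * y = op x y) {γ : Γ} {m : ℕ} [NeZero m]
    (hγ : orderOf γ = m) (x : ZMod m) : fCyclic op m γ x = γ ^ x.val := by
  rw [fCyclic, fMap]
  split_ifs with h0
  · rw [h0, pow_zero, ← h]
    obtain hm | hm := Nat.eq_zero_or_pos (m - 1)
    · have h1 : m = 1 := by
        have := NeZero.pos m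
        omega
      rw [h1, orderOf_eq_one_iff] at hγ
      rw [hm, power, if_pos (by omega), hγ, mul_one]
    · rw [power_eq_pow h _ _ hm, ← pow_succ', show m - 1 + 1 = m by omega, ← hγ,
        pow_orderOf_eq_one]
  · exact power_eq_pow h _ _ (Nat.pos_of_ne_zero h0)

theorem fCyclic_add [Group Γ] (h : ∀ x y : Γ, x * y = op x y) {γ : Γ} {m : ℕ} [NeZero m]
    (hγ : orderOf γ = m) (x y : ZMod m) :
    fCyclic op m γ (x + y) = op (fCyclic op m γ x) (fCyclic op m γ y) := by
  simp only [fCyclic_eq_pow h hγ, ← h, ← pow_add, ZMod.val_add]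
  nth_rewrite 3 [← hγ]
  rw [pow_mod_orderOf]

theorem fCyclic_injective [Group Γ] (h : ∀ x y : Γ, x * y = op x y) {γ : Γ} {m : ℕ} [NeZero m]
    (hγ : orderOf γ = m) : Function.Injective (fCyclic op m γ) := by
  intro x y hxy
  rw [fCyclic_eq_pow h hγ, fCyclic_eq_pow h hγ] at hxy
  refine ZMod.val_injective m (pow_injOn_Iio_orderOf ?_ ?_ hxy)
  · simpa [hγ] using x.val_lt
  · simpa [hγ] using y.val_lt

end Powers

/-! ### Instances: prime divisors and word length -/

section Presentation

variable {Γ : Type u} [Fintype Γ] [Nonempty Γ] {op : Γ → Γ → Γ} {I : Instance}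

theorem Instance.Presents.m_ne_zero (h : I.Presents op) : I.m ≠ 0 := by
  rw [h.size]
  exact Fintype.card_ne_zero

theorem Instance.Presents.dvd (h : I.Presents op) (i : Fin I.r) : I.p i ∣ I.m := by
  rw [h.factorization]
  exact (dvd_pow_self _ (h.exponent_pos i).ne').trans (Finset.dvd_prod_of_mem _ (mem_univ i))

theorem Instance.Presents.exists_eq (h : I.Presents op) {p : ℕ} (hp : p.Prime) (hpm : p ∣ I.m) :
    ∃ i, I.p i = p := by
  rw [h.factorization, hp.prime.dvd_finsetProd_iff] at hpm
  obtain ⟨i, -, hi⟩ := hpm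
  exact ⟨i, ((Nat.prime_dvd_prime_iff_eq hp (h.prime i)).1 (hp.dvd_of_dvd_pow hi)).symm⟩

theorem Instance.Presents.r_le (h : I.Presents op) : I.r ≤ I.m.primeFactors.card := by
  calc I.r = (univ : Finset (Fin I.r)).card := by simp
    _ ≤ _ := Finset.card_le_card_of_injOn I.p
      (fun i _ => Nat.mem_primeFactors.2 ⟨h.prime i, h.dvd i, h.m_ne_zero⟩) h.distinct.injOn

theorem Instance.Presents.r_lt (h : I.Presents op) : I.r < I.m :=
  h.r_le.trans_lt ((card_primeFactors_lt_size I.m h.m_ne_zero).trans_le (size_le_self _))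

theorem Instance.Presents.m_le_two_pow (h : I.Presents op) : I.m ≤ 2 ^ Nat.clog 2 I.q := by
  rw [h.size]
  exact h.binary.1.trans (Nat.le_pow_clog (by norm_num) _)

variable {ε : ℝ} {K : ℕ} {R : PairRule}

/-- The three summands of the word length make room for a constant, for `⌈1 / ε⌉` and for `m ≤ q`.
Every number the program computes is of this size. -/
theorem Instance.Presents.mul_lt_two_pow (h : I.Presents op) {a : ℕ} (ha : a < 2 ^ K) :
    a * ⌈1 / ε⌉₊ * I.m < 2 ^ (runEnv ε K R I).w := by
  have h1 := h.m_le_two_pow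
  have h2 : ⌈1 / ε⌉₊ ≤ 2 ^ Nat.clog 2 ⌈1 / ε⌉₊ := Nat.le_pow_clog (by norm_num) _
  have h3 : a * ⌈1 / ε⌉₊ * I.m ≤ a * 2 ^ Nat.clog 2 ⌈1 / ε⌉₊ * 2 ^ Nat.clog 2 I.q := by gcongr
  refine h3.trans_lt ?_
  have : 2 ^ (runEnv ε K R I).w =
      2 ^ K * 2 ^ Nat.clog 2 ⌈1 / ε⌉₊ * 2 ^ Nat.clog 2 I.q := by
    rw [← pow_add, ← pow_add]
    change 2 ^ wordLength ε K I.q = _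
    rw [wordLength]
    congr 1
    ring
  rw [this]
  gcongr

theorem one_le_ceil (hε : 0 < ε) : 1 ≤ ⌈1 / ε⌉₊ := Nat.one_le_ceil_iff.2 (by positivity)

theorem Instance.Presents.mul_m_lt_two_pow (h : I.Presents op) (hε : 0 < ε) {a : ℕ}
    (ha : a < 2 ^ K) : a * I.m < 2 ^ (runEnv ε K R I).w :=
  (Nat.mul_le_mul_right _ (Nat.le_mul_of_pos_right a (one_le_ceil hε))).trans_lt
    (h.mul_lt_two_pow ha)

theorem Instance.Presents.models (h : I.Presents op) (hε : 0 < ε) (hK : 2 ≤ K)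
    {π : Γ → BitString (Nat.clog 2 I.q)} (hinj : Function.Injective π)
    (hq : ∀ x y, I.O₂ (π x) (π y) = π (op x y)) : (runEnv ε K R I).Models op π I.m where
  one_lt := by
    change 1 < wordLength ε K I.q
    rw [wordLength]
    omega
  two_mul_le := (h.mul_m_lt_two_pow hε (hK.trans_lt Nat.lt_two_pow_self)).le
  injective := hinj
  query := hq

theorem arrayOf_eq {n : ℕ} (v : Fin n → ℕ) {i : ℕ} (hi : i < n) : arrayOf v i = v ⟨i, hi⟩ :=
  dif_pos hi

theorem Instance.Presents.lists (h : I.Presents op) (hε : 0 < ε) (hK : 2 ≤ K) :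
    (runEnv ε K R I).Lists I.m I.r := by
  have hp : ∀ i (hi : i < I.r), (runEnv ε K R I).arr .prime i = I.p ⟨i, hi⟩ :=
    fun i hi => arrayOf_eq _ hi
  have hf : ∀ i (hi : i < I.r), (runEnv ε K R I).arr .fst i = R.fst I.m (I.p ⟨i, hi⟩) :=
    fun i hi => arrayOf_eq (fun i => R.fst I.m (I.p i)) hi
  have hs : ∀ i (hi : i < I.r), (runEnv ε K R I).arr .snd i = R.snd I.m (I.p ⟨i, hi⟩) :=
    fun i hi => arrayOf_eq (fun i => R.snd I.m (I.p i)) hi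
  constructor
  · have h1 := h.mul_m_lt_two_pow (R := R) hε (hK.trans_lt Nat.lt_two_pow_self)
    have h2 := h.r_lt
    omega
  · intro i hi
    rw [hp i hi]
    exact h.prime _
  · intro i hi
    rw [hp i hi]
    exact h.dvd _
  · intro i hi
    rw [hp i hi, hf i hi]
    exact R.fst_lt _ _ (h.prime _) (h.dvd _)
  · intro i hi
    rw [hp i hi, hs i hi]
    exact R.snd_lt _ _ (h.prime _) (h.dvd _)
  · intro i hi
    rw [hf i hi, hs i hi]
    exact R.ne _ _ (h.prime _) (h.dvd _)

/-- The run consists of setting the parameters and repeating rounds. -/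
theorem Instance.Presents.run_eq (h : I.Presents op) (hε : 0 < ε) {c₁ c₂ c₃ : ℕ} (hc₂ : 0 < c₂)
    (h₁ : c₁ + 1 < 2 ^ K) (h₂ : c₂ < 2 ^ K) (h₃ : c₃ < 2 ^ K) (hK : 2 ≤ K) :
    ∃ c₀ : Config (Nat.clog 2 I.q), cyclicTestRun ε c₁ c₂ c₃ K R I =
        loopExec (runEnv ε K R I) (.eq (.var .decision) (.lit 0))
          (mainBody.exec (runEnv ε K R I)) (c₁ * I.m.size.size + 1) c₀ ∧
      c₀.int .len = I.m.size ∧ c₀.int .decision = 0 ∧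
      c₀.int .d₂ = c₂ * ⌈1 / ε⌉₊ * I.m.size.size.size ∧
      c₀.int .d₃ = c₃ * I.m.size.size.size ∧
      c₀.int .m = I.m ∧ c₀.int .r = I.r ∧ c₀.time ≤ 36 * I.m.size + 50 := by
  have hm := Nat.pos_of_ne_zero h.m_ne_zero
  have s1 := size_le_self I.m
  have s2 := size_le_self I.m.size
  have s3 := size_le_self I.m.size.size
  have g1 := h.mul_m_lt_two_pow (R := R) hε h₁
  have g2 := h.mul_lt_two_pow (ε := ε) (R := R) h₂
  have g3 := h.mul_m_lt_two_pow (R := R) hε h₃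
  obtain ⟨c₀, a1, a2, a3, a4, a5, a6, a7, a8⟩ := cyclicTestProgram_exec (E := runEnv ε K R I)
    (m := I.m) (N := ⌈1 / ε⌉₊) (c₁ := c₁) (c₂ := c₂) (c₃ := c₃) (c := startConfig I)
    (by
      change 1 < wordLength ε K I.q
      rw [wordLength]
      omega) hm
    (h.mul_m_lt_two_pow hε (hK.trans_lt Nat.lt_two_pow_self)).le
    (by
      refine lt_of_le_of_lt ?_ g1
      rw [add_mul, one_mul]
      exact add_le_add (Nat.mul_le_mul_left _ (s2.trans s1)) hm)
    (lt_of_le_of_lt (Nat.mul_le_mul_left _ (s3.trans (s2.trans s1))) g2)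
    (one_le_ceil hε) hc₂
    (lt_of_le_of_lt (Nat.mul_le_mul_left _ (s3.trans (s2.trans s1))) g3) rfl
  exact ⟨c₀, a1, a2, a3, a4, a5, a6, a7, by simpa [startConfig] using a8⟩

end Presentation

/-! ### Error probabilities of one round -/

section Acceptance

set_option linter.unusedSectionVars false

variable {Γ : Type u} [Fintype Γ] [Nonempty Γ] {op : Γ → Γ → Γ} {ℓ : ℕ} {E : Env ℓ}
  {π : Γ → BitString ℓ} {m r : ℕ} {c : Config ℓ}

/-- The number of generators determines the probability that a round accepts a cyclic group. -/
theorem expect_mainBody_fail_le [NeZero m] (hE : E.Models op π m) (hL : E.Lists m r)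
    (hO : E.O₁ = (PMF.uniformOfFintype Γ).map π) (hm : m = Fintype.card Γ)
    (hop : IsGroupIn cyclicGroups.{u} op) (hcm : c.int .m = m) (hcl : c.int .len = m.size)
    (hcr : c.int .r = r) :
    expect (mainBody.exec E c) failIndicator ≤ ((m - m.totient : ℕ) : ℝ≥0∞) / m := by
  classical
  obtain ⟨hG, hmul, hcyc⟩ := hop
  have hcyc' : IsCyclic Γ := hcyc
  rw [mainBody_exec hE.one_lt hO, expect_bind]
  -- Only elements that are not generators can make the round reject; there are `m - φ(m)` of them.
  refine (expect_uniform_indicator (univ.filter fun γ : Γ => ¬ orderOf γ = m) _ 1 (fun γ _ =>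
    expect_le_of_forall fun x _ => failIndicator_le_one x) (fun γ hγ => ?_)).trans (le_of_eq ?_)
  · simp only [mem_filter, mem_univ, true_and, not_not] at hγ
    have hready : c.Ready m (c.str .gamma) := ⟨hcm, hcl, rfl⟩
    refine le_antisymm (expect_le_of_forall fun c' hc' => ?_) (by simp)
    have := roundTests_pass hE hL ((Config.int_chosen (by simp)).trans hcr)
      (hready.chosen (π γ)) Config.int_decision_chosen (fCyclic_add hmul hγ)
      (fCyclic_injective hmul hγ) c' hc'
    simp [failIndicator, this]
  · have h1 : (univ.filter fun γ : Γ => orderOf γ = m).card = m.totient :=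
      IsCyclic.card_orderOf_eq_totient (by rw [hm])
    have h2 := Finset.card_filter_add_card_filter_not (s := (univ : Finset Γ))
      (fun γ : Γ => orderOf γ = m)
    rw [card_univ, h1, ← hm] at h2
    rw [mul_one, ← hm, ← Nat.eq_sub_of_add_eq' h2]

theorem natCast_div_pow_le {k m n : ℕ} (hm : 0 < m) {x : ℝ} (h : ((k : ℝ) / m) ^ n ≤ x) :
    ((k : ℝ≥0∞) / m) ^ n ≤ ENNReal.ofReal x := by
  have h1 : (k : ℝ≥0∞) / m = ENNReal.ofReal ((k : ℝ) / m) := by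
    rw [ENNReal.ofReal_div_of_pos (by exact_mod_cast hm), ENNReal.ofReal_natCast,
      ENNReal.ofReal_natCast]
  rw [h1, ← ENNReal.ofReal_pow (by positivity)]
  exact ENNReal.ofReal_le_ofReal h

theorem one_sub_pow_le_exp {x y : ℝ} (hx : 0 ≤ x) (h : x ≤ 1 - y) (n : ℕ) :
    x ^ n ≤ Real.exp (-(n * y)) := by
  calc x ^ n ≤ Real.exp (-y) ^ n :=
        pow_le_pow_left₀ hx (h.trans (by linarith [Real.add_one_le_exp (-y)])) n
    _ = _ := by rw [← Real.exp_nat_mul]; ring_nf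

theorem exp_neg_two_le : Real.exp (-2) ≤ 1 / 3 := by
  rw [Real.exp_neg, one_div]
  exact inv_anti₀ (by norm_num) (by linarith [Real.add_one_le_exp (2 : ℝ)])

theorem exp_neg_le_half_pow (n : ℕ) : Real.exp (-(n : ℝ)) ≤ (1 / 2) ^ n := by
  have h : Real.exp (-1) ≤ 1 / 2 := by
    rw [Real.exp_neg, one_div]
    exact inv_anti₀ (by norm_num) (by linarith [Real.add_one_le_exp (1 : ℝ)])
  calc Real.exp (-(n : ℝ)) = Real.exp (-1) ^ n := by rw [← Real.exp_nat_mul]; ring_nf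
    _ ≤ _ := pow_le_pow_left₀ (Real.exp_pos _).le h n

/-- A single test rejects with probability at least `1 / (32 * N)`, so `32 * N * n` tests all accept
with probability at most `exp (-n)`. -/
theorem homProb_pow_le [NeZero m] [DecidableEq Γ] {γ : Γ} {N n : ℕ} (hN : 0 < N)
    (h : m ^ 2 ≤ 32 * N * (badPairs op (fCyclic op m γ)).card) :
    homProb op m γ ^ (32 * N * n) ≤ ENNReal.ofReal ((1 / 2) ^ n) := by
  set b := (badPairs op (fCyclic op m γ)).card with hb
  have hm0 := NeZero.pos m
  have hcard : Fintype.card (ZMod m × ZMod m) = m ^ 2 := by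
    rw [Fintype.card_prod, ZMod.card, sq]
  rw [homProb, Finset.card_compl, hcard]
  refine natCast_div_pow_le (by positivity) ?_
  have hle : b ≤ m ^ 2 := by rw [← hcard]; exact Finset.card_le_univ _
  refine le_trans ?_ (exp_neg_le_half_pow n)
  have hNr : (0 : ℝ) < N := by exact_mod_cast hN
  have hmr : (0 : ℝ) < (m ^ 2 : ℕ) := by exact_mod_cast pow_pos hm0 2
  refine (one_sub_pow_le_exp (y := 1 / (32 * N)) (by positivity) ?_ _).trans (le_of_eq ?_)
  · rw [Nat.cast_sub hle, sub_div, div_self hmr.ne']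
    have h1 : ((m ^ 2 : ℕ) : ℝ) ≤ 32 * N * b := by exact_mod_cast h
    have h2 : 1 / (32 * (N : ℝ)) ≤ b / (m ^ 2 : ℕ) := by
      rw [div_le_div_iff₀ (by positivity) hmr]
      linarith
    linarith
  · congr 1
    push_cast
    field_simp

theorem injProb_pow_le [NeZero m] [DecidableEq Γ] {γ : Γ} {x y : ZMod m} (n : ℕ)
    (h : m ≤ 2 * (univ.filter fun u => fCyclic op m γ (x + u) = fCyclic op m γ (y + u)).card) :
    injProb op m γ x y ^ n ≤ ENNReal.ofReal ((1 / 2) ^ n) := by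
  have h1 := Finset.card_filter_add_card_filter_not (s := (univ : Finset (ZMod m)))
    (fun u => fCyclic op m γ (x + u) = fCyclic op m γ (y + u))
  rw [card_univ, ZMod.card] at h1
  rw [injProb, ZMod.card]
  have hm0 : (0 : ℝ) < m := by exact_mod_cast NeZero.pos m
  refine natCast_div_pow_le (NeZero.pos m) (pow_le_pow_left₀ (by positivity) ?_ n)
  rw [div_le_div_iff₀ hm0 (by norm_num)]
  norm_cast
  omega

/-- If the magma is far from the cyclic groups, then a round rarely accepts. -/
theorem expect_mainBody_pass_le [NeZero m] (hE : E.Models op π m) (hL : E.Lists m r)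
    (hO : E.O₁ = (PMF.uniformOfFintype Γ).map π) (hm : m = Fintype.card Γ)
    (hall : ∀ p, p.Prime → p ∣ m → ∃ i < r, E.arr .prime i = p) {ε : ℝ} (hε : 0 < ε)
    (hfar : HammingFar cyclicGroups.{u} ε Γ op) (hcm : c.int .m = m)
    (hcl : c.int .len = m.size) (hcr : c.int .r = r) {n : ℕ} (hd₃ : c.int .d₃ = n)
    (hd₂ : c.int .d₂ = 32 * ⌈1 / ε⌉₊ * n) :
    expect (mainBody.exec E c) passIndicator ≤ ENNReal.ofReal ((1 / 2) ^ n) := by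
  classical
  rw [mainBody_exec hE.one_lt hO, expect_bind]
  refine expect_le_of_forall fun γ _ => ?_
  have hready : c.Ready m (c.str .gamma) := ⟨hcm, hcl, rfl⟩
  refine (expect_roundTests_le hE hL ((Config.int_chosen (by simp)).trans hcr)
    (hready.chosen (π γ))).trans ?_
  rw [Config.int_chosen (by simp), Config.int_chosen (by simp), hd₃, hd₂]
  set a : ℕ → ℝ≥0∞ := fun k => injProb op m γ (E.element .fst m (r - (k + 1)))
    (E.element .snd m (r - (k + 1))) ^ n with ha
  have ha1 : ∀ k ∈ range r, a k ≤ 1 := fun k _ => pow_le_one₀ (by simp) (card_div_card_le_one _)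
  have hcard : Fintype.card (ZMod m) = Fintype.card Γ := by rw [ZMod.card, hm]
  -- For every `γ` one factor of the product is already small enough; all the others are bounded by
  -- `1`.
  rcases hfar.le_badPairs_or hcard hε (fCyclic op m γ) with h | ⟨p, hp, hpm, hK⟩
  · rw [ZMod.card] at h
    calc _ ≤ homProb op m γ ^ (32 * ⌈1 / ε⌉₊ * n) * 1 := by
          gcongr
          exact Finset.prod_le_one' ha1
      _ ≤ _ := by
          rw [mul_one]
          exact homProb_pow_le (one_le_ceil hε) h
  · rw [ZMod.card] at hpm
    obtain ⟨i, hi, rfl⟩ := hall p hp hpm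
    have h1 := hK (E.element .fst m i) (E.element .snd m i) (Env.nsmul_element _ hpm)
      (Env.nsmul_element _ hpm)
    rw [ZMod.card] at h1
    have hk : r - (i + 1) ∈ range r := mem_range.2 (by omega)
    have h2 : r - (r - (i + 1) + 1) = i := by omega
    calc _ ≤ 1 * ∏ k ∈ range r, a k := by
          gcongr
          exact pow_le_one₀ (by simp) (card_div_card_le_one _)
      _ = a (r - (i + 1)) * ∏ k ∈ (range r).erase (r - (i + 1)), a k := by
          rw [one_mul, Finset.mul_prod_erase _ _ hk]
      _ ≤ a (r - (i + 1)) * 1 := by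
          gcongr
          exact Finset.prod_le_one' fun k hk => ha1 k (mem_of_mem_erase hk)
      _ ≤ _ := by
          rw [mul_one]
          simp only [ha, h2]
          exact injProb_pow_le n h1

end Acceptance

/-! ### Error probabilities of the whole algorithm -/

section Tester

theorem two_thirds_le_of_add_eq_one {x y : ℝ≥0∞} (h : x + y = 1) (hy : y ≤ ENNReal.ofReal (1 / 3)) :
    2 / 3 ≤ x := by
  have h3 : ENNReal.ofReal (1 / 3) = 1 / 3 := by
    rw [ENNReal.ofReal_div_of_pos (by norm_num)]
    simp
  rw [h3] at hy
  have h1 : (2 / 3 : ℝ≥0∞) + 1 / 3 ≤ x + 1 / 3 := by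
    rw [ENNReal.div_add_div_same, show (2 : ℝ≥0∞) + 1 = 3 by norm_num,
      ENNReal.div_self (by norm_num) (by norm_num)]
    exact h.symm.le.trans (add_le_add_right hy x)
  exact (ENNReal.add_le_add_iff_right (by simp)).1 h1

theorem apply_true_add_apply_false (μ : PMF Bool) : μ true + μ false = 1 := by
  have := μ.tsum_coe
  rwa [tsum_bool, add_comm] at this

variable {Γ : Type u} [Fintype Γ] [Nonempty Γ] {op : Γ → Γ → Γ} {I : Instance}
  {ε : ℝ} {K c₁ c₂ c₃ : ℕ} {R : PairRule}

/-- A round rejects with probability at most `1 - φ(m) / m ≤ 1 - a / m.size.size`. More than `c₁ *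
m.size.size` independent rounds all reject with probability at most `exp (-a * c₁) ≤ exp (-2) ≤
1/3`. -/
theorem Instance.Presents.two_thirds_le_accept (h : I.Presents op) (hε : 0 < ε) (hc₂ : 0 < c₂)
    (h₁ : c₁ + 1 < 2 ^ K) (h₂ : c₂ < 2 ^ K) (h₃ : c₃ < 2 ^ K) (hK : 2 ≤ K)
    {a : ℝ} (ha : ∀ m : ℕ, m ≠ 0 → a * m ≤ m.totient * m.size.size) (hc₁ : 2 ≤ a * c₁)
    (hop : IsGroupIn cyclicGroups.{u} op) : 2 / 3 ≤ cyclicTest ε c₁ c₂ c₃ K R I true := by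
  refine two_thirds_le_of_add_eq_one (apply_true_add_apply_false _) ?_
  have : NeZero I.m := ⟨h.m_ne_zero⟩
  obtain ⟨π, hπ, hO, hq⟩ := h.binary.2
  have hE := h.models (R := R) hε hK hπ hq
  obtain ⟨c₀, hrun, hl, hdec, -, -, hm, hr, -⟩ := h.run_eq (R := R) hε hc₂ h₁ h₂ h₃ hK
  set E := runEnv ε K R I
  have hO' : E.O₁ = (PMF.uniformOfFintype Γ).map π := hO
  rw [cyclicTest, map_apply_eq_expect, hrun]
  have hbin := loopExec_support (E := E) (body := mainBody.exec E) (.eq (.var .decision) (.lit 0))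
    (fun c => c.int .decision = 1 ∨ c.int .decision = 0) (fun _ _ h => h)
    (fun c _ => mainBody_decision hE.one_lt hO' c) (c₁ * I.m.size.size + 1) c₀ (Or.inr hdec)
  have h4 := expect_repeat_fail_le (E := E) (body := mainBody.exec E)
    (fun c => c.int .m = I.m ∧ c.int .len = I.m.size ∧ c.int .r = I.r) (fun _ _ h => h)
    (fun c hc c' hc' => ⟨((mainBody_avoids _ (by simp)).int_eq c c' hc').trans hc.1,
      ((mainBody_avoids _ (by simp)).int_eq c c' hc').trans hc.2.1,
      ((mainBody_avoids _ (by simp)).int_eq c c' hc').trans hc.2.2⟩)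
    (fun c hc => expect_mainBody_fail_le hE (h.lists hε hK) hO' h.size hop hc.1 hc.2.1 hc.2.2)
    (c₁ * I.m.size.size + 1) c₀ ⟨hm, hl, hr⟩
  refine le_trans (expect_mono fun c' hc' => ?_) (h4.trans ?_)
  · rcases hbin c' hc' with h5 | h5 <;> simp [failIndicator, h5]
  · refine (mul_le_mul_right (failIndicator_le_one _) _).trans ?_
    rw [mul_one]
    refine natCast_div_pow_le (NeZero.pos _) (le_trans ?_ exp_neg_two_le)
    have hm0 : (0 : ℝ) < I.m := by exact_mod_cast NeZero.pos I.m
    refine (one_sub_pow_le_exp (y := I.m.totient / I.m) (by positivity) ?_ _).trans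
      (Real.exp_le_exp.2 (neg_le_neg ?_))
    · rw [Nat.cast_sub (Nat.totient_le _), sub_div, div_self hm0.ne']
    · have h6 := ha I.m h.m_ne_zero
      have h7 : a ≤ I.m.size.size * (I.m.totient / I.m : ℝ) := by
        rw [mul_div_assoc', le_div_iff₀ hm0]
        linarith
      calc (2 : ℝ) ≤ c₁ * a := by linarith
        _ ≤ c₁ * (I.m.size.size * (I.m.totient / I.m : ℝ)) := by gcongr
        _ ≤ (c₁ * I.m.size.size + 1 : ℕ) * (I.m.totient / I.m : ℝ) := by
          push_cast
          rw [← mul_assoc]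
          gcongr
          linarith

/-- Each of the `c₁ * m.size.size + 1` rounds accepts with probability at most `2 ^ (-d₃)`, and the
union bound gives at most `1/3`. The relation `c₂ = 32 * c₃` is the one demanded by
`homProb_pow_le`. -/
theorem Instance.Presents.two_thirds_le_reject (h : I.Presents op) (hε : 0 < ε)
    (hc₂ : c₂ = 32 * c₃) (hc₃ : c₃ = 3 * (c₁ + 1) + 1)
    (h₁ : c₁ + 1 < 2 ^ K) (h₂ : c₂ < 2 ^ K) (h₃ : c₃ < 2 ^ K) (hK : 2 ≤ K)
    (hfar : HammingFar cyclicGroups.{u} ε Γ op) : 2 / 3 ≤ cyclicTest ε c₁ c₂ c₃ K R I false := by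
  refine two_thirds_le_of_add_eq_one
    ((add_comm _ _).trans (apply_true_add_apply_false (cyclicTest ε c₁ c₂ c₃ K R I))) ?_
  have : NeZero I.m := ⟨h.m_ne_zero⟩
  obtain ⟨π, hπ, hO, hq⟩ := h.binary.2
  have hE := h.models (R := R) hε hK hπ hq
  obtain ⟨c₀, hrun, hl, hdec, hd₂, hd₃, hm, hr, -⟩ :=
    h.run_eq (R := R) hε (by omega) h₁ h₂ h₃ hK
  set E := runEnv ε K R I with hEdef
  have hO' : E.O₁ = (PMF.uniformOfFintype Γ).map π := hO
  rw [cyclicTest, map_apply_eq_expect, hrun]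
  set n := c₃ * I.m.size.size.size with hn
  have hd₂' : c₀.int .d₂ = 32 * ⌈1 / ε⌉₊ * n := by
    rw [hd₂, hc₂, hn]
    ring
  have hall : ∀ p, p.Prime → p ∣ I.m → ∃ i < I.r, E.arr .prime i = p := by
    intro p hp hpm
    obtain ⟨i, rfl⟩ := h.exists_eq hp hpm
    exact ⟨i, i.2, arrayOf_eq _ i.2⟩
  have h4 := expect_repeat_pass_le (E := E) (body := mainBody.exec E)
    (fun c => c.int .m = I.m ∧ c.int .len = I.m.size ∧ c.int .r = I.r ∧ c.int .d₃ = n ∧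
      c.int .d₂ = 32 * ⌈1 / ε⌉₊ * n) (fun _ _ h => h)
    (fun c hc c' hc' => ⟨((mainBody_avoids _ (by simp)).int_eq c c' hc').trans hc.1,
      ((mainBody_avoids _ (by simp)).int_eq c c' hc').trans hc.2.1,
      ((mainBody_avoids _ (by simp)).int_eq c c' hc').trans hc.2.2.1,
      ((mainBody_avoids _ (by simp)).int_eq c c' hc').trans hc.2.2.2.1,
      ((mainBody_avoids _ (by simp)).int_eq c c' hc').trans hc.2.2.2.2⟩)
    (fun c hc => expect_mainBody_pass_le hE (h.lists hε hK) hO' h.size hall hε hfar hc.1 hc.2.1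
      hc.2.2.1 hc.2.2.2.1 hc.2.2.2.2)
    (mainBody_decision hE.one_lt hO') (c₁ * I.m.size.size + 1) c₀ ⟨hm, hl, hr, hd₃, hd₂'⟩ hdec
  refine le_trans (expect_mono fun c' hc' => ?_) (h4.trans ?_)
  · rw [passIndicator]
    simp only [decide_eq_true_eq]
    exact le_rfl
  · rw [← ENNReal.ofReal_natCast, ← ENNReal.ofReal_mul (by positivity)]
    refine ENNReal.ofReal_le_ofReal ?_
    have p1 : 0 < I.m.size := Nat.size_pos.2 (NeZero.pos _)
    have p2 : 0 < I.m.size.size := Nat.size_pos.2 p1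
    have p3 : 0 < I.m.size.size.size := Nat.size_pos.2 p2
    -- The part `3 * (c₁ + 1)` of `c₃` absorbs the constant factor, the extra `1` absorbs
    -- `m.size.size < 2 ^ m.size.size.size`.
    have h5 : 3 * (c₁ * I.m.size.size + 1) ≤ 2 ^ n := by
      have h6 := Nat.lt_size_self I.m.size.size
      have h7 : 3 * (c₁ + 1) < 2 ^ (3 * (c₁ + 1)) := Nat.lt_two_pow_self
      calc 3 * (c₁ * I.m.size.size + 1) ≤ 3 * (c₁ + 1) * I.m.size.size := by nlinarith
        _ ≤ 2 ^ (3 * (c₁ + 1)) * 2 ^ I.m.size.size.size := Nat.mul_le_mul h7.le h6.le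
        _ = 2 ^ (3 * (c₁ + 1) + I.m.size.size.size) := by rw [pow_add]
        _ ≤ 2 ^ n := by
          refine Nat.pow_le_pow_right (by norm_num) ?_
          rw [hn, hc₃, add_mul, one_mul]
          exact Nat.add_le_add_right (Nat.le_mul_of_pos_right _ p3) _
    have h8 : (3 : ℝ) * (c₁ * I.m.size.size + 1 : ℕ) ≤ 2 ^ n := by exact_mod_cast h5
    rw [one_div, inv_pow, ← div_eq_mul_inv, div_le_iff₀ (by positivity)]
    linarith

end Tester
end CyclicTesting

namespace CyclicTesting
open Real

/-! ### Iterated bit lengths against iterated logarithms -/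

section Logarithms

theorem one_le_lg (x : ℝ) : 1 ≤ lg x := le_max_left _ _

theorem logb_le_lg (x : ℝ) : logb 2 x ≤ lg x := le_max_right _ _

theorem logb_two_le_of_le_two_pow {x : ℝ} (hx : 0 < x) {n : ℕ} (h : x ≤ 2 ^ n) :
    logb 2 x ≤ n := by
  rw [logb_le_iff_le_rpow (by norm_num) hx, rpow_natCast]
  exact h

theorem lg_le_self {x : ℝ} (hx : 1 ≤ x) : lg x ≤ x := by
  refine max_le hx ?_
  rw [logb_le_iff_le_rpow (by norm_num) (by linarith)]
  -- Bernoulli's inequality `1 + x ≤ 2 ^ x`.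
  have h := one_add_mul_self_le_rpow_one_add (s := 1) (by norm_num) hx
  norm_num at h
  linarith

theorem size_le_logb_add_one {n : ℕ} {x : ℝ} (hn : 0 < n) (hx : (n : ℝ) ≤ x) :
    (n.size : ℝ) ≤ logb 2 x + 1 := by
  have h1 : 0 < n.size := Nat.size_pos.2 hn
  have h2 := Nat.lt_size.1 (show n.size - 1 < n.size by omega)
  have hn0 : (0 : ℝ) < n := by exact_mod_cast hn
  have h3 : ((n.size - 1 : ℕ) : ℝ) ≤ logb 2 x := by
    rw [le_logb_iff_rpow_le (by norm_num) (by linarith), rpow_natCast]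
    refine le_trans ?_ hx
    exact_mod_cast h2
  rw [Nat.cast_sub (by omega)] at h3
  push_cast at h3
  linarith

theorem size_le_two_mul_lg {m : ℕ} (hm : 0 < m) : (m.size : ℝ) ≤ 2 * lg m := by
  have := size_le_logb_add_one hm le_rfl
  linarith [one_le_lg m, logb_le_lg m]

theorem size_size_le_three_mul_lg_lg {m : ℕ} (hm : 0 < m) :
    (m.size.size : ℝ) ≤ 3 * lg (lg m) := by
  have h1 := size_le_logb_add_one (Nat.size_pos.2 hm) (size_le_two_mul_lg hm)
  rw [logb_mul (by norm_num) (by linarith [one_le_lg m]), logb_self_eq_one (by norm_num)] at h1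
  linarith [one_le_lg (lg m), logb_le_lg (lg m)]

theorem size_size_size_le_four_mul_lg_lg_lg {m : ℕ} (hm : 0 < m) :
    (m.size.size.size : ℝ) ≤ 4 * lg (lg (lg m)) := by
  have h0 := one_le_lg (lg m)
  have h1 := size_le_logb_add_one (x := 4 * lg (lg m)) (Nat.size_pos.2 (Nat.size_pos.2 hm))
    (by linarith [size_size_le_three_mul_lg_lg hm])
  have h2 : logb 2 (4 : ℝ) ≤ (2 : ℕ) := logb_two_le_of_le_two_pow (by norm_num) (by norm_num)
  rw [logb_mul (by norm_num) (by linarith)] at h1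
  push_cast at h2
  linarith [one_le_lg (lg (lg m)), logb_le_lg (lg (lg m))]

theorem clog_le_two_mul_lg (q : ℕ) : (Nat.clog 2 q : ℝ) ≤ 2 * lg q := by
  have h0 := one_le_lg q
  rcases le_or_gt q 1 with hq | hq
  · rw [Nat.clog_of_right_le_one hq]
    push_cast
    linarith
  · have h1 := Nat.pow_pred_clog_lt_self (b := 2) (by norm_num) hq
    have hpos := Nat.clog_pos (b := 2) (by norm_num) hq
    have h2 : ((Nat.clog 2 q - 1 : ℕ) : ℝ) ≤ logb 2 q := by
      rw [le_logb_iff_rpow_le (by norm_num) (by exact_mod_cast (by omega : 0 < q)), rpow_natCast]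
      exact_mod_cast h1.le
    rw [Nat.cast_sub (by omega)] at h2
    push_cast at h2
    linarith [logb_le_lg q]

theorem lg_mono {x y : ℝ} (hx : 0 < x) (h : x ≤ y) : lg x ≤ lg y :=
  max_le_max le_rfl (logb_le_logb_of_le (by norm_num) hx h)

end Logarithms

/-! ### The complexity bound -/

section Complexity

variable {Γ : Type u} [Fintype Γ] [Nonempty Γ] {op : Γ → Γ → Γ} {I : Instance}
  {ε : ℝ} {K c₁ c₂ c₃ : ℕ} {R : PairRule}

/-- Bounds the total number of tests. The product `L₂ * r` of rounds and primes is absorbed into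
`L₁`, which yields the summand `log m` instead of `log m * log log m`. -/
theorem parameters_mul_le {N r L₁ L₂ L₃ : ℕ} (hN : 0 < N) (h₂ : 0 < L₂) (h₃ : 0 < L₃)
    (hr : r * L₂ ≤ 9 * L₁) :
    (c₁ * L₂ + 1 + 1) * (1 + c₂ * N * L₃ + r * (1 + c₃ * L₃)) ≤
      9 * (c₁ + 2) * (c₂ + c₃ + 2) * (L₃ * (L₂ * N + L₁)) := by
  have h1 : c₁ * L₂ + 1 + 1 ≤ (c₁ + 2) * L₂ := by nlinarith
  have h2 : 1 + c₂ * N * L₃ ≤ (c₂ + 1) * (N * L₃) := by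
    have : 0 < N * L₃ := Nat.mul_pos hN h₃
    nlinarith
  have h3 : r * (1 + c₃ * L₃) ≤ (c₃ + 1) * (r * L₃) := by nlinarith [Nat.zero_le r]
  calc _ ≤ ((c₁ + 2) * L₂) * ((c₂ + 1) * (N * L₃) + (c₃ + 1) * (r * L₃)) :=
        Nat.mul_le_mul h1 (add_le_add h2 h3)
    _ ≤ ((c₁ + 2) * L₂) * ((c₂ + c₃ + 2) * (N * L₃) + (c₂ + c₃ + 2) * (r * L₃)) := by
        gcongr <;> omega
    _ = (c₁ + 2) * (c₂ + c₃ + 2) * (L₃ * (L₂ * N + r * L₂)) := by ring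
    _ ≤ (c₁ + 2) * (c₂ + c₃ + 2) * (L₃ * (9 * (L₂ * N) + 9 * L₁)) := by
        refine Nat.mul_le_mul_left _ (Nat.mul_le_mul_left _ (add_le_add ?_ hr))
        omega
    _ = _ := by ring

theorem Instance.Presents.time_le_nat (h : I.Presents op) (hε : 0 < ε) (hc₂ : 0 < c₂)
    (h₁ : c₁ + 1 < 2 ^ K) (h₂ : c₂ < 2 ^ K) (h₃ : c₃ < 2 ^ K) (hK : 2 ≤ K) :
    ∀ c ∈ (cyclicTestRun ε c₁ c₂ c₃ K R I).support,
      c.time ≤ 2840 * ((c₁ + 2) * (c₂ + c₃ + 2)) * ((I.m.size + Nat.clog 2 I.q + 1) *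
        (I.m.size.size.size * (I.m.size.size * ⌈1 / ε⌉₊ + I.m.size))) := by
  intro c hc
  obtain ⟨c₀, hrun, hl, -, hd₂, hd₃, hm, hr, ht⟩ := h.run_eq (R := R) hε hc₂ h₁ h₂ h₃ hK
  rw [hrun] at hc
  have p1 : 0 < I.m.size := Nat.size_pos.2 (Nat.pos_of_ne_zero h.m_ne_zero)
  have p2 : 0 < I.m.size.size := Nat.size_pos.2 p1
  have p3 : 0 < I.m.size.size.size := Nat.size_pos.2 p2
  have h4 := repeat_time_le (c₁ * I.m.size.size + 1) c₀ hm hl c hc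
  rw [hd₂, hd₃, hr] at h4
  have h5 := parameters_mul_le (c₁ := c₁) (c₂ := c₂) (c₃ := c₃) (one_le_ceil hε) p2 p3
    ((Nat.mul_le_mul_right _ h.r_le).trans
      (card_primeFactors_mul_size_size_le I.m h.m_ne_zero))
  set X := I.m.size.size.size * (I.m.size.size * ⌈1 / ε⌉₊ + I.m.size) with hX
  set A := (c₁ + 2) * (c₂ + c₃ + 2) with hA
  set B := I.m.size + Nat.clog 2 I.q + 1 with hB
  have hX0 : 0 < X := Nat.mul_pos p3 (by omega)
  have hA0 : 0 < A := Nat.mul_pos (by omega) (by omega)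
  have h6 : 36 * I.m.size + 50 ≤ 50 * B := by omega
  have h7 : 50 * B ≤ 50 * A * (B * X) := by
    calc 50 * B ≤ 50 * B * (A * X) := Nat.le_mul_of_pos_right _ (Nat.mul_pos hA0 hX0)
      _ = _ := by ring
  have h8 : 310 * B * ((c₁ * I.m.size.size + 1 + 1) * (1 + c₂ * ⌈1 / ε⌉₊ * I.m.size.size.size +
      I.r * (1 + c₃ * I.m.size.size.size))) ≤ 2790 * A * (B * X) := by
    calc _ ≤ 310 * B * (9 * (c₁ + 2) * (c₂ + c₃ + 2) * X) := Nat.mul_le_mul_left _ h5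
      _ = _ := by rw [hA]; ring
  calc c.time ≤ 50 * A * (B * X) + 2790 * A * (B * X) := by omega
    _ = _ := by ring

/-- Rounding `1 / ε` up costs an extra `log log m`, which `log m` absorbs. The factor is `100 = 5 *
4 * 5`. -/
theorem complexity_le {m q : ℕ} (hm : 0 < m) (hmq : m ≤ q) (hε : 0 < ε) :
    (((m.size + Nat.clog 2 q + 1) * (m.size.size.size * (m.size.size * ⌈1 / ε⌉₊ + m.size)) : ℕ) :
      ℝ) ≤ 100 * complexityBound ε m q := by
  have hm0 : (0 : ℝ) < m := by exact_mod_cast hm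
  have b0 := one_le_lg q
  have b1 : lg m ≤ lg q := lg_mono hm0 (by exact_mod_cast hmq)
  have b2 := clog_le_two_mul_lg q
  have b3 := size_le_two_mul_lg hm
  have b4 := size_size_le_three_mul_lg_lg hm
  have b5 := size_size_size_le_four_mul_lg_lg_lg hm
  have b6 : (⌈1 / ε⌉₊ : ℝ) ≤ 1 / ε + 1 := (Nat.ceil_lt_add_one (by positivity)).le
  have b7 : lg (lg m) ≤ lg m := lg_le_self (one_le_lg m)
  have b8 := one_le_lg (lg m)
  have b9 := one_le_lg (lg (lg m))
  have h1 : (m.size : ℝ) + Nat.clog 2 q + 1 ≤ 5 * lg q := by linarith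
  have h2 : (m.size.size : ℝ) * ⌈1 / ε⌉₊ + m.size ≤ 5 * (lg m + lg (lg m) / ε) := by
    calc (m.size.size : ℝ) * ⌈1 / ε⌉₊ + m.size ≤ 3 * lg (lg m) * (1 / ε + 1) + 2 * lg m := by gcongr
      _ = 3 * (lg (lg m) / ε) + 3 * lg (lg m) + 2 * lg m := by ring
      _ ≤ _ := by
        have : 0 ≤ lg (lg m) / ε := by positivity
        linarith
  rw [complexityBound]
  push_cast
  calc ((m.size : ℝ) + Nat.clog 2 q + 1) * (m.size.size.size * (m.size.size * ⌈1 / ε⌉₊ + m.size))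
      ≤ (5 * lg q) * ((4 * lg (lg (lg m))) * (5 * (lg m + lg (lg m) / ε))) := by gcongr
    _ = _ := by ring

theorem Instance.Presents.queries_le_and_time_le (h : I.Presents op) (hε : 0 < ε) (hc₂ : 0 < c₂)
    (h₁ : c₁ + 1 < 2 ^ K) (h₂ : c₂ < 2 ^ K) (h₃ : c₃ < 2 ^ K) (hK : 2 ≤ K) :
    ∀ c ∈ (cyclicTestRun ε c₁ c₂ c₃ K R I).support,
      (c.queries : ℝ) ≤
        (284000 * ((c₁ + 2) * (c₂ + c₃ + 2)) : ℕ) * complexityBound ε I.m I.q ∧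
      (c.time : ℝ) ≤
        (284000 * ((c₁ + 2) * (c₂ + c₃ + 2)) : ℕ) * complexityBound ε I.m I.q := by
  intro c hc
  have h4 := h.time_le_nat hε hc₂ h₁ h₂ h₃ hK c hc
  have h5 : c.queries ≤ c.time := by
    have := Cmd.queries_add_time_le _ _ c hc
    simpa [startConfig] using this
  have h6 : (c.time : ℝ) ≤
      (284000 * ((c₁ + 2) * (c₂ + c₃ + 2)) : ℕ) * complexityBound ε I.m I.q := by
    have h7 := complexity_le (ε := ε) (Nat.pos_of_ne_zero h.m_ne_zero)
      (h.size.trans_le h.binary.1) hε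
    calc (c.time : ℝ) ≤ ((2840 * ((c₁ + 2) * (c₂ + c₃ + 2)) * ((I.m.size + Nat.clog 2 I.q + 1) *
        (I.m.size.size.size * (I.m.size.size * ⌈1 / ε⌉₊ + I.m.size))) : ℕ) : ℝ) := by
          exact_mod_cast h4
      _ = ((2840 * ((c₁ + 2) * (c₂ + c₃ + 2)) : ℕ) : ℝ) * (((I.m.size + Nat.clog 2 I.q + 1) *
        (I.m.size.size.size * (I.m.size.size * ⌈1 / ε⌉₊ + I.m.size)) : ℕ) : ℝ) := by
          rw [← Nat.cast_mul]
      _ ≤ ((2840 * ((c₁ + 2) * (c₂ + c₃ + 2)) : ℕ) : ℝ) *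
          (100 * complexityBound ε I.m I.q) := by gcongr
      _ = _ := by push_cast; ring
  exact ⟨(by exact_mod_cast h5 : (c.queries : ℝ) ≤ c.time).trans h6, h6⟩

end Complexity
end CyclicTesting

/-! ### Choice of the constants -/

open CyclicTesting in
theorem theorem3 :
    ∃ c₁ c₂ c₃ K : ℕ, 0 < c₁ ∧ 0 < c₂ ∧ 0 < c₃ ∧ ∃ C : ℝ,
      ∀ ε : ℝ, 0 < ε → ∀ R : PairRule,
        IsTester.{u} cyclicGroups.{u} (EditFar cyclicGroups.{u} ε)
          (cyclicTest ε c₁ c₂ c₃ K R) ∧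
        IsTester.{u} cyclicGroups.{u} (HammingFar cyclicGroups.{u} ε)
          (cyclicTest ε c₁ c₂ c₃ K R) ∧
        ∀ (Γ : Type u) [Fintype Γ] [Nonempty Γ] (op : Γ → Γ → Γ) (I : Instance),
          I.Presents op →
          ∀ c ∈ (cyclicTestRun ε c₁ c₂ c₃ K R I).support,
            (c.queries : ℝ) ≤ C * complexityBound ε I.m I.q ∧
            (c.time : ℝ) ≤ C * complexityBound ε I.m I.q := by
  obtain ⟨a, ha, htot⟩ := exists_le_totient_mul_size_size
  -- Completeness fixes `c₁` through the totient constant `a`; soundness then fixes `c₃` and `c₂`,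
  -- and `K` only has to make all of them fit into a word.
  obtain ⟨c₁, hc₁⟩ := exists_nat_ge (2 / a)
  have hc₁' : 2 ≤ a * c₁ := by
    rw [div_le_iff₀ ha] at hc₁
    linarith
  have hpos : 0 < c₁ := Nat.pos_of_ne_zero fun h => by
    rw [h] at hc₁'
    norm_num at hc₁'
  obtain ⟨c₃, hc₃⟩ : ∃ c₃, c₃ = 3 * (c₁ + 1) + 1 := ⟨_, rfl⟩
  obtain ⟨c₂, hc₂⟩ : ∃ c₂, c₂ = 32 * c₃ := ⟨_, rfl⟩
  obtain ⟨K, hK⟩ : ∃ K, K = c₂ + c₁ + 2 := ⟨_, rfl⟩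
  have hlt : K < 2 ^ K := Nat.lt_two_pow_self
  have h₁ : c₁ + 1 < 2 ^ K := by omega
  have h₂ : c₂ < 2 ^ K := by omega
  have h₃ : c₃ < 2 ^ K := by omega
  refine ⟨c₁, c₂, c₃, K, hpos, by omega, by omega,
    ((284000 * ((c₁ + 2) * (c₂ + c₃ + 2)) : ℕ) : ℝ), fun ε hε R => ⟨?_, ?_, ?_⟩⟩
  · intro Γ _ _ op I hI
    exact ⟨hI.two_thirds_le_accept hε (by omega) h₁ h₂ h₃ (by omega) htot hc₁', fun hfar =>
      hI.two_thirds_le_reject hε hc₂ hc₃ h₁ h₂ h₃ (by omega) hfar.hammingFar⟩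
  · intro Γ _ _ op I hI
    exact ⟨hI.two_thirds_le_accept hε (by omega) h₁ h₂ h₃ (by omega) htot hc₁', fun hfar =>
      hI.two_thirds_le_reject hε hc₂ hc₃ h₁ h₂ h₃ (by omega) hfar⟩
  · intro Γ _ _ op I hI
    exact hI.queries_le_and_time_le hε (by omega) h₁ h₂ h₃ (by omega)
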